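/- All languages are subsets of $\{0,1\}^*$, and $\mathrm{NP}$ is the class of languages accepted by nondeterministic multi-tape Turing machines in polynomial time. An oracle machine with $m$ query tapes calls an oracle $A$ by entering a pre-query state; if query tape $j$ then holds $|i_j\rangle|b_j\rangle$ (a query string and an answer bit), the call replaces it by $|i_j\rangle|b_j\oplus A(i_j)\rangle$ for every $j$ at once and moves the machine to a post-query state, changing nothing else (a query tape without answer bit is not queried). The machine makes at most $m$ non-adaptive queries if every computation path contains at most one such call, so that the list of all queries on the path is complete before the first query is made. For $m\ge 0$ let $\mathrm{P}_{\|}^{\mathrm{NP}[m]}$ be the class of languages decided, for some oracle $A\in\mathrm{NP}$, by a deterministic oracle Turing machine that makes at most $m$ non-adaptive queries and runs in polynomial time (whatever answers it receives). Let $K\subseteq\mathbb{C}$ be any set of amplitudes that contains $0,\,1,\,\tfrac1{\sqrt2},\,-\tfrac1{\sqrt2}$, for instance $K=\mathbb{C}$. Let $\mathrm{EQP}_{\|}^{\mathrm{NP}[m]}$ be the class of languages $L$ for which there are an oracle $A\in\mathrm{NP}$, a polynomial $p$, and a quantum oracle Turing machine with transition amplitudes in $K$ and unitary time evolution, making at most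 $m$ non-adaptive queries on every computation path, such that on every input $x$ a measurement after $p(|x|)$ steps finds an accepting state with probability $1$ if $x\in L$ and with probability $0$ if $x\notin L$. Then for every integer $k\ge 0$ $$\mathrm{P}_{\|}^{\mathrm{NP}[2k]}\subseteq \mathrm{EQP}_{\|}^{\mathrm{NP}[k]}.$$ -/

import Mathlib

namespace QueryMachine

/-! ### Multi-tape configurations, shared by all machine models below -/

/-- Tape symbols: the blank `none`, the two bits, and finitely many further symbols `α`. -/
abbrev Sym (α : Type) : Type := Option (Bool ⊕ α)

/-- The symbol of a bit. -/
def bit {α : Type} (b : Bool) : Sym α := some (Sum.inl b)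

/-- Exclusive-or with `1` on bit symbols; all other symbols are fixed. -/
def flip {α : Type} : Sym α → Sym α
  | some (Sum.inl b) => some (Sum.inl (!b))
  | s => s

/-- Tape names: one input tape, `k` query tapes, and work tapes `W`. -/
abbrev TapeIdx (k : ℕ) (W : Type) : Type := Unit ⊕ (Fin k ⊕ W)

/-- A configuration: control state, contents of the two-way infinite tapes, head positions. -/
@[ext]
structure Cfg (k : ℕ) (Q α W : Type) where
  state : Q
  tape : TapeIdx k W → ℤ → Sym α
  head : TapeIdx k W → ℤ

/-- What one local step does: the next state, the symbols written, and the head moves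
(`-1` left, `0` stay, `1` right). -/
abbrev Action (k : ℕ) (Q α W : Type) : Type :=
  Q × (TapeIdx k W → Sym α) × (TapeIdx k W → SignType)

namespace Cfg

variable {k : ℕ} {Q α W : Type}

/-- The scanned symbols. -/
def read (c : Cfg k Q α W) : TapeIdx k W → Sym α := fun i => c.tape i (c.head i)

/-- Perform an action: write under every head, then move the heads. -/
def act (c : Cfg k Q α W) (a : Action k Q α W) : Cfg k Q α W where
  state := a.1
  tape := fun i => Function.update (c.tape i) (c.head i) (a.2.1 i)
  head := fun i => c.head i + ((a.2.2 i : SignType) : ℤ)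

/-- The initial configuration on input `x`: `x` stands on the cells `0, …, |x| - 1` of the input
tape, everything else is blank, all heads are at `0`. -/
def init (q₀ : Q) (x : List Bool) : Cfg k Q α W where
  state := q₀
  tape := fun i z => match i with
    | Sum.inl _ => if 0 ≤ z then (x[z.toNat]?).map Sum.inl else none
    | Sum.inr _ => none
  head := fun _ => 0

/-- The query string `w` on the `j`-th query tape. The scanned cell of a query tape is the answer
cell `b`; the query string is the maximal block of bits that starts immediately to its right. -/
def HasQuery (c : Cfg k Q α W) (j : Fin k) (w : List Bool) : Prop :=
  (∀ n (hn : n < w.length),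
    c.tape (Sum.inr (Sum.inl j)) (c.head (Sum.inr (Sum.inl j)) + 1 + n) = bit w[n]) ∧
  ∀ b : Bool, c.tape (Sum.inr (Sum.inl j)) (c.head (Sum.inr (Sum.inl j)) + 1 + w.length) ≠ bit b

open Classical in
/-- The answers `A(w₁), …, A(w_k)` of the oracle `A` to the list of strings on the query tapes. -/
noncomputable def answers (A : Language Bool) (c : Cfg k Q α W) (j : Fin k) : Bool :=
  decide (∃ w, c.HasQuery j w ∧ w ∈ A)

/-- The effect of an oracle call answered by `v`: the state becomes the post-query state, and on
each query tape the answer bit `b` becomes `b ⊕ v j`. Nothing else changes. (A query tape whose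
answer cell holds no bit is left alone, so that a call may ask fewer than `k` questions.) -/
def call (post : Q) (v : Fin k → Bool) (c : Cfg k Q α W) : Cfg k Q α W where
  state := post
  tape := fun i => match i with
    | Sum.inr (Sum.inl j) =>
        if v j then
          Function.update (c.tape (Sum.inr (Sum.inl j))) (c.head (Sum.inr (Sum.inl j)))
            (flip (c.read (Sum.inr (Sum.inl j))))
        else c.tape (Sum.inr (Sum.inl j))
    | i => c.tape i
  head := c.head

end Cfg

/-! ### Nondeterministic machines and `NP` -/

/-- A nondeterministic multi-tape Turing machine (no query tapes). -/
structure NTM where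
  Q : Type
  α : Type
  W : Type
  [finQ : Finite Q]
  [finα : Finite α]
  [finW : Finite W]
  start : Q
  accept : Q
  δ : Q → (TapeIdx 0 W → Sym α) → Set (Action 0 Q α W)

/-- `N` has an accepting computation with `t` steps on input `x`. -/
def NTM.AcceptsIn (N : NTM) (x : List Bool) (t : ℕ) : Prop :=
  ∃ c : ℕ → Cfg 0 N.Q N.α N.W, c 0 = Cfg.init N.start x ∧
    (∀ i < t, ∃ a ∈ N.δ (c i).state (c i).read, c (i + 1) = (c i).act a) ∧
    (c t).state = N.accept

/-- `NP`: the languages accepted by a nondeterministic Turing machine in polynomial time. A string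
outside the language has no accepting computation, and one in the language has an accepting
computation of polynomial length. -/
def NP : Set (Language Bool) :=
  {L | ∃ (N : NTM) (p : Polynomial ℕ), ∀ x : List Bool,
    (∀ t, N.AcceptsIn x t → x ∈ L) ∧ (x ∈ L → ∃ t ≤ p.eval x.length, N.AcceptsIn x t)}

/-! ### Deterministic oracle machines with non-adaptive queries -/

/-- A deterministic multi-tape oracle Turing machine with `k` query tapes. In the pre-query state
`pre` it calls the oracle and passes to `post`; it halts with output `b` in the states `q` with
`output q = some b`. -/
structure DOTM (k : ℕ) where
  Q : Type
  α : Type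
  W : Type
  [finQ : Finite Q]
  [finα : Finite α]
  [finW : Finite W]
  start : Q
  pre : Q
  post : Q
  output : Q → Option Bool
  δ : Q → (TapeIdx k W → Sym α) → Action k Q α W

namespace DOTM

variable {k : ℕ} (D : DOTM k)

open Classical in
/-- One step, where `O` answers the oracle calls. -/
noncomputable def step (O : Cfg k D.Q D.α D.W → Fin k → Bool) (c : Cfg k D.Q D.α D.W) :
    Cfg k D.Q D.α D.W :=
  if D.output c.state ≠ none then c
  else if c.state = D.pre then c.call D.post (O c)
  else c.act (D.δ c.state c.read)

/-- The configuration after `t` steps on input `x`. -/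
noncomputable def run (O : Cfg k D.Q D.α D.W → Fin k → Bool) (x : List Bool) (t : ℕ) :
    Cfg k D.Q D.α D.W :=
  (D.step O)^[t] (Cfg.init D.start x)

/-- `D` halts within time `p`, whatever the answers to its queries are. -/
def RunsInTime (p : Polynomial ℕ) : Prop :=
  ∀ (v : Fin k → Bool) (x : List Bool),
    D.output (D.run (fun _ => v) x (p.eval x.length)).state ≠ none

/-- `D` calls the oracle at most once, with the list of all its queries on the query tapes. Thus
it asks at most `k` queries, and the list of them is complete before the first one is made. -/
def NonAdaptive : Prop :=
  ∀ (v : Fin k → Bool) (x : List Bool) (s t : ℕ), s < t →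
    (D.run (fun _ => v) x s).state = D.pre → (D.run (fun _ => v) x t).state ≠ D.pre

end DOTM

open Classical in
/-- `P` with at most `k` non-adaptive queries to the oracle `A`. -/
def PPar (A : Language Bool) (k : ℕ) : Set (Language Bool) :=
  {L | ∃ (D : DOTM k) (p : Polynomial ℕ), D.RunsInTime p ∧ D.NonAdaptive ∧
    ∀ x : List Bool,
      D.output (D.run (Cfg.answers A) x (p.eval x.length)).state = some (decide (x ∈ L))}

/-- `P` with at most `k` non-adaptive queries to a set in `NP`. -/
def PParNP (k : ℕ) : Set (Language Bool) :=
  {L | ∃ A ∈ NP, L ∈ PPar A k}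

/-! ### Quantum oracle machines with non-adaptive queries -/

/-- A quantum multi-tape oracle Turing machine with `k` query tapes. `δ q s a` is the amplitude of
action `a` in state `q` with scanned symbols `s`. In the pre-query state `pre` the machine calls
the oracle and passes to `post`. -/
structure QOTM (k : ℕ) where
  Q : Type
  α : Type
  W : Type
  [finQ : Finite Q]
  [finα : Finite α]
  [finW : Finite W]
  start : Q
  pre : Q
  post : Q
  accept : Set Q
  δ : Q → (TapeIdx k W → Sym α) → (Action k Q α W →₀ ℂ)

namespace QOTM

variable {k : ℕ} (M : QOTM k)

/-- Configurations, the basis states. -/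
abbrev Conf : Type := Cfg k M.Q M.α M.W

/-- Superpositions of configurations. -/
abbrev State : Type := M.Conf →₀ ℂ

open Classical in
/-- The successor of a basis state: an oracle call in the pre-query state, and otherwise the
superposition of the results of all actions with the amplitudes given by `δ`. -/
noncomputable def stepBasis (A : Language Bool) (c : M.Conf) : M.State :=
  if c.state = M.pre then Finsupp.single (c.call M.post (c.answers A)) 1
  else Finsupp.mapDomain c.act (M.δ c.state c.read)

/-- The time evolution operator with oracle `A`. -/
noncomputable def evolve (A : Language Bool) : M.State →ₗ[ℂ] M.State :=
  Finsupp.linearCombination ℂ (M.stepBasis A)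

/-- The squared norm of a superposition. -/
noncomputable def normSq (ψ : M.State) : ℝ := ψ.sum fun _ z => ‖z‖ ^ 2

/-- The time evolution is unitary: norm-preserving and invertible. -/
def WellFormed : Prop :=
  ∀ A : Language Bool, Function.Bijective (M.evolve A) ∧
    ∀ ψ : M.State, M.normSq (M.evolve A ψ) = M.normSq ψ

/-- The superposition after `t` steps on input `x`. -/
noncomputable def run (A : Language Bool) (x : List Bool) (t : ℕ) : M.State :=
  (M.evolve A)^[t] (Finsupp.single (Cfg.init M.start x) 1)

open Classical in
/-- The probability that a measurement after `t` steps shows an accepting state. -/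
noncomputable def acceptProb (A : Language Bool) (x : List Bool) (t : ℕ) : ℝ :=
  (M.run A x t).sum fun c z => if c.state ∈ M.accept then ‖z‖ ^ 2 else 0

/-- `c 0, …, c T` is a computation path on input `x`: every transition has nonzero amplitude. -/
def IsPath (A : Language Bool) (x : List Bool) (T : ℕ) (c : ℕ → M.Conf) : Prop :=
  c 0 = Cfg.init M.start x ∧ ∀ i < T, M.stepBasis A (c i) (c (i + 1)) ≠ 0

/-- Every computation path of length `T` on input `x` calls the oracle at most once, with the list
of all queries of this path on the query tapes. Thus every path asks at most `k` queries, and the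
list of them is complete before the first one is made. -/
def NonAdaptive (A : Language Bool) (x : List Bool) (T : ℕ) : Prop :=
  ∀ c : ℕ → M.Conf, M.IsPath A x T c →
    ∀ s t, s < t → t < T → (c s).state = M.pre → (c t).state ≠ M.pre

end QOTM

open Classical in
/-- `EQP` with at most `k` non-adaptive queries to the oracle `A`, for machines with transition
amplitudes in `K`: exact acceptance after a polynomial number of steps.
For `K = Set.univ` all complex amplitudes are allowed. -/
def EQPPar (K : Set ℂ) (A : Language Bool) (k : ℕ) : Set (Language Bool) :=
  {L | ∃ (M : QOTM k) (p : Polynomial ℕ), (∀ q s a, M.δ q s a ∈ K) ∧ M.WellFormed ∧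
    ∀ x : List Bool, M.NonAdaptive A x (p.eval x.length) ∧
      M.acceptProb A x (p.eval x.length) = if x ∈ L then 1 else 0}

/-- `EQP` with at most `k` non-adaptive queries to a set in `NP`, amplitudes in `K`. -/
def EQPParNP (K : Set ℂ) (k : ℕ) : Set (Language Bool) :=
  {L | ∃ A ∈ NP, L ∈ EQPPar K A k}

end QueryMachine

/-! Fix an input. Let `out v` be the output of the deterministic machine when its 2k simultaneous
queries are answered by `v`, and let `a` be the vector of true answers. Let c be the largest number
of changes of `out` along an increasing chain of vectors that starts at 0 and stays below `a`. Every
change raises the Hamming weight, so c ≤ 2k. By maximality `out` takes the same value at the end of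
a longest chain and at `a`, so `out a` is `out 0` plus the parity of c (`exists_chain_length`).

That there are at least i changes is an NP property: a chain below `a` only needs positive answers,
which have witnesses, and `out` is computed without an oracle. Formally it is a monotone combination
of finitely many NP languages (`combine_mem_NP`, fed by `outLang_mem_NP` and `queryLang_mem_NP`).
These threshold questions form a new oracle. Since c ≤ 2k, the number c is odd iff for some j < k
the thresholds 2j+1 and 2j+2 are answered differently (`exists_xor_iff_odd`). Hence k exclusive-ors
of two answers each, together with `out 0`, decide the language (`exists_xor_oracle`).

Deutsch's algorithm finds the exclusive-or of two answers exactly with one query (`exists_deutsch`).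
The two questions of a pair differ in the first bit of the query string only, and this bit is put
into superposition. The k instances use one query tape each and share a single call. They end in one
basis configuration up to a phase, so the remaining computation is classical.

It remains to make the whole machine unitary. A step is a Hadamard gate, which is a Hermitian
involution, followed by a bijection of the configurations (`bijective_and_sqNorm_of_involution`).
The bijection comes from a permutation of the pairs of a state and scanned symbols, with head moves
determined by the new state. A classical control program becomes injective by recording its history
on a log tape (`injOn_logRule`), and its partial rule then extends to a permutation
(`exists_perm_extending`). In the subroutine the branches differ only in cell contents, never in the
control state, so the oracle is called at one fixed time (`eq_of_state_eq_pre`). -/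

namespace QueryMachine

attribute [instance] NTM.finQ NTM.finα NTM.finW DOTM.finQ DOTM.finα DOTM.finW

/-! ### Symbols and tapes -/

/-- The bit a symbol stands for, if any. -/
def bitOf {α : Type} : Sym α → Option Bool
  | some (Sum.inl b) => some b
  | _ => none

@[simp] lemma bitOf_bit {α : Type} (b : Bool) : bitOf (bit b : Sym α) = some b := rfl

@[simp] lemma bitOf_none {α : Type} : bitOf (none : Sym α) = none := rfl

@[simp] lemma bitOf_map_inl {α : Type} (o : Option Bool) :
    bitOf (o.map Sum.inl : Sym α) = o := by
  cases o <;> rfl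

lemma bitOf_eq_some {α : Type} {s : Sym α} {b : Bool} : bitOf s = some b ↔ s = bit b := by
  rcases s with _ | ⟨_ | _⟩ <;> simp [bitOf, bit]

lemma bitOf_eq_none {α : Type} {s : Sym α} : bitOf s = none ↔ ∀ b, s ≠ bit b := by
  rcases s with _ | ⟨_ | _⟩ <;> simp [bitOf, bit]

lemma bit_injective {α : Type} : Function.Injective (bit : Bool → Sym α) := by
  intro a b h
  simpa [bit] using h

@[simp] lemma flip_bit {α : Type} (b : Bool) : flip (bit b : Sym α) = bit (!b) := rfl

@[simp] lemma flip_flip {α : Type} (s : Sym α) : flip (flip s) = s := by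
  rcases s with _ | ⟨_ | _⟩ <;> simp [flip]

/-- Change of the alphabet of further symbols. -/
def symMap {α β : Type} (f : α → β) : Sym α → Sym β := Option.map (Sum.map id f)

@[simp] lemma symMap_none {α β : Type} (f : α → β) : symMap f none = none := rfl

@[simp] lemma symMap_map_inl {α β : Type} (f : α → β) (o : Option Bool) :
    symMap f (o.map Sum.inl) = o.map Sum.inl := by
  cases o <;> rfl

@[simp] lemma bitOf_symMap {α β : Type} (f : α → β) (s : Sym α) :
    bitOf (symMap f s) = bitOf s := by
  rcases s with _ | ⟨_ | _⟩ <;> rfl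

lemma symMap_injective {α β : Type} {f : α → β} (hf : Function.Injective f) :
    Function.Injective (symMap f) :=
  Option.map_injective (Function.injective_id.sumMap hf)

/-- A left inverse of an injective map between types of symbols. -/
noncomputable def decode {α β : Type} (e : Sym α → Sym β) : Sym β → Sym α := Function.invFun e

lemma decode_apply {α β : Type} {e : Sym α → Sym β} (he : Function.Injective e) (s : Sym α) :
    decode e (e s) = s :=
  Function.leftInverse_invFun he s

/-- The tape with the string `w` on the cells `0, …, |w| - 1`. -/
def strTape {α : Type} (w : List Bool) : ℤ → Sym α :=
  fun z => if 0 ≤ z then (w[z.toNat]?).map Sum.inl else none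

@[simp] lemma strTape_nil {α : Type} : (strTape [] : ℤ → Sym α) = fun _ => none := by
  funext z
  simp [strTape]

@[simp] lemma strTape_natCast {α : Type} (w : List Bool) (n : ℕ) :
    (strTape w (n : ℤ) : Sym α) = (w[n]?).map Sum.inl := by
  simp [strTape]

lemma strTape_of_neg {α : Type} (w : List Bool) {z : ℤ} (hz : z < 0) :
    (strTape w z : Sym α) = none := by
  simp [strTape, hz]

lemma strTape_concat {α : Type} (w : List Bool) (b : Bool) :
    Function.update (strTape w : ℤ → Sym α) w.length (bit b) = strTape (w ++ [b]) := by
  funext z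
  by_cases hz : z = w.length
  · subst hz
    simp [bit]
  · rw [Function.update_of_ne hz]
    rcases lt_or_ge z 0 with h | h
    · simp [strTape_of_neg _ h]
    · lift z to ℕ using h
      simp only [strTape_natCast]
      have hz' : z ≠ w.length := by exact_mod_cast hz
      rcases lt_or_gt_of_ne hz' with h | h
      · rw [List.getElem?_append_left h]
      · rw [List.getElem?_eq_none (by omega), List.getElem?_eq_none (by simp; omega)]

lemma symMap_strTape {α β : Type} (f : α → β) (w : List Bool) (z : ℤ) :
    symMap f (strTape w z) = strTape w z := by
  unfold strTape
  split_ifs <;> simp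

/-! ### Configurations that contain a simulated configuration -/

namespace Cfg

variable {k k₁ k₂ k₃ : ℕ} {Q Q₁ Q₂ Q₃ α α₁ α₂ α₃ W W₁ W₂ W₃ : Type}

@[simp] lemma init_head (q : Q) (x : List Bool) (i : TapeIdx k W) :
    (init q x : Cfg k Q α W).head i = 0 := rfl

@[simp] lemma init_state (q : Q) (x : List Bool) :
    (init q x : Cfg k Q α W).state = q := rfl

@[simp] lemma act_state (c : Cfg k Q α W) (a : Action k Q α W) : (c.act a).state = a.1 := rfl

lemma act_tape (c : Cfg k Q α W) (a : Action k Q α W) (i : TapeIdx k W) :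
    (c.act a).tape i = Function.update (c.tape i) (c.head i) (a.2.1 i) := rfl

lemma act_head (c : Cfg k Q α W) (a : Action k Q α W) (i : TapeIdx k W) :
    (c.act a).head i = c.head i + ((a.2.2 i : SignType) : ℤ) := rfl

lemma act_tape_of_eq (c : Cfg k Q α W) (a : Action k Q α W) (i : TapeIdx k W)
    (h : a.2.1 i = c.read i) : (c.act a).tape i = c.tape i := by
  rw [act_tape, h]
  exact Function.update_eq_self _ _

lemma act_self (c : Cfg k Q α W) (q : Q) :
    c.act (q, c.read, 0) = { c with state := q } := by
  ext i
  · rfl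
  · simp [act_tape_of_eq c (q, c.read, 0) i rfl]
  · simp [act_head]

/-- The configuration `c₂` contains, on the tapes selected by `ι` and in the alphabet given by `e`,
the tapes and heads of `c₁`. -/
structure Sees (ι : TapeIdx k₁ W₁ → TapeIdx k₂ W₂) (e : Sym α₁ → Sym α₂)
    (c₂ : Cfg k₂ Q₂ α₂ W₂) (c₁ : Cfg k₁ Q₁ α₁ W₁) : Prop where
  tape : ∀ i z, c₂.tape (ι i) z = e (c₁.tape i z)
  head : ∀ i, c₂.head (ι i) = c₁.head i

/-- The action `a`, performed on the tapes selected by `ι`; the other tapes keep the scanned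
symbols `s`. -/
noncomputable def liftAction (ι : TapeIdx k₁ W₁ → TapeIdx k₂ W₂) (e : Sym α₁ → Sym α₂)
    (q : Q₂) (s : TapeIdx k₂ W₂ → Sym α₂) (a : Action k₁ Q₁ α₁ W₁) : Action k₂ Q₂ α₂ W₂ :=
  (q, Function.extend ι (e ∘ a.2.1) s, Function.extend ι a.2.2 0)

@[simp] lemma liftAction_fst (ι : TapeIdx k₁ W₁ → TapeIdx k₂ W₂) (e : Sym α₁ → Sym α₂)
    (q : Q₂) (s : TapeIdx k₂ W₂ → Sym α₂) (a : Action k₁ Q₁ α₁ W₁) :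
    (liftAction ι e q s a).1 = q := rfl

section Sees

variable {ι : TapeIdx k₁ W₁ → TapeIdx k₂ W₂} {e : Sym α₁ → Sym α₂}
  {c₂ : Cfg k₂ Q₂ α₂ W₂} {c₁ : Cfg k₁ Q₁ α₁ W₁}

lemma Sees.read (h : Sees ι e c₂ c₁) (i : TapeIdx k₁ W₁) : c₂.read (ι i) = e (c₁.read i) := by
  simp only [Cfg.read, h.head, h.tape]

lemma Sees.decode_read (h : Sees ι e c₂ c₁) (he : Function.Injective e) :
    (fun i => decode e (c₂.read (ι i))) = c₁.read := by
  funext i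
  rw [h.read, decode_apply he]

lemma Sees.act (h : Sees ι e c₂ c₁) (hι : Function.Injective ι) (q : Q₂)
    (a : Action k₁ Q₁ α₁ W₁) : Sees ι e (c₂.act (liftAction ι e q c₂.read a)) (c₁.act a) where
  tape i z := by
    rw [act_tape, act_tape, h.head]
    simp only [liftAction, hι.extend_apply, Function.comp]
    by_cases hz : z = c₁.head i
    · subst hz
      simp
    · rw [Function.update_of_ne hz, Function.update_of_ne hz, h.tape]
  head i := by
    rw [act_head, act_head, h.head]
    simp only [liftAction, hι.extend_apply]

lemma act_liftAction_tape (c₂ : Cfg k₂ Q₂ α₂ W₂) (q : Q₂) (a : Action k₁ Q₁ α₁ W₁)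
    {i : TapeIdx k₂ W₂} (hi : ∀ j, ι j ≠ i) :
    (c₂.act (liftAction ι e q c₂.read a)).tape i = c₂.tape i := by
  apply act_tape_of_eq
  exact Function.extend_apply' _ _ _ (by rintro ⟨j, hj⟩; exact hi j hj)

lemma act_liftAction_head (c₂ : Cfg k₂ Q₂ α₂ W₂) (q : Q₂) (s : TapeIdx k₂ W₂ → Sym α₂)
    (a : Action k₁ Q₁ α₁ W₁) {i : TapeIdx k₂ W₂} (hi : ∀ j, ι j ≠ i) :
    (c₂.act (liftAction ι e q s a)).head i = c₂.head i := by
  rw [act_head]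
  simp only [liftAction]
  rw [Function.extend_apply' _ _ _ (by rintro ⟨j, hj⟩; exact hi j hj)]
  simp

lemma Sees.congr {Q₃ Q₄ : Type} {c₃ : Cfg k₂ Q₃ α₂ W₂} {c₄ : Cfg k₁ Q₄ α₁ W₁}
    (h : Sees ι e c₂ c₁)
    (ht : ∀ i, c₃.tape (ι i) = c₂.tape (ι i)) (hh : ∀ i, c₃.head (ι i) = c₂.head (ι i))
    (ht' : c₄.tape = c₁.tape) (hh' : c₄.head = c₁.head) :
    Sees ι e c₃ c₄ where
  tape i z := by rw [ht, h.tape, ht']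
  head i := by rw [hh, h.head, hh']

lemma Sees.act_of_disjoint (h : Sees ι e c₂ c₁) {ι' : TapeIdx k₃ W₃ → TapeIdx k₂ W₂}
    {e' : Sym α₃ → Sym α₂} (hd : ∀ i j, ι' j ≠ ι i) (q : Q₂) (a : Action k₃ Q₃ α₃ W₃) :
    Sees ι e (c₂.act (liftAction ι' e' q c₂.read a)) c₁ :=
  h.congr (fun i => act_liftAction_tape _ _ _ (hd i))
    (fun i => act_liftAction_head _ _ _ _ (hd i)) rfl rfl

end Sees

/-! ### Query strings -/

lemma hasQuery_iff (c : Cfg k Q α W) (j : Fin k) (w : List Bool) :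
    c.HasQuery j w ↔ ∀ n ≤ w.length, bitOf (c.tape (Sum.inr (Sum.inl j))
      (c.head (Sum.inr (Sum.inl j)) + 1 + n)) = w[n]? := by
  constructor
  · rintro ⟨h₁, h₂⟩ n hn
    rcases hn.lt_or_eq with hn | rfl
    · rw [h₁ n hn, bitOf_bit, List.getElem?_eq_getElem hn]
    · rw [List.getElem?_eq_none le_rfl, bitOf_eq_none]
      exact h₂
  · intro h
    refine ⟨fun n hn => ?_, ?_⟩
    · rw [← bitOf_eq_some, h n hn.le, List.getElem?_eq_getElem hn]
    · rw [← bitOf_eq_none, h _ le_rfl, List.getElem?_eq_none le_rfl]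

/-- The string ends at the first cell without a bit, so two candidates of different lengths would
disagree about that cell. Thus an answer concerns one well-defined string. -/
lemma HasQuery.unique {c : Cfg k Q α W} {j : Fin k} {w w' : List Bool}
    (h : c.HasQuery j w) (h' : c.HasQuery j w') : w = w' := by
  rw [hasQuery_iff] at h h'
  have key : ∀ n, n ≤ w.length → n ≤ w'.length → w[n]? = w'[n]? := fun n hn hn' => by
    rw [← h n hn, ← h' n hn']
  have hlen : w.length = w'.length := by
    rcases lt_trichotomy w.length w'.length with hl | hl | hl
    · have := key w.length le_rfl hl.le
      rw [List.getElem?_eq_none le_rfl, List.getElem?_eq_getElem hl] at this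
      simp at this
    · exact hl
    · have := key w'.length hl.le le_rfl
      rw [List.getElem?_eq_none le_rfl, List.getElem?_eq_getElem hl] at this
      simp at this
  apply List.ext_getElem?
  intro n
  rcases le_or_gt n w.length with hn | hn
  · exact key n hn (hlen ▸ hn)
  · rw [List.getElem?_eq_none hn.le, List.getElem?_eq_none (by omega)]

lemma answers_eq_true {A : Language Bool} {c : Cfg k Q α W} {j : Fin k} :
    c.answers A j = true ↔ ∃ w, c.HasQuery j w ∧ w ∈ A := by
  simp [answers]

open Classical in
lemma HasQuery.answers_eq {A : Language Bool} {c : Cfg k Q α W} {j : Fin k} {w : List Bool}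
    (h : c.HasQuery j w) : c.answers A j = decide (w ∈ A) := by
  unfold answers
  congr 1
  refine propext ⟨fun ⟨w', h', hA⟩ => h.unique h' ▸ hA, fun hA => ⟨w, h, hA⟩⟩

end Cfg

/-! ### Polynomials -/

lemma eval_mono (p : Polynomial ℕ) {m n : ℕ} (h : m ≤ n) : p.eval m ≤ p.eval n := by
  simp only [Polynomial.eval_eq_sum_range]
  gcongr

/-! ### Accepting computations -/

section Acceptance

variable {Q α W : Type} {δ : Q → (TapeIdx 0 W → Sym α) → Set (Action 0 Q α W)} {acc : Q}

/-- The rule `δ` has an accepting computation with `t` steps from the configuration `c`. -/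
def AccFrom (δ : Q → (TapeIdx 0 W → Sym α) → Set (Action 0 Q α W)) (acc : Q) :
    ℕ → Cfg 0 Q α W → Prop
  | 0, c => c.state = acc
  | t + 1, c => ∃ a ∈ δ c.state c.read, AccFrom δ acc t (c.act a)

lemma accFrom_iff (t : ℕ) (c₀ : Cfg 0 Q α W) :
    AccFrom δ acc t c₀ ↔ ∃ c : ℕ → Cfg 0 Q α W, c 0 = c₀ ∧
      (∀ i < t, ∃ a ∈ δ (c i).state (c i).read, c (i + 1) = (c i).act a) ∧
      (c t).state = acc := by
  induction t generalizing c₀ with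
  | zero =>
    constructor
    · intro h
      exact ⟨fun _ => c₀, rfl, by simp, h⟩
    · rintro ⟨c, rfl, -, h⟩
      exact h
  | succ t ih =>
    constructor
    · rintro ⟨a, ha, h⟩
      obtain ⟨c, h0, hs, hacc⟩ := (ih _).1 h
      refine ⟨fun n => n.casesOn c₀ c, rfl, fun i hi => ?_, hacc⟩
      cases i with
      | zero => exact ⟨a, ha, h0⟩
      | succ i => exact hs i (by omega)
    · rintro ⟨c, rfl, hs, hacc⟩
      obtain ⟨a, ha, h1⟩ := hs 0 (by omega)
      refine ⟨a, ha, (ih _).2 ⟨fun n => c (n + 1), h1, fun i hi => hs (i + 1) (by omega), hacc⟩⟩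

lemma NTM.acceptsIn_iff (N : NTM) (x : List Bool) (t : ℕ) :
    N.AcceptsIn x t ↔ AccFrom N.δ N.accept t (Cfg.init N.start x) :=
  (accFrom_iff _ _).symm

/-- Every accepting computation from `c` leads in `n` steps to `c'`, and `c'` is reachable. -/
def Leads (δ : Q → (TapeIdx 0 W → Sym α) → Set (Action 0 Q α W)) (acc : Q) (n : ℕ)
    (c c' : Cfg 0 Q α W) : Prop :=
  ∀ t, AccFrom δ acc t c ↔ ∃ t', t = n + t' ∧ AccFrom δ acc t' c'

lemma Leads.refl (c : Cfg 0 Q α W) : Leads δ acc 0 c c := fun t => by simp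

lemma Leads.trans {m n : ℕ} {c c' c'' : Cfg 0 Q α W} (h : Leads δ acc m c c')
    (h' : Leads δ acc n c' c'') : Leads δ acc (m + n) c c'' := fun t => by
  rw [h t]
  constructor
  · rintro ⟨t', rfl, ht'⟩
    obtain ⟨t'', rfl, h''⟩ := (h' t').1 ht'
    exact ⟨t'', by omega, h''⟩
  · rintro ⟨t'', rfl, h''⟩
    exact ⟨n + t'', by omega, (h' _).2 ⟨t'', rfl, h''⟩⟩

/-- No computation may stop at `c`, and there is only one way on. Since `Leads` is an equivalence
with exact lengths, chains of such steps give soundness and completeness of the deterministic phases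
at once. -/
lemma Leads.single {c : Cfg 0 Q α W} {a : Action 0 Q α W}
    (hc : c.state ≠ acc) (ha : δ c.state c.read = {a}) : Leads δ acc 1 c (c.act a) := fun t => by
  cases t with
  | zero =>
    simp only [AccFrom, hc, false_iff]
    rintro ⟨t', h, -⟩
    omega
  | succ t =>
    simp only [AccFrom, ha, Set.mem_singleton_iff, exists_eq_left]
    constructor
    · intro h
      exact ⟨t, by omega, h⟩
    · rintro ⟨t', h, h'⟩
      obtain rfl : t = t' := by omega
      exact h'

end Acceptance

/-! ### Copying a string to blank tapes -/

section Moves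

variable {k : ℕ} {Q α W : Type}

open Classical in
/-- Write the bit `b` on the tapes `tgt` and move right on these tapes and on `src`. -/
noncomputable def copyAction (src : TapeIdx k W) (tgt : Set (TapeIdx k W)) (q : Q) (b : Bool)
    (s : TapeIdx k W → Sym α) : Action k Q α W :=
  (q, fun i => if i ∈ tgt then bit b else s i, fun i => if i = src ∨ i ∈ tgt then 1 else 0)

open Classical in
/-- Move the heads on the tapes `tgt`. -/
noncomputable def moveAction (tgt : Set (TapeIdx k W)) (q : Q) (m : SignType)
    (s : TapeIdx k W → Sym α) : Action k Q α W :=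
  (q, s, fun i => if i ∈ tgt then m else 0)

namespace Cfg

variable (c : Cfg k Q α W)

@[simp] lemma act_move_state (tgt : Set (TapeIdx k W)) (q : Q) (m : SignType) :
    (c.act (moveAction tgt q m c.read)).state = q := rfl

@[simp] lemma act_move_tape (tgt : Set (TapeIdx k W)) (q : Q) (m : SignType) :
    (c.act (moveAction tgt q m c.read)).tape = c.tape :=
  funext fun _ => act_tape_of_eq _ _ _ rfl

lemma act_move_head_mem {tgt : Set (TapeIdx k W)} (q : Q) (m : SignType) {i : TapeIdx k W}
    (hi : i ∈ tgt) : (c.act (moveAction tgt q m c.read)).head i = c.head i + (m : ℤ) := by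
  simp [act_head, moveAction, hi]

lemma act_move_head_not_mem {tgt : Set (TapeIdx k W)} (q : Q) (m : SignType) {i : TapeIdx k W}
    (hi : i ∉ tgt) : (c.act (moveAction tgt q m c.read)).head i = c.head i := by
  simp [act_head, moveAction, hi]

lemma act_copy_tape_mem (src : TapeIdx k W) {tgt : Set (TapeIdx k W)} (q : Q) (b : Bool)
    {i : TapeIdx k W} (hi : i ∈ tgt) : (c.act (copyAction src tgt q b c.read)).tape i =
      Function.update (c.tape i) (c.head i) (bit b) := by
  simp [act_tape, copyAction, hi]

lemma act_copy_tape_not_mem (src : TapeIdx k W) {tgt : Set (TapeIdx k W)} (q : Q) (b : Bool)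
    {i : TapeIdx k W} (hi : i ∉ tgt) :
    (c.act (copyAction src tgt q b c.read)).tape i = c.tape i := by
  apply act_tape_of_eq
  simp [copyAction, hi]

lemma act_copy_head_mem {src : TapeIdx k W} {tgt : Set (TapeIdx k W)} (q : Q) (b : Bool)
    {i : TapeIdx k W} (hi : i = src ∨ i ∈ tgt) :
    (c.act (copyAction src tgt q b c.read)).head i = c.head i + 1 := by
  simp [act_head, copyAction, hi]

lemma act_copy_head_not_mem {src : TapeIdx k W} {tgt : Set (TapeIdx k W)} (q : Q) (b : Bool)
    {i : TapeIdx k W} (hi : ¬(i = src ∨ i ∈ tgt)) :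
    (c.act (copyAction src tgt q b c.read)).head i = c.head i := by
  simp [act_head, copyAction, hi]

end Cfg

end Moves

section Copy

variable {Q α W : Type} {δ : Q → (TapeIdx 0 W → Sym α) → Set (Action 0 Q α W)} {acc : Q}
  {cp rw nxt : Q} {src : TapeIdx 0 W} {tgt : Set (TapeIdx 0 W)} {t₀ : TapeIdx 0 W}

/-- Induction on the part `w` that is still to be copied, with `l` already written. The extra step
turns around: it leaves the target heads on the last written cell, whence the offset `-1`. -/
lemma leads_copy (hcp : cp ≠ acc) (hsrc : src ∉ tgt)
    (hδ : ∀ s, δ cp s = {match bitOf (s src) with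
      | some b => copyAction src tgt cp b s
      | none => moveAction tgt rw (-1) s})
    (l w : List Bool) (c : Cfg 0 Q α W) (hc : c.state = cp)
    (hs : ∀ n ≤ w.length, bitOf (c.tape src (c.head src + n)) = w[n]?)
    (ht : ∀ i ∈ tgt, c.tape i = strTape l) (hh : ∀ i ∈ tgt, c.head i = l.length) :
    ∃ c', Leads δ acc (w.length + 1) c c' ∧ c'.state = rw ∧
      (∀ i ∈ tgt, c'.tape i = strTape (l ++ w)) ∧
      (∀ i ∈ tgt, c'.head i = (l ++ w).length + (-1 : ℤ)) ∧
      (∀ i, i ∉ tgt → c'.tape i = c.tape i) ∧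
      (∀ i, i ∉ tgt → i ≠ src → c'.head i = c.head i) := by
  induction w generalizing l c with
  | nil =>
    have h0 := hs 0 le_rfl
    simp only [Nat.cast_zero, add_zero, List.getElem?_nil] at h0
    refine ⟨c.act (moveAction tgt rw (-1) c.read), Leads.single (hc ▸ hcp) ?_, rfl, ?_, ?_, ?_, ?_⟩
    · rw [hc, hδ, show c.read src = c.tape src (c.head src) from rfl, h0]
    · intro i hi
      simp [ht i hi]
    · intro i hi
      rw [c.act_move_head_mem _ _ hi, hh i hi]
      simp
    · intro i _
      simp
    · intro i hi _
      exact c.act_move_head_not_mem _ _ hi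
  | cons b w ih =>
    have h0 := hs 0 (by simp)
    simp only [Nat.cast_zero, add_zero, List.getElem?_cons_zero] at h0
    set c₁ := c.act (copyAction src tgt cp b c.read) with hc₁
    have hstep : Leads δ acc 1 c c₁ := by
      refine Leads.single (hc ▸ hcp) ?_
      rw [hc, hδ, show c.read src = c.tape src (c.head src) from rfl, h0]
    obtain ⟨c', hl, h1, h2, h3, h4, h5⟩ := ih (l ++ [b]) c₁ rfl
      (fun n hn => by
        have := hs (n + 1) (by simpa using hn)
        rw [List.getElem?_cons_succ] at this
        rw [← this, hc₁, c.act_copy_tape_not_mem _ _ _ hsrc,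
          c.act_copy_head_mem _ _ (Or.inl rfl)]
        push_cast
        ring_nf)
      (fun i hi => by
        rw [hc₁, c.act_copy_tape_mem _ _ _ hi, ht i hi, hh i hi, strTape_concat])
      (fun i hi => by
        rw [hc₁, c.act_copy_head_mem _ _ (Or.inr hi), hh i hi]
        simp)
    refine ⟨c', ?_, h1, ?_, ?_, ?_, ?_⟩
    · have := hstep.trans hl
      rwa [add_comm 1] at this
    · simpa using h2
    · simpa using h3
    · intro i hi
      rw [h4 i hi, hc₁, c.act_copy_tape_not_mem _ _ _ hi]
    · intro i hi hi'
      rw [h5 i hi hi', hc₁, c.act_copy_head_not_mem _ _ (by tauto)]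

/-- All target heads move in lockstep, so it suffices to look for the left end on the single tape
`t₀`: cell `-1` is blank there, and one step to the right puts every head on cell `0`. -/
lemma leads_rewind (hrw : rw ≠ acc) (ht₀ : t₀ ∈ tgt)
    (hδ : ∀ s, δ rw s = {match bitOf (s t₀) with
      | some _ => moveAction tgt rw (-1) s
      | none => moveAction tgt nxt 1 s})
    (w : List Bool) (m : ℕ) (hm : m ≤ w.length) (c : Cfg 0 Q α W) (hc : c.state = rw)
    (ht : c.tape t₀ = strTape w) (hh : ∀ i ∈ tgt, c.head i = m + (-1 : ℤ)) :
    ∃ c', Leads δ acc (m + 1) c c' ∧ c'.state = nxt ∧ c'.tape = c.tape ∧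
      (∀ i ∈ tgt, c'.head i = 0) ∧ (∀ i, i ∉ tgt → c'.head i = c.head i) := by
  induction m generalizing c with
  | zero =>
    refine ⟨c.act (moveAction tgt nxt 1 c.read), Leads.single (hc ▸ hrw) ?_, rfl, ?_, ?_, ?_⟩
    · rw [hc, hδ, show c.read t₀ = c.tape t₀ (c.head t₀) from rfl, ht, hh t₀ ht₀,
        strTape_of_neg _ (by simp)]
      rfl
    · simp
    · intro i hi
      rw [c.act_move_head_mem _ _ hi, hh i hi]
      simp
    · intro i hi
      exact c.act_move_head_not_mem _ _ hi
  | succ m ih =>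
    set c₁ := c.act (moveAction tgt rw (-1) c.read) with hc₁
    have hstep : Leads δ acc 1 c c₁ := by
      refine Leads.single (hc ▸ hrw) ?_
      rw [hc, hδ, show c.read t₀ = c.tape t₀ (c.head t₀) from rfl, ht, hh t₀ ht₀]
      have : ((m + 1 : ℕ) : ℤ) + -1 = (m : ℕ) := by push_cast; ring
      rw [this, strTape_natCast, List.getElem?_eq_getElem (by omega)]
      rfl
    obtain ⟨c', hl, h1, h2, h3, h4⟩ := ih (by omega) c₁ rfl (by simp [hc₁, ht])
      (fun i hi => by
        rw [hc₁, c.act_move_head_mem _ _ hi, hh i hi]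
        push_cast
        simp)
    refine ⟨c', ?_, h1, ?_, h3, ?_⟩
    · have := hstep.trans hl
      rwa [add_comm 1] at this
    · rw [h2, hc₁, Cfg.act_move_tape]
    · intro i hi
      rw [h4 i hi, hc₁, c.act_move_head_not_mem _ _ hi]

/-- Two states that copy a string from `src` to the blank tapes `tgt` and rewind these. -/
lemma leads_copy_rewind (hcp : cp ≠ acc) (hrw : rw ≠ acc) (hsrc : src ∉ tgt)
    (ht₀ : t₀ ∈ tgt)
    (hδ : ∀ s, δ cp s = {match bitOf (s src) with
      | some b => copyAction src tgt cp b s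
      | none => moveAction tgt rw (-1) s})
    (hδ' : ∀ s, δ rw s = {match bitOf (s t₀) with
      | some _ => moveAction tgt rw (-1) s
      | none => moveAction tgt nxt 1 s})
    (w : List Bool) (c : Cfg 0 Q α W) (hc : c.state = cp)
    (hs : ∀ n ≤ w.length, bitOf (c.tape src (c.head src + n)) = w[n]?)
    (ht : ∀ i ∈ tgt, c.tape i = fun _ => none) (hh : ∀ i ∈ tgt, c.head i = 0) :
    ∃ c', Leads δ acc (2 * w.length + 2) c c' ∧ c'.state = nxt ∧
      (∀ i ∈ tgt, c'.tape i = strTape w ∧ c'.head i = 0) ∧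
      (∀ i, i ∉ tgt → i ≠ src → c'.tape i = c.tape i ∧ c'.head i = c.head i) := by
  obtain ⟨c₁, hl₁, a1, a2, a3, a4, a5⟩ := leads_copy hcp hsrc hδ [] w c hc hs
    (by simpa using ht) (by simpa using hh)
  simp only [List.nil_append] at a2 a3
  obtain ⟨c₂, hl₂, b1, b2, b3, b4⟩ := leads_rewind hrw ht₀ hδ' w w.length le_rfl c₁ a1
    (a2 t₀ ht₀) a3
  refine ⟨c₂, ?_, b1, fun i hi => ⟨by rw [b2, a2 i hi], b3 i hi⟩,
    fun i hi hi' => ⟨by rw [b2, a4 i hi], by rw [b4 i hi, a5 i hi hi']⟩⟩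
  have := hl₁.trans hl₂
  convert this using 1
  ring

end Copy

/-! ### Deterministic oracle machines with fixed answers -/

namespace DOTM

variable {k : ℕ} (D : DOTM k)

open Classical in
/-- The local rule of `D` when its query is answered by `v`. -/
noncomputable def rule (v : Fin k → Bool) (q : D.Q) (s : TapeIdx k D.W → Sym D.α) :
    Action k D.Q D.α D.W :=
  if D.output q ≠ none then (q, s, 0)
  else if q = D.pre then
    (D.post, fun i => match i with
      | Sum.inr (Sum.inl j) => if v j then flip (s i) else s i
      | i => s i, 0)
  else D.δ q s

/-- With answers fixed in advance, a call only flips scanned symbols and is therefore an ordinary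
local action. This is what lets machines without an oracle simulate `D`. -/
lemma step_const (v : Fin k → Bool) (c : Cfg k D.Q D.α D.W) :
    D.step (fun _ => v) c = c.act (D.rule v c.state c.read) := by
  unfold step rule
  split_ifs with h₁ h₂
  · rw [Cfg.act_self]
  · ext i
    · rfl
    · rcases i with i | j | i
      · rw [Cfg.act_tape_of_eq _ _ _ rfl]
        rfl
      · simp only [Cfg.call, Cfg.act_tape]
        split_ifs
        · rfl
        · simp [Cfg.read]
      · rw [Cfg.act_tape_of_eq _ _ _ rfl]
        rfl
    · simp [Cfg.act_head, Cfg.call]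
  · rfl

variable {D}

lemma run_succ (O : Cfg k D.Q D.α D.W → Fin k → Bool) (x : List Bool) (t : ℕ) :
    D.run O x (t + 1) = D.step O (D.run O x t) :=
  Function.iterate_succ_apply' _ _ _

lemma run_const_succ (v : Fin k → Bool) (x : List Bool) (t : ℕ) :
    D.run (fun _ => v) x (t + 1) = (D.run (fun _ => v) x t).act
      (D.rule v (D.run (fun _ => v) x t).state (D.run (fun _ => v) x t).read) := by
  rw [run_succ, step_const]

lemma run_eq_of_halted {O : Cfg k D.Q D.α D.W → Fin k → Bool} {x : List Bool} {t : ℕ}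
    (h : D.output (D.run O x t).state ≠ none) {t' : ℕ} (ht : t ≤ t') :
    D.run O x t' = D.run O x t := by
  induction t', ht using Nat.le_induction with
  | base => rfl
  | succ n _ ih => rw [run_succ, ih, step, if_pos h]

lemma run_head_le (O : Cfg k D.Q D.α D.W → Fin k → Bool) (x : List Bool) (t : ℕ)
    (i : TapeIdx k D.W) : |(D.run O x t).head i| ≤ t := by
  induction t with
  | zero => simp [run]
  | succ t ih =>
    rw [run_succ, step]
    have : |(D.run O x t).head i| ≤ ((t + 1 : ℕ) : ℤ) := ih.trans (by push_cast; omega)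
    split_ifs
    · exact this
    · exact this
    · rw [Cfg.act_head]
      generalize (D.δ _ _).2.2 i = m
      have hm : |(m : ℤ)| ≤ 1 := by cases m <;> simp
      push_cast
      exact (abs_add_le _ _).trans (add_le_add ih hm)

lemma run_tape_eq_none (O : Cfg k D.Q D.α D.W → Fin k → Bool) (x : List Bool) (t : ℕ)
    (i : Fin k ⊕ D.W) (z : ℤ) (hz : (t : ℤ) < z) : (D.run O x t).tape (Sum.inr i) z = none := by
  induction t generalizing z with
  | zero => rfl
  | succ t ih =>
    have hh := run_head_le O x t (Sum.inr i)
    have hne : z ≠ (D.run O x t).head (Sum.inr i) := by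
      rintro rfl
      have := (le_abs_self _).trans hh
      push_cast at hz
      omega
    have hz' : (t : ℤ) < z := by push_cast at hz; omega
    rw [run_succ, step]
    split_ifs
    · exact ih z hz'
    · rcases i with j | i
      · simp only [Cfg.call]
        split_ifs
        · rw [Function.update_of_ne hne]
          exact ih z hz'
        · exact ih z hz'
      · exact ih z hz'
    · rw [Cfg.act_tape, Function.update_of_ne hne]
      exact ih z hz'

/-- After `t` steps the head is at least at `-t` and all cells beyond `t` are blank, so at most `2 *
t` bits fit to the right of the head. -/
lemma length_le_of_hasQuery {O : Cfg k D.Q D.α D.W → Fin k → Bool} {x : List Bool} {t : ℕ}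
    {j : Fin k} {w : List Bool} (h : (D.run O x t).HasQuery j w) : w.length ≤ 2 * t := by
  by_contra hlt
  push Not at hlt
  have hh := neg_le_of_abs_le (run_head_le O x t (Sum.inr (Sum.inl j)))
  have h1 := h.1 (w.length - 1) (by omega)
  rw [run_tape_eq_none _ _ _ _ _ (by push_cast [show 1 ≤ w.length by omega]; omega)] at h1
  simp [bit] at h1

end DOTM

/-! ### The language of inputs with a given output is in `NP` -/

section OutLang

variable {k : ℕ} (D : DOTM k) (v : Fin k → Bool) (b : Bool)

/-- The inputs on which `D` outputs `b` if its query is answered by `v`. -/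
def outLang : Language Bool := {x | ∃ t, D.output (D.run (fun _ => v) x t).state = some b}

/-- The tapes of an oracle machine, with the query tapes regarded as work tapes. -/
def plainTape (k : ℕ) (W : Type) : TapeIdx k W → TapeIdx 0 (Fin k ⊕ W) := Sum.map id Sum.inr

lemma plainTape_injective (k : ℕ) (W : Type) : Function.Injective (plainTape k W) :=
  Function.injective_id.sumMap Sum.inr_injective

open Classical in
/-- The rule of a machine that accepts if `D` outputs `b` when its query is answered by `v`. -/
noncomputable def outRule : Option D.Q → (TapeIdx 0 (Fin k ⊕ D.W) → Sym D.α) →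
    Set (Action 0 (Option D.Q) D.α (Fin k ⊕ D.W))
  | none, _ => ∅
  | some q, s =>
    if D.output q = some b then {(none, s, 0)}
    else {Cfg.liftAction (plainTape k D.W) id
      (some (D.rule v q fun i => s (plainTape k D.W i)).1) s
      (D.rule v q fun i => s (plainTape k D.W i))}

/-- Until the output `b` appears, the rule has exactly one action, which copies the step of `D`;
nothing can be accepted in the meantime. -/
lemma outRule_leads (x : List Bool) (t : ℕ)
    (ht : ∀ s < t, D.output (D.run (fun _ => v) x s).state ≠ some b) :
    ∃ c, Leads (outRule D v b) none t (Cfg.init (some D.start) x) c ∧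
      Cfg.Sees (plainTape k D.W) id c (D.run (fun _ => v) x t) ∧
      c.state = some (D.run (fun _ => v) x t).state := by
  induction t with
  | zero =>
    refine ⟨_, Leads.refl _, ⟨?_, fun _ => rfl⟩, rfl⟩
    rintro (_ | _) z <;> rfl
  | succ t ih =>
    obtain ⟨c, hl, hs, hq⟩ := ih fun s hs => ht s (by omega)
    have hr : (fun i => c.read (plainTape k D.W i)) = (D.run (fun _ => v) x t).read :=
      funext fun i => hs.read i
    refine ⟨_, hl.trans (Leads.single (a := Cfg.liftAction (plainTape k D.W) id
      (some (D.rule v (D.run (fun _ => v) x t).state (D.run (fun _ => v) x t).read).1) c.read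
      (D.rule v (D.run (fun _ => v) x t).state (D.run (fun _ => v) x t).read)) ?_ ?_), ?_, ?_⟩
    · simp [hq]
    · rw [hq, outRule, if_neg (ht t (by omega)), hr]
    · rw [DOTM.run_const_succ]
      exact hs.act (plainTape_injective _ _) _ _
    · rw [DOTM.run_const_succ]
      rfl

lemma outLang_mem_NP {p : Polynomial ℕ} (hp : D.RunsInTime p) : outLang D v b ∈ NP := by
  classical
  -- The added `1` is the step into the accepting state `none`.
  refine ⟨⟨Option D.Q, D.α, Fin k ⊕ D.W, some D.start, none, outRule D v b⟩, p + 1,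
    fun x => ⟨fun t ht => ?_, fun hx => ?_⟩⟩
  · by_contra hx
    -- If `b` is never output, the forced simulation makes every accepting computation at least `t +
    -- 1` steps long, for any `t`.
    obtain ⟨c, hl, -⟩ := outRule_leads D v b x (t + 1) fun s _ hs => hx ⟨s, hs⟩
    rw [NTM.acceptsIn_iff] at ht
    obtain ⟨t', h, -⟩ := (hl t).1 ht
    omega
  · have hfind := Nat.find_spec hx
    set t := Nat.find hx with htdef
    have hmin : ∀ s < t, D.output (D.run (fun _ => v) x s).state ≠ some b :=
      fun s hs => Nat.find_min hx hs
    obtain ⟨c, hl, -, hq⟩ := outRule_leads D v b x t hmin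
    refine ⟨t + 1, ?_, ?_⟩
    · have : t ≤ p.eval x.length := by
        by_contra hlt
        push Not at hlt
        refine hmin _ hlt ?_
        rw [← DOTM.run_eq_of_halted (hp v x) hlt.le]
        exact hfind
      simpa using this
    · rw [NTM.acceptsIn_iff, hl]
      refine ⟨1, rfl, (none, c.read, 0), ?_, rfl⟩
      simp only [hq, outRule, if_pos hfind]
      rfl

end OutLang

/-! ### The language of inputs with a positive answer to the `j`-th query is in `NP` -/

section QueryLang

variable {k : ℕ} (D : DOTM k) (N : NTM) (A : Language Bool) (j : Fin k)

/-- The inputs on which `D` calls the oracle `A`, with a positive answer to the `j`-th query. -/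
def queryLang : Language Bool :=
  {x | ∃ t, (D.run (fun _ _ => false) x t).state = D.pre ∧
    (D.run (fun _ _ => false) x t).answers A j = true}

/-- The states of `queryRule`. -/
inductive QueryState (Q₁ Q₂ : Type) : Type
  | sim (q : Q₁)
  | copy
  | rewind
  | verify (q : Q₂)

instance {Q₁ Q₂ : Type} [Finite Q₁] [Finite Q₂] : Finite (QueryState Q₁ Q₂) := by
  let f : (Q₁ ⊕ Q₂) ⊕ Bool → QueryState Q₁ Q₂ := fun
    | Sum.inl (Sum.inl q) => .sim q
    | Sum.inl (Sum.inr q) => .verify q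
    | Sum.inr true => .copy
    | Sum.inr false => .rewind
  refine Finite.of_surjective f ?_
  rintro (q | _ | _ | q)
  · exact ⟨Sum.inl (Sum.inl q), rfl⟩
  · exact ⟨Sum.inr true, rfl⟩
  · exact ⟨Sum.inr false, rfl⟩
  · exact ⟨Sum.inl (Sum.inr q), rfl⟩

/-- The tapes of the simulated oracle machine. -/
def simTape (k : ℕ) (W₁ W₂ : Type) :
    TapeIdx k W₁ → TapeIdx 0 ((Fin k ⊕ W₁) ⊕ TapeIdx 0 W₂) :=
  Sum.map id (Sum.inr ∘ Sum.inl)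

/-- The tapes of the machine that verifies a query. -/
def verifyTape (k : ℕ) (W₁ W₂ : Type) :
    TapeIdx 0 W₂ → TapeIdx 0 ((Fin k ⊕ W₁) ⊕ TapeIdx 0 W₂) :=
  Sum.inr ∘ Sum.inr ∘ Sum.inr

lemma simTape_injective (k : ℕ) (W₁ W₂ : Type) : Function.Injective (simTape k W₁ W₂) :=
  Function.injective_id.sumMap (Sum.inr_injective.comp Sum.inl_injective)

lemma verifyTape_injective (k : ℕ) (W₁ W₂ : Type) : Function.Injective (verifyTape k W₁ W₂) :=
  Sum.inr_injective.comp (Sum.inr_injective.comp Sum.inr_injective)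

lemma simTape_ne_verifyTape {k : ℕ} {W₁ W₂ : Type} (i : TapeIdx k W₁) (i' : TapeIdx 0 W₂) :
    simTape k W₁ W₂ i ≠ verifyTape k W₁ W₂ i' := by
  rcases i with _ | _ <;> simp [simTape, verifyTape]

open Classical in
/-- The rule of a machine that simulates `D` up to its oracle call, copies the `j`-th query string
to the input tape of `N`, and runs `N`. -/
noncomputable def queryRule (q : QueryState D.Q N.Q)
    (s : TapeIdx 0 ((Fin k ⊕ D.W) ⊕ TapeIdx 0 N.W) → Sym (D.α ⊕ N.α)) :
    Set (Action 0 (QueryState D.Q N.Q) (D.α ⊕ N.α) ((Fin k ⊕ D.W) ⊕ TapeIdx 0 N.W)) :=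
  match q with
    | .sim q =>
      if q = D.pre then {moveAction {simTape k D.W N.W (Sum.inr (Sum.inl j))} .copy 1 s}
      else {Cfg.liftAction (simTape k D.W N.W) (symMap Sum.inl)
        (.sim (D.rule (fun _ => false) q
          fun i => decode (symMap Sum.inl) (s (simTape k D.W N.W i))).1) s
        (D.rule (fun _ => false) q fun i => decode (symMap Sum.inl) (s (simTape k D.W N.W i)))}
    | .copy => {match bitOf (s (simTape k D.W N.W (Sum.inr (Sum.inl j)))) with
      | some b => copyAction (simTape k D.W N.W (Sum.inr (Sum.inl j)))
          {verifyTape k D.W N.W (Sum.inl ())} .copy b s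
      | none => moveAction {verifyTape k D.W N.W (Sum.inl ())} .rewind (-1) s}
    | .rewind => {match bitOf (s (verifyTape k D.W N.W (Sum.inl ()))) with
      | some _ => moveAction {verifyTape k D.W N.W (Sum.inl ())} .rewind (-1) s
      | none => moveAction {verifyTape k D.W N.W (Sum.inl ())} (.verify N.start) 1 s}
    | .verify q => Set.image (fun a => Cfg.liftAction (verifyTape k D.W N.W) (symMap Sum.inr)
        (.verify a.1) s a)
        (N.δ q fun i => decode (symMap Sum.inr) (s (verifyTape k D.W N.W i)))

lemma queryRule_leads_sim (x : List Bool) (t : ℕ)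
    (ht : ∀ s < t, (D.run (fun _ _ => false) x s).state ≠ D.pre) :
    ∃ c, Leads (queryRule D N j) (.verify N.accept) t (Cfg.init (QueryState.sim D.start) x) c ∧
      Cfg.Sees (simTape k D.W N.W) (symMap Sum.inl) c (D.run (fun _ _ => false) x t) ∧
      (∀ i, c.tape (verifyTape k D.W N.W i) = (fun _ => none) ∧
        c.head (verifyTape k D.W N.W i) = 0) ∧
      c.state = .sim (D.run (fun _ _ => false) x t).state := by
  induction t with
  | zero =>
    refine ⟨_, Leads.refl _, ⟨?_, fun _ => rfl⟩, fun _ => ⟨rfl, rfl⟩, rfl⟩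
    rintro (_ | _) z
    · exact (symMap_strTape Sum.inl x z).symm
    · rfl
  | succ t ih =>
    obtain ⟨c, hl, hs, hv, hq⟩ := ih fun s hs => ht s (by omega)
    have hr := hs.decode_read (symMap_injective Sum.inl_injective)
    refine ⟨_, hl.trans (Leads.single
      (a := Cfg.liftAction (simTape k D.W N.W) (symMap Sum.inl)
      (.sim (D.rule (fun _ => false) (D.run (fun _ _ => false) x t).state
        (D.run (fun _ _ => false) x t).read).1) c.read
      (D.rule (fun _ => false) (D.run (fun _ _ => false) x t).state
        (D.run (fun _ _ => false) x t).read)) ?_ ?_), ?_, ?_, ?_⟩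
    · simp [hq]
    · rw [hq, queryRule, if_neg (ht t (by omega)), hr]
    · rw [DOTM.run_const_succ]
      exact hs.act (simTape_injective _ _ _) _ _
    · intro i
      rw [Cfg.act_liftAction_tape _ _ _ (fun i' => simTape_ne_verifyTape i' i),
        Cfg.act_liftAction_head _ _ _ _ (fun i' => simTape_ne_verifyTape i' i)]
      exact hv i
    · rw [DOTM.run_const_succ]
      rfl

/-- In the verification phase only the tapes of `N` are read and changed, so the accepting
computations correspond step by step. This is the only nondeterministic phase. -/
lemma queryRule_accFrom_verify (t : ℕ) (c : Cfg 0 (QueryState D.Q N.Q)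
      (D.α ⊕ N.α) ((Fin k ⊕ D.W) ⊕ TapeIdx 0 N.W)) (c₁ : Cfg 0 N.Q N.α N.W)
    (hs : Cfg.Sees (verifyTape k D.W N.W) (symMap Sum.inr) c c₁)
    (hq : c.state = .verify c₁.state) :
    AccFrom (queryRule D N j) (.verify N.accept) t c ↔ AccFrom N.δ N.accept t c₁ := by
  induction t generalizing c c₁ with
  | zero =>
    simp only [AccFrom, hq]
    simp
  | succ t ih =>
    have hr := hs.decode_read (symMap_injective Sum.inr_injective)
    simp only [AccFrom, hq]
    constructor
    · rintro ⟨_, ⟨a, ha, rfl⟩, h⟩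
      rw [hr] at ha
      exact ⟨a, ha, (ih _ _ (hs.act (verifyTape_injective _ _ _) _ _) rfl).1 h⟩
    · rintro ⟨a, ha, h⟩
      refine ⟨_, ⟨a, ?_, rfl⟩, (ih _ _ (hs.act (verifyTape_injective _ _ _) _ _) rfl).2 h⟩
      rwa [hr]

lemma DOTM.exists_hasQuery {D : DOTM k} (O : Cfg k D.Q D.α D.W → Fin k → Bool) (x : List Bool)
    (t : ℕ) (j : Fin k) : ∃ w, (D.run O x t).HasQuery j w := by
  classical
  set c := D.run O x t with hc
  have hex : ∃ n : ℕ, bitOf (c.tape (Sum.inr (Sum.inl j))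
      (c.head (Sum.inr (Sum.inl j)) + 1 + n)) = none := by
    -- The head is at least at `-t`, so this cell lies beyond `t`, where nothing has been written.
    refine ⟨2 * t, ?_⟩
    rw [hc, run_tape_eq_none]
    · rfl
    · have := neg_le_of_abs_le (run_head_le O x t (Sum.inr (Sum.inl j)))
      push_cast
      omega
  have hspec := Nat.find_spec hex
  -- The default value `false` is never taken: all cells before the first one without a bit hold
  -- bits.
  refine ⟨List.ofFn fun n : Fin (Nat.find hex) => (bitOf (c.tape (Sum.inr (Sum.inl j))
      (c.head (Sum.inr (Sum.inl j)) + 1 + n))).getD false, ?_⟩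
  rw [Cfg.hasQuery_iff]
  intro n hn
  rw [List.length_ofFn] at hn
  rcases hn.lt_or_eq with h | rfl
  · rw [List.getElem?_eq_getElem (by simpa using h), List.getElem_ofFn]
    have := Nat.find_min hex h
    obtain ⟨b, hb⟩ := Option.ne_none_iff_exists'.1 this
    rw [hb]
    rfl
  · rw [hspec, List.getElem?_eq_none (by simp)]

lemma queryRule_leads_verify (x : List Bool) (t : ℕ)
    (ht : ∀ s < t, (D.run (fun _ _ => false) x s).state ≠ D.pre)
    (hpre : (D.run (fun _ _ => false) x t).state = D.pre) (w : List Bool)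
    (hw : (D.run (fun _ _ => false) x t).HasQuery j w) :
    ∃ c, Leads (queryRule D N j) (.verify N.accept) (t + 1 + (2 * w.length + 2))
        (Cfg.init (QueryState.sim D.start) x) c ∧
      Cfg.Sees (verifyTape k D.W N.W) (symMap Sum.inr) c (Cfg.init N.start w : Cfg 0 N.Q N.α N.W) ∧
      c.state = .verify N.start := by
  obtain ⟨c, hl, hs, hv, hq⟩ := queryRule_leads_sim D N j x t ht
  have hq' : c.state = .sim D.pre := by rw [hq, hpre]
  set src := simTape k D.W N.W (Sum.inr (Sum.inl j)) with hsrc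
  set tgt : Set (TapeIdx 0 ((Fin k ⊕ D.W) ⊕ TapeIdx 0 N.W)) :=
    {verifyTape k D.W N.W (Sum.inl ())} with htgt
  -- At a call the head scans the answer cell; the query string starts one cell to the right.
  set c₁ := c.act (moveAction {src} (.copy : QueryState D.Q N.Q) 1 c.read) with hc₁
  have hl₁ : Leads (queryRule D N j) (.verify N.accept) 1 c c₁ := by
    refine Leads.single ?_ ?_
    · simp [hq']
    · rw [hq', queryRule, if_pos rfl]
  have hmem : ∀ i, verifyTape k D.W N.W i ∉
      ({src} : Set (TapeIdx 0 ((Fin k ⊕ D.W) ⊕ TapeIdx 0 N.W))) :=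
    fun i h => simTape_ne_verifyTape (Sum.inr (Sum.inl j)) i (Set.mem_singleton_iff.1 h).symm
  have hv₁ : ∀ i, c₁.tape (verifyTape k D.W N.W i) = (fun _ => none) ∧
        c₁.head (verifyTape k D.W N.W i) = 0 := fun i => by
    rw [hc₁, Cfg.act_move_tape, Cfg.act_move_head_not_mem _ _ _ (hmem i)]
    exact hv i
  obtain ⟨c₂, hl₂, h1, h2, h3⟩ := leads_copy_rewind (δ := queryRule D N j) (acc := .verify N.accept)
    (cp := .copy) (rw := .rewind) (nxt := .verify N.start) (src := src) (tgt := tgt)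
    (t₀ := verifyTape k D.W N.W (Sum.inl ())) (by simp) (by simp)
    (fun h => simTape_ne_verifyTape _ _ (Set.mem_singleton_iff.1 h)) rfl (fun _ => rfl)
    (fun _ => rfl) w c₁ rfl
    (fun n hn => by
      rw [← (Cfg.hasQuery_iff _ _ _).1 hw n hn, hc₁, Cfg.act_move_tape,
        Cfg.act_move_head_mem _ _ _ (Set.mem_singleton src), hsrc, hs.tape, hs.head, bitOf_symMap]
      rfl)
    (fun i hi => by
      obtain rfl := Set.mem_singleton_iff.1 hi
      exact (hv₁ _).1)
    (fun i hi => by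
      obtain rfl := Set.mem_singleton_iff.1 hi
      exact (hv₁ _).2)
  refine ⟨c₂, (hl.trans hl₁).trans hl₂, ⟨?_, ?_⟩, h1⟩
  · rintro (_ | i) z
    · rw [(h2 _ rfl).1]
      exact (symMap_strTape Sum.inr w z).symm
    · rw [(h3 _ (fun h => ?_) (fun h => ?_)).1, (hv₁ _).1]
      · rfl
      · exact absurd (verifyTape_injective _ _ _ (Set.mem_singleton_iff.1 h)) (by simp)
      · exact simTape_ne_verifyTape _ _ h.symm
  · rintro (_ | i)
    · exact (h2 _ rfl).2
    · rw [(h3 _ (fun h => ?_) (fun h => ?_)).2, (hv₁ _).2]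
      · rfl
      · exact absurd (verifyTape_injective _ _ _ (Set.mem_singleton_iff.1 h)) (by simp)
      · exact simTape_ne_verifyTape _ _ h.symm

/-- The query string is found deterministically, by running `D` up to its call, and a positive
answer is then certified by an accepting computation of `N`. Non-adaptivity makes the time of the
call, and with it the string, unique. -/
lemma queryLang_mem_NP {p : Polynomial ℕ} (hp : D.RunsInTime p) (hD : D.NonAdaptive)
    (hA : A ∈ NP) : queryLang D A j ∈ NP := by
  classical
  obtain ⟨N, q, hN⟩ := hA
  refine ⟨⟨_, _, _, .sim D.start, .verify N.accept, queryRule D N j⟩,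
    -- The summands bound the simulation, the move off the answer cell, the copying and rewinding of
    -- a string of length at most `2 * p`, and the verification of that string.
    p + 1 + (2 * (2 * p) + 2) + q.comp (2 * p), fun x => ?_⟩
  by_cases hex : ∃ t, (D.run (fun _ _ => false) x t).state = D.pre
  · have hpre := Nat.find_spec hex
    have hmin : ∀ s < Nat.find hex, (D.run (fun _ _ => false) x s).state ≠ D.pre :=
      fun s hs => Nat.find_min hex hs
    set t := Nat.find hex with htdef
    obtain ⟨w, hw⟩ := DOTM.exists_hasQuery (D := D) (fun _ _ => false) x t j
    have hx : x ∈ queryLang D A j ↔ w ∈ A := by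
      constructor
      · rintro ⟨t', ht', hans⟩
        obtain rfl : t' = t := by
          rcases lt_trichotomy t' t with h | h | h
          · exact absurd ht' (hmin _ h)
          · exact h
          · exact absurd ht' (hD (fun _ => false) x t t' h hpre)
        rw [hw.answers_eq] at hans
        simpa using hans
      · intro h
        exact ⟨t, hpre, by rw [hw.answers_eq]; simpa using h⟩
    obtain ⟨c, hl, hs, hq⟩ := queryRule_leads_verify D N j x t hmin hpre w hw
    rw [hx]
    constructor
    · intro T hT
      rw [NTM.acceptsIn_iff] at hT
      obtain ⟨t', -, ht'⟩ := (hl T).1 hT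
      rw [queryRule_accFrom_verify D N j t' c _ hs hq, ← NTM.acceptsIn_iff] at ht'
      exact (hN w).1 t' ht'
    · intro hwA
      obtain ⟨t', ht', hacc⟩ := (hN w).2 hwA
      refine ⟨_, ?_, (NTM.acceptsIn_iff _ _ _).2 ((hl _).2 ⟨t', rfl, ?_⟩)⟩
      · have ht : t ≤ p.eval x.length := by
          by_contra hlt
          push Not at hlt
          refine hmin _ hlt ?_
          rw [← DOTM.run_eq_of_halted (hp (fun _ => false) x) hlt.le]
          exact hpre
        have hlen : w.length ≤ 2 * p.eval x.length :=
          (DOTM.length_le_of_hasQuery hw).trans (by omega)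
        have := ht'.trans (eval_mono q hlen)
        simp only [Polynomial.eval_add, Polynomial.eval_mul, Polynomial.eval_one,
          Polynomial.eval_ofNat, Polynomial.eval_comp]
        omega
      · rw [queryRule_accFrom_verify D N j t' c _ hs hq, ← NTM.acceptsIn_iff]
        exact hacc
  · push Not at hex
    constructor
    · intro T hT
      rw [NTM.acceptsIn_iff] at hT
      -- Without a call the machine simulates forever, so no length `T` is long enough for
      -- acceptance.
      obtain ⟨c, hl, -⟩ := queryRule_leads_sim D N j x (T + 1) fun s _ => hex s
      obtain ⟨t', h, -⟩ := (hl T).1 hT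
      omega
    · rintro ⟨t, ht, -⟩
      exact absurd ht (hex t)

end QueryLang

/-! ### Monotone combinations of `NP` languages, with a prefix -/

section Combine

variable {ι : Type} (N : ι → NTM) (m : ℕ) (Good : List Bool → Set ι → Prop)

/-- The states of `combineRule`. -/
inductive CombineState (Q : ι → Type) (m : ℕ) : Type
  | scan (p : {p : List Bool // p.length ≤ m})
  | copy (p : {p : List Bool // p.length ≤ m})
  | rewind (p : {p : List Bool // p.length ≤ m})
  | sim (p : {p : List Bool // p.length ≤ m}) (q : ∀ l, Q l)
  | accept

instance [Finite ι] {Q : ι → Type} [∀ l, Finite (Q l)] : Finite (CombineState Q m) := by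
  have : Finite {p : List Bool // p.length ≤ m} := (List.finite_length_le Bool m).to_subtype
  let f : (Fin 3 × {p : List Bool // p.length ≤ m}) ⊕
      Option ({p : List Bool // p.length ≤ m} × ∀ l, Q l) → CombineState Q m := fun
    | Sum.inl (0, p) => .scan p
    | Sum.inl (1, p) => .copy p
    | Sum.inl (2, p) => .rewind p
    | Sum.inr (some (p, q)) => .sim p q
    | Sum.inr none => .accept
  refine Finite.of_surjective f ?_
  rintro (p | p | p | ⟨p, q⟩ | _)
  · exact ⟨Sum.inl (0, p), rfl⟩
  · exact ⟨Sum.inl (1, p), rfl⟩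
  · exact ⟨Sum.inl (2, p), rfl⟩
  · exact ⟨Sum.inr (some (p, q)), rfl⟩
  · exact ⟨Sum.inr none, rfl⟩

/-- The tapes of the `l`-th machine. -/
def partTape (l : ι) : TapeIdx 0 (N l).W → TapeIdx 0 (Σ l, TapeIdx 0 (N l).W) :=
  fun i => Sum.inr (Sum.inr ⟨l, i⟩)

lemma partTape_injective (l : ι) : Function.Injective (partTape N l) := by
  intro i i' h
  simpa [partTape] using h

variable {N} in
lemma partTape_ne {l l' : ι} (h : l ≠ l') (i : TapeIdx 0 (N l).W) (i' : TapeIdx 0 (N l').W) :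
    partTape N l i ≠ partTape N l' i' := by
  intro h'
  simp only [partTape, Sum.inr.injEq, Sigma.mk.injEq] at h'
  exact h h'.1

/-- The symbols of the `l`-th machine. -/
def partSym (l : ι) : Sym (N l).α → Sym (Σ l, (N l).α) := symMap fun a => ⟨l, a⟩

lemma partSym_injective (l : ι) : Function.Injective (partSym N l) :=
  symMap_injective fun a b h => by simpa using h

/-- The input tapes of all machines. -/
def partInputs : Set (TapeIdx 0 (Σ l, TapeIdx 0 (N l).W)) :=
  Set.range fun l => partTape N l (Sum.inl ())

variable {m} in
open Classical in
/-- The rule of a machine that scans a prefix of length `m`, copies the rest of the input to the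
input tapes of all machines, runs these in any order, and accepts if the prefix and the set of
machines in an accepting state satisfy `Good`. -/
noncomputable def combineRule (l₀ : ι) (q : CombineState (fun l => (N l).Q) m)
    (s : TapeIdx 0 (Σ l, TapeIdx 0 (N l).W) → Sym (Σ l, (N l).α)) :
    Set (Action 0 (CombineState (fun l => (N l).Q) m) (Σ l, (N l).α)
      (Σ l, TapeIdx 0 (N l).W)) :=
  match q with
  | .scan p =>
    if h : p.1.length < m then
      match bitOf (s (Sum.inl ())) with
      | some b => {moveAction {Sum.inl ()} (.scan ⟨p.1 ++ [b], by simpa using h⟩) 1 s}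
      | none => ∅
    else {moveAction ∅ (.copy p) 0 s}
  | .copy p => {match bitOf (s (Sum.inl ())) with
    | some b => copyAction (Sum.inl ()) (partInputs N) (.copy p) b s
    | none => moveAction (partInputs N) (.rewind p) (-1) s}
  | .rewind p => {match bitOf (s (partTape N l₀ (Sum.inl ()))) with
    | some _ => moveAction (partInputs N) (.rewind p) (-1) s
    | none => moveAction (partInputs N) (.sim p fun l => (N l).start) 1 s}
  | .sim p q =>
    {a | ∃ l, ∃ a₁ ∈ (N l).δ (q l) (fun i => decode (partSym N l) (s (partTape N l i))),
      a = Cfg.liftAction (partTape N l) (partSym N l) (.sim p (Function.update q l a₁.1)) s a₁} ∪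
    {a | a = (.accept, s, 0) ∧ Good p.1 {l | q l = (N l).accept}}
  | .accept => ∅

variable {N m Good} {l₀ : ι}

lemma combineRule_leads_scan (w : List Bool) (i : ℕ) (hi : i ≤ m) (hw : i ≤ w.length) :
    ∃ c, Leads (combineRule N Good l₀) .accept i (Cfg.init (.scan ⟨[], Nat.zero_le m⟩) w) c ∧
      c.state = .scan ⟨w.take i, by simp [hi]⟩ ∧ c.tape (Sum.inl ()) = strTape w ∧
      c.head (Sum.inl ()) = i ∧
      ∀ j, c.tape (Sum.inr j) = (fun _ => none) ∧ c.head (Sum.inr j) = 0 := by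
  induction i with
  | zero => exact ⟨_, Leads.refl _, by simp, rfl, rfl, fun _ => ⟨rfl, rfl⟩⟩
  | succ i ih =>
    obtain ⟨c, hl, hq, ht, hh, hb⟩ := ih (by omega) (by omega)
    have hlen : (w.take i).length < m := by simp; omega
    have hread : bitOf (c.read (Sum.inl ())) = some w[i] := by
      rw [Cfg.read, ht, hh, strTape_natCast, bitOf_map_inl, List.getElem?_eq_getElem]
    refine ⟨c.act (moveAction {Sum.inl ()} (.scan ⟨w.take i ++ [w[i]], by simp; omega⟩) 1
      c.read), hl.trans (Leads.single ?_ ?_), ?_, ?_, ?_, fun j => ⟨?_, ?_⟩⟩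
    · simp [hq]
    · rw [hq, combineRule, dif_pos hlen, hread]
    · rw [Cfg.act_move_state]
      simp
    · rw [Cfg.act_move_tape, ht]
    · rw [Cfg.act_move_head_mem _ _ _ (Set.mem_singleton _), hh]
      simp
    · rw [Cfg.act_move_tape, (hb j).1]
    · rw [Cfg.act_move_head_not_mem _ _ _ (by simp), (hb j).2]

/-- The scan of the prefix reaches a blank too early, where the rule offers no action. -/
lemma not_accFrom_combineRule_of_short {w : List Bool} (hw : w.length < m) (t : ℕ) :
    ¬AccFrom (combineRule N Good l₀) .accept t (Cfg.init (.scan ⟨[], Nat.zero_le m⟩) w) := by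
  obtain ⟨c, hl, hq, ht, hh, -⟩ :=
    combineRule_leads_scan (N := N) (Good := Good) (l₀ := l₀) w w.length hw.le le_rfl
  rw [hl]
  rintro ⟨t', -, h⟩
  cases t' with
  | zero =>
    rw [AccFrom, hq] at h
    simp at h
  | succ t' =>
    obtain ⟨a, ha, -⟩ := h
    have hread : bitOf (c.read (Sum.inl ())) = none := by
      rw [Cfg.read, ht, hh, strTape_natCast, bitOf_map_inl, List.getElem?_eq_none le_rfl]
    rw [hq, combineRule, dif_pos (by simpa using hw), hread] at ha
    exact ha

lemma combineRule_leads_sim (w : List Bool) (hw : m ≤ w.length) :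
    ∃ c, Leads (combineRule N Good l₀) .accept (m + 1 + (2 * (w.drop m).length + 2))
        (Cfg.init (.scan ⟨[], Nat.zero_le m⟩) w) c ∧
      c.state = .sim ⟨w.take m, by simp⟩ (fun l => (N l).start) ∧
      ∀ l, Cfg.Sees (partTape N l) (partSym N l) c
        (Cfg.init (N l).start (w.drop m) : Cfg 0 (N l).Q (N l).α (N l).W) := by
  obtain ⟨c, hl, hq, ht, hh, hb⟩ :=
    combineRule_leads_scan (N := N) (Good := Good) (l₀ := l₀) w m le_rfl hw
  set p : {p : List Bool // p.length ≤ m} := ⟨w.take m, by simp⟩ with hp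
  have hl₁ : Leads (combineRule N Good l₀) .accept 1 c
      (c.act (moveAction ∅ (.copy p) 0 c.read)) := by
    refine Leads.single (by simp [hq]) ?_
    rw [hq, combineRule, dif_neg (by simp [hp, hw])]
  obtain ⟨c₂, hl₂, h1, h2, h3⟩ := leads_copy_rewind (δ := combineRule N Good l₀) (acc := .accept)
    (cp := .copy p) (rw := .rewind p) (nxt := .sim p fun l => (N l).start)
    (src := Sum.inl ()) (tgt := partInputs N) (t₀ := partTape N l₀ (Sum.inl ()))
    (by simp) (by simp) (by simp [partInputs, partTape]) ⟨l₀, rfl⟩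
    (fun _ => rfl) (fun _ => rfl) (w.drop m) (c.act (moveAction ∅ (.copy p) 0 c.read)) rfl
    (fun n _ => by
      rw [Cfg.act_move_tape, Cfg.act_move_head_not_mem _ _ _ (by simp), ht, hh, ← Nat.cast_add,
        strTape_natCast, bitOf_map_inl, List.getElem?_drop])
    (fun i hi => by
      obtain ⟨l, rfl⟩ := hi
      rw [Cfg.act_move_tape]
      exact (hb _).1)
    (fun i hi => by
      obtain ⟨l, rfl⟩ := hi
      rw [Cfg.act_move_head_not_mem _ _ _ (by simp)]
      exact (hb _).2)
  have hne : ∀ l (i : Fin 0 ⊕ (N l).W), partTape N l (Sum.inr i) ∉ partInputs N := by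
    rintro l i ⟨l', h⟩
    by_cases hll : l' = l
    · subst hll
      exact absurd (partTape_injective N l' h) (by simp)
    · exact partTape_ne hll _ _ h
  have hne' : ∀ l (i : TapeIdx 0 (N l).W), partTape N l i ≠ Sum.inl () := by
    intro l i
    simp [partTape]
  refine ⟨c₂, (hl.trans hl₁).trans hl₂, h1, fun l => ⟨?_, ?_⟩⟩
  · rintro (_ | i) z
    · rw [(h2 _ ⟨l, rfl⟩).1]
      exact (symMap_strTape _ _ z).symm
    · rw [(h3 _ (hne l i) (hne' l _)).1, Cfg.act_move_tape, partTape, (hb _).1]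
      rfl
  · rintro (_ | i)
    · exact (h2 _ ⟨l, rfl⟩).2
    · rw [(h3 _ (hne l i) (hne' l _)).2, Cfg.act_move_head_not_mem _ _ _ (by simp), partTape,
        (hb _).2]
      rfl

open Classical in
/-- The effect of a step of the `l`-th machine on the family of all simulated machines. -/
lemma sees_update {Q₂ : Type} {c : Cfg 0 Q₂ (Σ l, (N l).α) (Σ l, TapeIdx 0 (N l).W)}
    {cs : ∀ l, Cfg 0 (N l).Q (N l).α (N l).W}
    (hs : ∀ l, Cfg.Sees (partTape N l) (partSym N l) c (cs l)) (l : ι) (q : Q₂)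
    (a : Action 0 (N l).Q (N l).α (N l).W) (l' : ι) :
    Cfg.Sees (partTape N l') (partSym N l')
      (c.act (Cfg.liftAction (partTape N l) (partSym N l) q c.read a))
      (Function.update cs l ((cs l).act a) l') := by
  by_cases h : l' = l
  · subst h
    rw [Function.update_self]
    exact (hs l').act (partTape_injective N l') q a
  · rw [Function.update_of_ne h]
    exact (hs l').act_of_disjoint (fun i j => partTape_ne (Ne.symm h) j i) q a

open Classical in
lemma update_state (cs : ∀ l, Cfg 0 (N l).Q (N l).α (N l).W) (l : ι)
    (c' : Cfg 0 (N l).Q (N l).α (N l).W) :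
    (fun l' => (Function.update cs l c' l').state) =
      Function.update (fun l' => (cs l').state) l c'.state := by
  funext l'
  by_cases h : l' = l
  · subst h
    simp
  · simp [h]

/-- The invariant is that any machine that can still accept belongs to `S`. A step of one machine
preserves it, since it shortens an accepting computation from the front. At the end, a machine in
its accepting state has an accepting computation of length `0`, so the set tested by `Good` lies in
`S`. -/
lemma good_of_accFrom_combineRule (hG : ∀ p S S', S ⊆ S' → Good p S → Good p S')
    (S : Set ι) (p : {p : List Bool // p.length ≤ m}) (t : ℕ)
    (c : Cfg 0 (CombineState (fun l => (N l).Q) m) (Σ l, (N l).α) (Σ l, TapeIdx 0 (N l).W))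
    (cs : ∀ l, Cfg 0 (N l).Q (N l).α (N l).W)
    (hs : ∀ l, Cfg.Sees (partTape N l) (partSym N l) c (cs l))
    (hq : c.state = .sim p fun l => (cs l).state)
    (hS : ∀ l t, AccFrom (N l).δ (N l).accept t (cs l) → l ∈ S)
    (hacc : AccFrom (combineRule N Good l₀) .accept t c) : Good p.1 S := by
  classical
  induction t generalizing c cs with
  | zero =>
    rw [AccFrom, hq] at hacc
    simp at hacc
  | succ t ih =>
    obtain ⟨a, ha, h⟩ := hacc
    rw [hq, combineRule] at ha
    rcases ha with ⟨l, a₁, ha₁, rfl⟩ | ⟨-, hgood⟩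
    · rw [(hs l).decode_read (partSym_injective N l)] at ha₁
      refine ih _ _ (sees_update hs l _ a₁) ?_ (fun l' t' h' => ?_) h
      · rw [Cfg.act_state, Cfg.liftAction_fst, update_state]
        congr!
      · by_cases hll : l' = l
        · subst hll
          rw [Function.update_self] at h'
          exact hS l' (t' + 1) ⟨a₁, ha₁, h'⟩
        · rw [Function.update_of_ne hll] at h'
          exact hS l' t' h'
    · exact hG _ _ _ (fun l hl => hS l 0 hl) hgood

/-- Only the machines in `S` are run, one step at a time, each up to the end of its accepting
computation; the induction is on the total number of remaining steps. Further machines in accepting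
states do no harm by monotonicity. The added `1` is the final step to `accept`. -/
lemma exists_accFrom_combineRule (hG : ∀ p S S', S ⊆ S' → Good p S → Good p S')
    (S : Finset ι) (p : {p : List Bool // p.length ≤ m}) (hgood : Good p.1 S) (n : ℕ) (T : ι → ℕ)
    (hT : ∑ l ∈ S, T l = n)
    (c : Cfg 0 (CombineState (fun l => (N l).Q) m) (Σ l, (N l).α) (Σ l, TapeIdx 0 (N l).W))
    (cs : ∀ l, Cfg 0 (N l).Q (N l).α (N l).W)
    (hs : ∀ l, Cfg.Sees (partTape N l) (partSym N l) c (cs l))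
    (hq : c.state = .sim p fun l => (cs l).state)
    (hacc : ∀ l ∈ S, AccFrom (N l).δ (N l).accept (T l) (cs l)) :
    AccFrom (combineRule N Good l₀) .accept (n + 1) c := by
  classical
  induction n generalizing T c cs with
  | zero =>
    refine ⟨(.accept, c.read, 0), ?_, rfl⟩
    rw [hq, combineRule]
    refine Or.inr ⟨rfl, hG _ _ _ (fun l hl => ?_) hgood⟩
    have := hacc l hl
    rw [Finset.sum_eq_zero_iff.1 hT l hl] at this
    exact this
  | succ n ih =>
    obtain ⟨l, hl, hne⟩ : ∃ l ∈ S, T l ≠ 0 := by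
      by_contra! h
      rw [Finset.sum_eq_zero h] at hT
      omega
    obtain ⟨t, ht⟩ := Nat.exists_eq_succ_of_ne_zero hne
    have hl' := hacc l hl
    rw [ht] at hl'
    obtain ⟨a, ha, h⟩ := hl'
    refine ⟨Cfg.liftAction (partTape N l) (partSym N l)
      (.sim p (Function.update (fun l => (cs l).state) l a.1)) c.read a, ?_,
      ih (Function.update T l t) ?_ _ _ (sees_update hs l _ a) ?_ fun l' hl' => ?_⟩
    · rw [hq, combineRule]
      refine Or.inl ⟨l, a, ?_, rfl⟩
      rwa [(hs l).decode_read (partSym_injective N l)]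
    · rw [Finset.sum_update_of_mem hl]
      rw [← Finset.add_sum_erase S T hl, ht, Finset.erase_eq] at hT
      omega
    · rw [Cfg.act_state, Cfg.liftAction_fst, update_state]
      rfl
    · by_cases hll : l' = l
      · subst hll
        rw [Function.update_self, Function.update_self]
        exact h
      · rw [Function.update_of_ne hll, Function.update_of_ne hll]
        exact hacc _ (by assumption)

/-- If `Good` is monotone, then the strings `p ++ x` with `|p| = m` for which the set of languages
that contain `x` satisfies `Good p` form a language in `NP`. -/
theorem combine_mem_NP [Finite ι] [Nonempty ι] (L : ι → Language Bool) (hL : ∀ l, L l ∈ NP)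
    (m : ℕ) (Good : List Bool → Set ι → Prop) (hG : ∀ p S S', S ⊆ S' → Good p S → Good p S') :
    ({w | m ≤ w.length ∧ Good (w.take m) {l | w.drop m ∈ L l}} : Language Bool) ∈ NP := by
  classical
  have := Fintype.ofFinite ι
  choose N p hN using hL
  obtain ⟨l₀⟩ := ‹Nonempty ι›
  refine ⟨⟨CombineState (fun l => (N l).Q) m, Σ l, (N l).α, Σ l, TapeIdx 0 (N l).W,
    .scan ⟨[], Nat.zero_le m⟩, .accept, combineRule N Good l₀⟩,
    -- Up to the simulation there are `m + 1` steps for the prefix and `2 * (|w| - m) + 2` for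
    -- copying and rewinding; the final step to `accept` completes the constant `m + 4`.
    (Polynomial.C (m + 4) + 2 * Polynomial.X) + ∑ l, p l, fun w => ⟨fun t ht => ?_, ?_⟩⟩
  · rw [NTM.acceptsIn_iff] at ht
    rcases lt_or_ge w.length m with hw | hw
    · exact absurd ht (not_accFrom_combineRule_of_short hw t)
    · obtain ⟨c, hl, hq, hs⟩ := combineRule_leads_sim (N := N) (Good := Good) (l₀ := l₀) w hw
      obtain ⟨t', -, h⟩ := (hl t).1 ht
      refine ⟨hw, good_of_accFrom_combineRule hG _ ⟨w.take m, by simp⟩ t' c _ hs hq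
        (fun l t h => (hN l _).1 t ((NTM.acceptsIn_iff _ _ _).2 h)) h⟩
  · rintro ⟨hw, hgood⟩
    obtain ⟨c, hl, hq, hs⟩ := combineRule_leads_sim (N := N) (Good := Good) (l₀ := l₀) w hw
    -- For languages that do not contain the string, the time `0` is a dummy; these machines are not
    -- run.
    have hex : ∀ l, ∃ t ≤ (p l).eval (w.drop m).length,
        w.drop m ∈ L l → (N l).AcceptsIn (w.drop m) t := fun l => by
      by_cases h : w.drop m ∈ L l
      · obtain ⟨t, ht, h'⟩ := (hN l _).2 h
        exact ⟨t, ht, fun _ => h'⟩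
      · exact ⟨0, Nat.zero_le _, fun h' => absurd h' h⟩
    choose T hT hacc using hex
    refine ⟨_, ?_, (NTM.acceptsIn_iff _ _ _).2 ((hl _).2 ⟨_, rfl,
      exists_accFrom_combineRule hG (Finset.univ.filter fun l => w.drop m ∈ L l)
        ⟨w.take m, by simp⟩ (by simpa using hgood) _ T rfl c _ hs hq fun l hl => ?_⟩)⟩
    · have h1 : ∑ l with w.drop m ∈ L l, T l ≤ ∑ l, (p l).eval w.length :=
        (Finset.sum_le_univ_sum_of_nonneg fun _ => Nat.zero_le _).trans
          (Finset.sum_le_sum fun l _ => (hT l).trans (eval_mono _ (by simp)))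
      simp only [Polynomial.eval_add, Polynomial.eval_C, Polynomial.eval_mul,
        Polynomial.eval_ofNat, Polynomial.eval_X, Polynomial.eval_finsetSum, List.length_drop]
      omega
    · exact (NTM.acceptsIn_iff _ _ _).1 (hacc l (by simpa using hl))

end Combine

/-! ### Mind changes -/

section Chain

variable {n : ℕ}

/-- There are vectors `0 = v 0 ≤ v 1 ≤ … ≤ v c ≤ a` along which `out` changes `c` times. -/
def HasChain (out : (Fin n → Bool) → Bool) (a : Fin n → Bool) (c : ℕ) : Prop :=
  ∃ v : ℕ → Fin n → Bool, v 0 = (fun _ => false) ∧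
    (∀ i < c, v i ≤ v (i + 1) ∧ out (v i) ≠ out (v (i + 1))) ∧ v c ≤ a

variable {out : (Fin n → Bool) → Bool} {a : Fin n → Bool}

lemma HasChain.mono {a' : Fin n → Bool} {c : ℕ} (h : HasChain out a c) (ha : a ≤ a') :
    HasChain out a' c := by
  obtain ⟨v, h0, hs, hc⟩ := h
  exact ⟨v, h0, hs, hc.trans ha⟩

lemma hasChain_zero : HasChain out a 0 :=
  ⟨fun _ _ => false, rfl, by simp, fun _ => Bool.false_le _⟩

lemma HasChain.of_succ {c : ℕ} (h : HasChain out a (c + 1)) : HasChain out a c := by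
  obtain ⟨v, h0, hs, hc⟩ := h
  exact ⟨v, h0, fun i hi => hs i (by omega), (hs c (by omega)).1.trans hc⟩

lemma HasChain.of_le {c c' : ℕ} (h : HasChain out a c) (hc : c' ≤ c) : HasChain out a c' := by
  induction c, hc using Nat.le_induction with
  | base => exact h
  | succ c _ ih => exact ih h.of_succ

/-- A change of `out` forces a strict increase, so the `i`-th vector has at least `i` ones. -/
lemma HasChain.le {c : ℕ} (h : HasChain out a c) : c ≤ n := by
  obtain ⟨v, h0, hs, hc⟩ := h
  have key : ∀ i ≤ c, i ≤ (Finset.univ.filter fun j => v i j = true).card := by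
    intro i
    induction i with
    | zero => intro _; exact Nat.zero_le _
    | succ i ih =>
      intro hi
      have h1 := hs i (by omega)
      have hne : v i ≠ v (i + 1) := fun h => h1.2 (by rw [h])
      refine (ih (by omega)).trans_lt (Finset.card_lt_card ?_)
      refine (Finset.ssubset_iff_subset_ne).2 ⟨fun j => ?_, fun heq => hne ?_⟩
      · simp only [Finset.mem_filter, Finset.mem_univ, true_and]
        intro hj
        have := h1.1 j
        rw [hj] at this
        exact Bool.eq_true_of_true_le this
      · funext j
        have := Finset.ext_iff.1 heq j
        simp only [Finset.mem_filter, Finset.mem_univ, true_and] at this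
        exact Bool.eq_iff_iff.2 this
  simpa using (key c le_rfl).trans (Finset.card_filter_le _ _)

/-- The value of `out` at `a` is determined by its value at `0` and the parity of the largest
number of changes. -/
lemma exists_chain_length (out : (Fin n → Bool) → Bool) (a : Fin n → Bool) :
    ∃ c ≤ n, (∀ i, HasChain out a i ↔ i ≤ c) ∧
      out a = xor (out fun _ => false) (decide (Odd c)) := by
  classical
  have hex : ∃ c, ¬HasChain out a (c + 1) := ⟨n, fun h => by have := h.le; omega⟩
  have hspec := Nat.find_spec hex
  set c := Nat.find hex with hc
  have hchain : HasChain out a c := by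
    rcases Nat.eq_zero_or_pos c with h0 | h0
    · rw [h0]
      exact hasChain_zero
    · have := Nat.find_min hex (m := c - 1) (by omega)
      rw [not_not, show c - 1 + 1 = c by omega] at this
      exact this
  refine ⟨c, hchain.le, fun i => ⟨fun h => ?_, fun h => hchain.of_le h⟩, ?_⟩
  · by_contra hlt
    exact hspec (h.of_le (by omega))
  · obtain ⟨v, h0, hs, hca⟩ := hchain
    have key : ∀ i ≤ c, out (v i) = xor (out fun _ => false) (decide (Odd i)) := by
      intro i
      induction i with
      | zero => simp [h0]
      | succ i ih =>
        intro hi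
        have h1 := (hs i (by omega)).2
        rw [ih (by omega)] at h1
        have h2 : decide (Odd (i + 1)) = !decide (Odd i) := by
          rw [Bool.eq_iff_iff]
          simp [Nat.odd_add_one]
        rw [h2]
        revert h1
        generalize out (v (i + 1)) = o
        generalize (out fun _ => false) = o'
        cases o <;> cases o' <;> cases decide (Odd i) <;> simp
    rw [← key c le_rfl]
    by_contra hne
    -- If `out` differed between the end of the chain and `a`, appending `a` would give one more
    -- change.
    refine hspec ⟨fun i => if i ≤ c then v i else a, by simp [h0], fun i hi => ?_, by simp⟩
    rcases Nat.lt_succ_iff_lt_or_eq.1 hi with h | rfl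
    · simp only [if_pos h.le, if_pos (Nat.succ_le_of_lt h)]
      exact hs i h
    · simp only [le_refl, if_true, if_neg (Nat.not_succ_le_self _)]
      exact ⟨hca, fun h => hne h.symm⟩

/-- The thresholds `2 * j + 1` and `2 * j + 2` are separated by `c` only if `c = 2 * j + 1`. The
bound on `c` guarantees that every odd value occurs for some `j` below `k`. -/
lemma exists_xor_iff_odd {k c : ℕ} (hc : c ≤ 2 * k) {f : Fin k → Bool → Bool}
    (hf : ∀ j b, f j b = true ↔ 2 * j.1 + b.toNat + 1 ≤ c) :
    (∃ j, xor (f j false) (f j true) = true) ↔ Odd c := by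
  have key : ∀ j, xor (f j false) (f j true) = true ↔ c = 2 * j.1 + 1 := by
    intro j
    have h0 := hf j false
    have h1 := hf j true
    simp only [Bool.toNat_false, Bool.toNat_true] at h0 h1
    revert h0 h1
    cases f j false <;> cases f j true <;> simp <;> omega
  simp only [key]
  constructor
  · rintro ⟨j, hj⟩
    exact ⟨j, hj⟩
  · rintro ⟨i, hi⟩
    exact ⟨⟨i, by omega⟩, hi⟩

end Chain

/-! ### Runs with fixed answers and with an oracle -/

namespace DOTM

variable {k : ℕ} {D : DOTM k}

lemma run_congr_of_no_call {O O' : Cfg k D.Q D.α D.W → Fin k → Bool} {x : List Bool} {t : ℕ}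
    (h : ∀ s < t, (D.run O x s).state ≠ D.pre) : D.run O x t = D.run O' x t := by
  induction t with
  | zero => rfl
  | succ t ih =>
    rw [run_succ, run_succ, ← ih fun s hs => h s (by omega), step, step]
    simp only [if_neg (h t (by omega))]

/-- Up to the call the run does not depend on the answers, so the strings on the query tapes are
those of the run with negative answers, to which `queryLang` refers. As there is only one call, the
true answers may be fixed in advance. -/
lemma run_answers_eq (hD : D.NonAdaptive) (A : Language Bool) (x : List Bool) (v : Fin k → Bool)
    (hv : ∀ j, v j = true ↔ x ∈ queryLang D A j) (t : ℕ) :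
    D.run (Cfg.answers A) x t = D.run (fun _ => v) x t := by
  classical
  induction t with
  | zero => rfl
  | succ t ih =>
    rw [run_succ, run_succ, ih, step, step]
    by_cases hpre : (D.run (fun _ => v) x t).state = D.pre
    · have hmin : ∀ s < t, (D.run (fun _ => v) x s).state ≠ D.pre :=
        fun s hs h => hD v x s t hs h hpre
      have h0 : D.run (fun _ => v) x t = D.run (fun _ _ => false) x t := run_congr_of_no_call hmin
      have hans : (D.run (fun _ => v) x t).answers A = v := by
        funext j
        rw [Bool.eq_iff_iff, hv j]
        constructor
        · intro h
          exact ⟨t, h0 ▸ hpre, h0 ▸ h⟩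
        · rintro ⟨t', ht', h⟩
          obtain rfl : t = t' := by
            rw [h0] at hpre
            rcases lt_trichotomy t t' with hlt | hlt | hlt
            · exact absurd ht' (hD (fun _ => false) x t t' hlt hpre)
            · exact hlt
            · exact absurd hpre (hD (fun _ => false) x t' t hlt ht')
          rw [h0]
          exact h
      simp only [hans]
    · simp only [if_neg hpre]

lemma mem_outLang_iff {p : Polynomial ℕ} (hp : D.RunsInTime p) (v : Fin k → Bool) (b : Bool)
    (x : List Bool) :
    x ∈ outLang D v b ↔ D.output (D.run (fun _ => v) x (p.eval x.length)).state = some b := by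
  refine ⟨fun ⟨t, ht⟩ => ?_, fun h => ⟨_, h⟩⟩
  rcases le_total t (p.eval x.length) with h | h
  · rw [run_eq_of_halted (by rw [ht]; simp) h, ht]
  · rw [← run_eq_of_halted (hp v x) h, ht]

end DOTM

/-! ### The oracle -/

/-- The query prefix with index `j` and bit `b`. -/
def queryPrefix (k : ℕ) (j : Fin k) (b : Bool) : List Bool :=
  b :: List.ofFn fun i : Fin k => decide (i = j)

@[simp] lemma length_queryPrefix (k : ℕ) (j : Fin k) (b : Bool) :
    (queryPrefix k j b).length = k + 1 := by
  simp [queryPrefix]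

/-- The index is coded in unary position form, so all prefixes have length `k + 1` and can be split
off from the input. The bit comes first and thus stands next to the answer cell. -/
lemma queryPrefix_inj {k : ℕ} {j j' : Fin k} {b b' : Bool}
    (h : queryPrefix k j b = queryPrefix k j' b') : j = j' ∧ b = b' := by
  simp only [queryPrefix, List.cons.injEq, List.ofFn_inj] at h
  refine ⟨?_, h.1⟩
  simpa using congrFun h.2 j

section Oracle

variable {k : ℕ} (D : DOTM (2 * k)) (A : Language Bool)

/-- The languages that tell the outputs of `D` and the answers to its queries. -/
def infoLang : ((Fin (2 * k) → Bool) × Bool) ⊕ Fin (2 * k) → Language Bool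
  | Sum.inl (v, b) => outLang D v b
  | Sum.inr j => queryLang D A j

open Classical in
/-- The prefix `p` asks for at most as many mind changes as are possible according to `S`. -/
def Supports (k : ℕ) (p : List Bool)
    (S : Set (((Fin (2 * k) → Bool) × Bool) ⊕ Fin (2 * k))) : Prop :=
  ∃ (j : Fin k) (b : Bool), p = queryPrefix k j b ∧ ∃ out : (Fin (2 * k) → Bool) → Bool,
    (∀ v, Sum.inl (v, out v) ∈ S) ∧
    HasChain out (fun j => decide (Sum.inr j ∈ S)) (2 * j.1 + b.toNat + 1)

/-- Both requirements are positive: each value of `out` is certified by a membership and never by an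
absence, and enlarging the set of positive answers leaves more room for chains. -/
lemma Supports.mono {p : List Bool} {S S' : Set (((Fin (2 * k) → Bool) × Bool) ⊕ Fin (2 * k))}
    (hS : S ⊆ S') (h : Supports k p S) : Supports k p S' := by
  obtain ⟨j, b, hp, out, hout, hc⟩ := h
  refine ⟨j, b, hp, out, fun v => hS (hout v), hc.mono fun j' => ?_⟩
  by_cases hj : (Sum.inr j' : ((Fin (2 * k) → Bool) × Bool) ⊕ Fin (2 * k)) ∈ S
  · simp [hj, hS hj]
  · simp [hj]

/-- The oracle of mind changes: it contains `queryPrefix k j b ++ x` if on input `x` there are at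
least `2 * j + b + 1` mind changes. -/
def mindChangeLang : Language Bool :=
  {w | k + 1 ≤ w.length ∧ Supports k (w.take (k + 1)) {l | w.drop (k + 1) ∈ infoLang D A l}}

lemma mindChangeLang_mem_NP {p : Polynomial ℕ} (hp : D.RunsInTime p) (hD : D.NonAdaptive)
    (hA : A ∈ NP) : mindChangeLang D A ∈ NP := by
  have : Nonempty (((Fin (2 * k) → Bool) × Bool) ⊕ Fin (2 * k)) :=
    ⟨Sum.inl (fun _ => false, false)⟩
  refine combine_mem_NP (infoLang D A) ?_ (k + 1) (Supports k) fun p S S' h => Supports.mono h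
  rintro (⟨v, b⟩ | j)
  · exact outLang_mem_NP D v b hp
  · exact queryLang_mem_NP D A j hp hD hA

open Classical in
-- The function guessed in `Supports` has to be the true one, because `D` has only one output for
-- each vector of answers.
lemma mem_mindChangeLang_iff {p : Polynomial ℕ} (hp : D.RunsInTime p) (x : List Bool)
    (out : (Fin (2 * k) → Bool) → Bool)
    (hout : ∀ v, D.output (D.run (fun _ => v) x (p.eval x.length)).state = some (out v))
    (j : Fin k) (b : Bool) :
    queryPrefix k j b ++ x ∈ mindChangeLang D A ↔
      HasChain out (fun j => decide (x ∈ queryLang D A j)) (2 * j.1 + b.toNat + 1) := by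
  have htake : (queryPrefix k j b ++ x).take (k + 1) = queryPrefix k j b :=
    List.take_left' (by simp)
  have hdrop : (queryPrefix k j b ++ x).drop (k + 1) = x := List.drop_left' (by simp)
  constructor
  · rintro ⟨-, h⟩
    rw [htake, hdrop] at h
    obtain ⟨j', b', hpre, out', hout', hc⟩ := h
    obtain ⟨rfl, rfl⟩ := queryPrefix_inj hpre
    obtain rfl : out = out' := by
      funext v
      have := (DOTM.mem_outLang_iff hp v _ x).1 (hout' v)
      rw [hout v] at this
      simpa using this
    exact hc
  · intro h
    refine ⟨by simp, ?_⟩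
    rw [htake, hdrop]
    exact ⟨j, b, rfl, out, fun v => (DOTM.mem_outLang_iff hp v _ x).2 (hout v), h⟩

end Oracle

open Classical in
/-- A language with `2 * k` non-adaptive `NP` queries is reduced to the output of a deterministic
machine with negative answers and to `k` exclusive-ors of two queries to an `NP` oracle. -/
theorem exists_xor_oracle {k : ℕ} {L : Language Bool} (hL : L ∈ PParNP (2 * k)) :
    ∃ (D : DOTM (2 * k)) (p : Polynomial ℕ), ∃ B ∈ NP, ∀ x : List Bool, ∃ b : Bool,
      D.output (D.run (fun _ _ => false) x (p.eval x.length)).state = some b ∧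
      decide (x ∈ L) = xor b (decide (∃ j : Fin k,
        xor (decide (queryPrefix k j false ++ x ∈ B))
          (decide (queryPrefix k j true ++ x ∈ B)) = true)) := by
  obtain ⟨A, hA, D, p, hp, hD, hLx⟩ := hL
  refine ⟨D, p, mindChangeLang D A, mindChangeLang_mem_NP D A hp hD hA, fun x => ?_⟩
  have hex : ∀ v, ∃ b, D.output (D.run (fun _ => v) x (p.eval x.length)).state = some b :=
    fun v => Option.ne_none_iff_exists'.1 (hp v x)
  choose out hout using hex
  refine ⟨out fun _ => false, hout _, ?_⟩
  set a : Fin (2 * k) → Bool := fun j => decide (x ∈ queryLang D A j) with ha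
  obtain ⟨c, hc, hchain, hpar⟩ := exists_chain_length out a
  have h1 : decide (x ∈ L) = out a := by
    have := hLx x
    rw [DOTM.run_answers_eq hD A x a (by simp [ha]), hout a] at this
    simpa using this.symm
  have h2 := exists_xor_iff_odd hc (f := fun j b => decide (queryPrefix k j b ++ x ∈
    mindChangeLang D A)) fun j b => by
      rw [decide_eq_true_iff, mem_mindChangeLang_iff D A hp x out hout, hchain]
  rw [h1, hpar]
  congr 1
  rw [Bool.eq_iff_iff, decide_eq_true_iff, decide_eq_true_iff, ← h2]

/-! ### Unitary operators on superpositions -/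

section Unitary

open ComplexConjugate

variable {X : Type}

/-- The squared norm of a superposition. -/
noncomputable def sqNorm (ψ : X →₀ ℂ) : ℝ := ψ.sum fun _ z => ‖z‖ ^ 2

/-- The inner product of superpositions. -/
noncomputable def innerSum (φ ψ : X →₀ ℂ) : ℂ := φ.sum fun x z => conj z * ψ x

lemma innerSum_self (ψ : X →₀ ℂ) : innerSum ψ ψ = (sqNorm ψ : ℂ) := by
  simp only [innerSum, sqNorm, Finsupp.sum, Complex.ofReal_sum]
  refine Finset.sum_congr rfl fun x _ => ?_
  rw [Complex.conj_mul']
  norm_cast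

lemma innerSum_add_left (φ φ' ψ : X →₀ ℂ) :
    innerSum (φ + φ') ψ = innerSum φ ψ + innerSum φ' ψ := by
  classical
  exact Finsupp.sum_add_index' (by simp) (by intros; rw [map_add, add_mul])

lemma innerSum_add_right (φ ψ ψ' : X →₀ ℂ) :
    innerSum φ (ψ + ψ') = innerSum φ ψ + innerSum φ ψ' := by
  simp only [innerSum, Finsupp.add_apply, mul_add]
  exact Finsupp.sum_add

lemma innerSum_single_left (x : X) (a : ℂ) (ψ : X →₀ ℂ) :
    innerSum (Finsupp.single x a) ψ = conj a * ψ x :=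
  Finsupp.sum_single_index (by simp)

lemma innerSum_single_right (φ : X →₀ ℂ) (x : X) (a : ℂ) :
    innerSum φ (Finsupp.single x a) = conj (φ x) * a := by
  classical
  induction φ using Finsupp.induction_linear with
  | zero => simp [innerSum]
  | add f g hf hg => rw [innerSum_add_left, hf, hg, Finsupp.add_apply, map_add, add_mul]
  | single y b =>
    rw [innerSum_single_left, Finsupp.single_apply, Finsupp.single_apply]
    by_cases h : x = y
    · simp [h]
    · simp [h, Ne.symm h]

variable {g : X → X →₀ ℂ}

/-- An operator with a Hermitian matrix is self-adjoint; by additivity this is checked on basis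
states. -/
lemma innerSum_linearCombination (hg : ∀ x y, g x y = conj (g y x)) (φ ψ : X →₀ ℂ) :
    innerSum (Finsupp.linearCombination ℂ g φ) ψ =
      innerSum φ (Finsupp.linearCombination ℂ g ψ) := by
  induction φ using Finsupp.induction_linear with
  | zero => simp [innerSum]
  | add f f' hf hf' => rw [map_add, innerSum_add_left, innerSum_add_left, hf, hf']
  | single x a =>
    induction ψ using Finsupp.induction_linear with
    | zero => simp [innerSum]
    | add f f' hf hf' => rw [map_add, innerSum_add_right, innerSum_add_right, hf, hf']
    | single y b =>
      rw [Finsupp.linearCombination_single, Finsupp.linearCombination_single,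
        innerSum_single_left, innerSum_single_right, Finsupp.smul_apply, Finsupp.smul_apply,
        smul_eq_mul, smul_eq_mul, map_mul, ← hg y x]
      ring

/-- A Hermitian involution followed by a permutation of the basis is unitary. -/
lemma bijective_and_sqNorm_of_involution (hg : ∀ x y, g x y = conj (g y x))
    (hgg : ∀ x, Finsupp.linearCombination ℂ g (g x) = Finsupp.single x 1)
    {F : X → X} (hF : Function.Bijective F) :
    Function.Bijective (Finsupp.linearCombination ℂ fun x => Finsupp.mapDomain F (g x)) ∧
      ∀ ψ, sqNorm (Finsupp.linearCombination ℂ (fun x => Finsupp.mapDomain F (g x)) ψ) =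
        sqNorm ψ := by
  set G := Finsupp.linearCombination ℂ g with hG
  have hinv : ∀ ψ, G (G ψ) = ψ := by
    intro ψ
    have : G ∘ₗ G = LinearMap.id := by
      refine Finsupp.lhom_ext' fun x => LinearMap.ext_ring ?_
      have := hgg x
      simpa [hG] using this
    exact congrArg (fun f => f ψ) this
  have hcomp : ∀ ψ, Finsupp.linearCombination ℂ (fun x => Finsupp.mapDomain F (g x)) ψ =
      Finsupp.mapDomain F (G ψ) := by
    intro ψ
    have : Finsupp.linearCombination ℂ (fun x => Finsupp.mapDomain F (g x)) =
        Finsupp.lmapDomain ℂ ℂ F ∘ₗ G := by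
      refine Finsupp.lhom_ext' fun x => LinearMap.ext_ring ?_
      simp [hG]
    exact congrArg (fun f => f ψ) this
  constructor
  · have : ⇑(Finsupp.linearCombination ℂ fun x => Finsupp.mapDomain F (g x)) =
        Finsupp.mapDomain F ∘ G := funext hcomp
    rw [this]
    exact Function.Bijective.comp
      ⟨Finsupp.mapDomain_injective hF.1, Finsupp.mapDomain_surjective hF.2⟩
      (Function.Involutive.bijective hinv)
  · intro ψ
    rw [hcomp, sqNorm, Finsupp.sum_mapDomain_index_inj hF.1]
    -- A self-adjoint involution preserves the inner product: one `G` is moved to the other side,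
    -- where it cancels. The permutation `F` merely relabels amplitudes.
    have h : innerSum (G ψ) (G ψ) = innerSum ψ ψ := by
      rw [hG, innerSum_linearCombination hg, ← hG, hinv]
    rw [innerSum_self, innerSum_self] at h
    exact_mod_cast h

end Unitary

/-! ### Oracle calls -/

namespace Cfg

variable {k : ℕ} {Q α W : Type}

@[simp] lemma call_state (c : Cfg k Q α W) (q : Q) (v : Fin k → Bool) :
    (c.call q v).state = q := rfl

/-- The flipped answer cell lies outside the query string. Hence the same call, made again, gets the
same answers and undoes itself, as reversibility requires. -/
lemma hasQuery_call (c : Cfg k Q α W) (q : Q) (v : Fin k → Bool) (j : Fin k) (w : List Bool) :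
    (c.call q v).HasQuery j w ↔ c.HasQuery j w := by
  have key : ∀ n : ℕ, (c.call q v).tape (Sum.inr (Sum.inl j))
      ((c.call q v).head (Sum.inr (Sum.inl j)) + 1 + n) =
      c.tape (Sum.inr (Sum.inl j)) (c.head (Sum.inr (Sum.inl j)) + 1 + n) := by
    intro n
    simp only [call]
    split_ifs
    · exact Function.update_of_ne (by omega) _ _
    · rfl
  rw [hasQuery_iff, hasQuery_iff]
  simp only [key]

lemma answers_call (A : Language Bool) (c : Cfg k Q α W) (q : Q) (v : Fin k → Bool) :
    (c.call q v).answers A = c.answers A := by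
  funext j
  rw [Bool.eq_iff_iff, answers_eq_true, answers_eq_true]
  simp only [hasQuery_call]

lemma call_call (c : Cfg k Q α W) (q : Q) (v : Fin k → Bool) :
    (c.call q v).call c.state v = c := by
  ext i z
  · rfl
  · rcases i with i | j | i
    · rfl
    · rw [call]
      by_cases hv : v j
      · simp [call, read, hv]
      · simp [call, hv]
    · rfl
  · rfl

open Classical in
/-- Flip the scanned bit of the `j`-th query tape. -/
noncomputable def flipHead (c : Cfg k Q α W) (j : Fin k) : Cfg k Q α W where
  state := c.state
  tape := Function.update c.tape (Sum.inr (Sum.inl j))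
    (Function.update (c.tape (Sum.inr (Sum.inl j))) (c.head (Sum.inr (Sum.inl j)))
      (flip (c.read (Sum.inr (Sum.inl j)))))
  head := c.head

open Classical in
lemma read_flipHead (c : Cfg k Q α W) (j : Fin k) :
    (c.flipHead j).read = Function.update c.read (Sum.inr (Sum.inl j))
      (flip (c.read (Sum.inr (Sum.inl j)))) := by
  funext i
  by_cases h : i = Sum.inr (Sum.inl j)
  · subst h
    simp [flipHead, read]
  · simp [flipHead, read, h]

lemma flipHead_flipHead (c : Cfg k Q α W) (j : Fin k) : (c.flipHead j).flipHead j = c := by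
  rw [flipHead, read_flipHead]
  ext i z
  · rfl
  · by_cases h : i = Sum.inr (Sum.inl j)
    · subst h
      simp [flipHead, read]
    · simp [flipHead, h]
  · rfl

/-- An action overwrites the flipped cell. So the two branches of a Hadamard gate can be expressed
as two actions on the same configuration. -/
lemma act_flipHead (c : Cfg k Q α W) (j : Fin k) (a : Action k Q α W) :
    (c.flipHead j).act a = c.act a := by
  ext i z
  · rfl
  · by_cases h : i = Sum.inr (Sum.inl j)
    · subst h
      simp [flipHead, act_tape]
    · simp [flipHead, act_tape, h]
  · rfl

end Cfg

/-! ### Reversible machines with Hadamard gates -/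

/-- A reversible machine: a permutation `σ` of the pairs of a state and scanned symbols, head moves
that depend on the new state only, and Hadamard gates that some states apply to the scanned cell of
a query tape before the permutation. -/
structure RevRule (k : ℕ) (Q α W : Type) where
  σ : Equiv.Perm (Q × (TapeIdx k W → Sym α))
  move : Q → TapeIdx k W → SignType
  had : Q → Option (Fin k)
  pre : Q
  post : Q
  σ_pre : ∀ s, σ (pre, s) = (post, s)
  had_pre : had pre = none

namespace RevRule

variable {k : ℕ} {Q α W : Type} (R : RevRule k Q α W)

/-- The action with a given new state and given written symbols. -/
def action (r : Q × (TapeIdx k W → Sym α)) : Action k Q α W := (r.1, r.2, R.move r.1)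

lemma action_injective : Function.Injective R.action := by
  rintro ⟨q, s⟩ ⟨q', s'⟩ h
  simp only [action, Prod.mk.injEq] at h
  exact Prod.ext h.1 h.2.1

open Classical in
/-- The successor configuration, apart from the Hadamard gates. -/
noncomputable def next (A : Language Bool) (c : Cfg k Q α W) : Cfg k Q α W :=
  if c.state = R.pre then c.call R.post (c.answers A)
  else c.act (R.action (R.σ (c.state, c.read)))

open Classical in
/-- The predecessor configuration, apart from the Hadamard gates. -/
noncomputable def prev (A : Language Bool) (c : Cfg k Q α W) : Cfg k Q α W :=
  if c.state = R.post then c.call R.pre (c.answers A)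
  else
    let h : TapeIdx k W → ℤ := fun i => c.head i - (R.move c.state i : ℤ)
    let r := R.σ.symm (c.state, fun i => c.tape i (h i))
    ⟨r.1, fun i => Function.update (c.tape i) (h i) (r.2 i), h⟩

/-- All pairs with state `post` are already images of pairs with state `pre`. Thus `post` is entered
by calls only, and `prev` can tell which kind of step to undo. -/
lemma σ_fst_ne_post {q : Q} (hq : q ≠ R.pre) (s : TapeIdx k W → Sym α) :
    (R.σ (q, s)).1 ≠ R.post := by
  intro h
  have : R.σ (q, s) = R.σ (R.pre, (R.σ (q, s)).2) := by
    rw [R.σ_pre, ← h]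
  exact hq (congrArg Prod.fst (R.σ.injective this))

lemma σ_symm_fst_ne_pre {q : Q} (hq : q ≠ R.post) (s : TapeIdx k W → Sym α) :
    (R.σ.symm (q, s)).1 ≠ R.pre := by
  intro h
  have h' : R.σ (R.pre, (R.σ.symm (q, s)).2) = (q, s) := by
    rw [← h]
    exact R.σ.apply_symm_apply (q, s)
  rw [R.σ_pre] at h'
  exact hq (congrArg Prod.fst h').symm

/-- Since moves depend on the new state only, the old head positions can be read off; the symbols
found there determine the old state and symbols through the inverse of `σ`. -/
lemma prev_next (A : Language Bool) (c : Cfg k Q α W) : R.prev A (R.next A c) = c := by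
  unfold next
  split_ifs with h
  · rw [prev, if_pos (Cfg.call_state _ _ _), Cfg.answers_call, ← h, Cfg.call_call]
  · have hne : (c.act (R.action (R.σ (c.state, c.read)))).state ≠ R.post := R.σ_fst_ne_post h _
    rw [prev, if_neg hne]
    simp only [Cfg.act, action, add_sub_cancel_right, Function.update_self,
      Prod.mk.eta, Equiv.symm_apply_apply, Function.update_idem]
    ext i z
    · rfl
    · simp [Cfg.read]
    · rfl

lemma next_prev (A : Language Bool) (c : Cfg k Q α W) : R.next A (R.prev A c) = c := by
  unfold prev
  split_ifs with h
  · rw [next, if_pos (Cfg.call_state _ _ _), Cfg.answers_call, ← h, Cfg.call_call]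
  · set head : TapeIdx k W → ℤ := fun i => c.head i - (R.move c.state i : ℤ) with hhead
    set r := R.σ.symm (c.state, fun i => c.tape i (head i)) with hrdef
    have hr : R.σ r = (c.state, fun i => c.tape i (head i)) := R.σ.apply_symm_apply _
    set c₁ : Cfg k Q α W := ⟨r.1, fun i => Function.update (c.tape i) (head i) (r.2 i), head⟩
      with hc₁
    have hread : (c₁.state, c₁.read) = r := Prod.ext rfl (funext fun i => by simp [hc₁, Cfg.read])
    have hne : c₁.state ≠ R.pre := R.σ_symm_fst_ne_pre h _
    rw [next, if_neg hne, hread, hr]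
    ext i z
    · rfl
    · simp [Cfg.act_tape, action, hc₁]
    · simp [Cfg.act_head, action, hc₁, hhead]

lemma next_bijective (A : Language Bool) : Function.Bijective (R.next A) :=
  ⟨Function.LeftInverse.injective (R.prev_next A),
    Function.RightInverse.surjective (R.next_prev A)⟩

/-- The query tape and the bit to which a Hadamard gate is applied, if any. -/
def hadBit (q : Q) (s : TapeIdx k W → Sym α) : Option (Fin k × Bool) :=
  (R.had q).bind fun j => (bitOf (s (Sum.inr (Sum.inl j)))).map fun b => (j, b)

lemma hadBit_eq_some {q : Q} {s : TapeIdx k W → Sym α} {j : Fin k} {b : Bool} :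
    R.hadBit q s = some (j, b) ↔ R.had q = some j ∧ s (Sum.inr (Sum.inl j)) = bit b := by
  unfold hadBit
  cases hq : R.had q with
  | none => simp
  | some j' =>
    simp only [Option.bind_some, Option.map_eq_some_iff, Prod.mk.injEq, Option.some.injEq,
      bitOf_eq_some]
    constructor
    · rintro ⟨b', hb, rfl, rfl⟩
      exact ⟨rfl, hb⟩
    · rintro ⟨rfl, hb⟩
      exact ⟨b, hb, rfl, rfl⟩

lemma hadBit_of_had_eq_none {q : Q} (hq : R.had q = none) (s : TapeIdx k W → Sym α) :
    R.hadBit q s = none := by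
  simp [hadBit, hq]

/-- The amplitudes of a Hadamard gate. -/
noncomputable def amp (b : Bool) : ℂ :=
  if b then ((-(1 / √2) : ℝ) : ℂ) else ((1 / √2 : ℝ) : ℂ)

@[simp] lemma amp_true : amp true = -amp false := by simp [amp]

lemma amp_mul_self : amp false * amp false = 1 / 2 := by
  simp only [amp, Bool.false_eq_true, if_false]
  rw [← Complex.ofReal_mul, div_mul_div_comm, one_mul, Real.mul_self_sqrt (by norm_num)]
  norm_num

lemma conj_amp (b : Bool) : (starRingEnd ℂ) (amp b) = amp b := by
  unfold amp
  split_ifs <;> exact Complex.conj_ofReal _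

/-- The Hadamard gate that is applied to a configuration. -/
noncomputable def mix (c : Cfg k Q α W) : Cfg k Q α W →₀ ℂ :=
  match R.hadBit c.state c.read with
  | none => Finsupp.single c 1
  | some (j, b) => Finsupp.single (c.flipHead j) (amp false) + Finsupp.single c (amp b)

lemma mix_of_none {c : Cfg k Q α W} (h : R.hadBit c.state c.read = none) :
    R.mix c = Finsupp.single c 1 := by
  rw [mix, h]

lemma mix_of_some {c : Cfg k Q α W} {j : Fin k} {b : Bool}
    (h : R.hadBit c.state c.read = some (j, b)) :
    R.mix c = Finsupp.single (c.flipHead j) (amp false) + Finsupp.single c (amp b) := by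
  rw [mix, h]

lemma hadBit_flipHead {c : Cfg k Q α W} {j : Fin k} {b : Bool}
    (h : R.hadBit c.state c.read = some (j, b)) :
    R.hadBit (c.flipHead j).state (c.flipHead j).read = some (j, !b) := by
  rw [hadBit_eq_some] at h ⊢
  refine ⟨h.1, ?_⟩
  classical
  rw [Cfg.read_flipHead, Function.update_self, h.2, flip_bit]

/-- The square of the Hadamard matrix is the identity: the diagonal terms give 1/2 + 1/2, and the
off-diagonal terms cancel by sign. -/
lemma linearCombination_mix (c : Cfg k Q α W) :
    Finsupp.linearCombination ℂ R.mix (R.mix c) = Finsupp.single c 1 := by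
  rcases h : R.hadBit c.state c.read with _ | ⟨j, b⟩
  · rw [R.mix_of_none h, Finsupp.linearCombination_single, one_smul, R.mix_of_none h]
  · have h' := R.hadBit_flipHead h
    rw [R.mix_of_some h, map_add, Finsupp.linearCombination_single,
      Finsupp.linearCombination_single, R.mix_of_some h, R.mix_of_some h', Cfg.flipHead_flipHead]
    simp only [smul_add, Finsupp.smul_single, smul_eq_mul]
    have hb : amp b * amp b = 1 / 2 := by
      cases b
      · exact amp_mul_self
      · rw [amp_true, neg_mul_neg, amp_mul_self]
    have hb' : amp false * amp (!b) + amp b * amp false = 0 := by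
      cases b <;> simp
    have ha := amp_mul_self
    classical
    ext c'
    simp only [Finsupp.add_apply, Finsupp.single_apply]
    split_ifs
    · linear_combination ha + hb + hb'
    · linear_combination ha + hb
    · linear_combination hb'
    · ring

open Classical in
lemma mix_apply_of_ne {c c' : Cfg k Q α W} (h : c ≠ c') :
    R.mix c c' = if ∃ j b, R.hadBit c.state c.read = some (j, b) ∧ c.flipHead j = c'
      then amp false else 0 := by
  rcases hc : R.hadBit c.state c.read with _ | ⟨j, b⟩
  · rw [R.mix_of_none hc]
    simp [h]
  · rw [R.mix_of_some hc]
    simp only [Finsupp.add_apply, Finsupp.single_apply, h, if_false, add_zero, Option.some.injEq,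
      Prod.mk.injEq]
    congr 1
    refine propext ⟨fun h => ⟨j, b, ⟨rfl, rfl⟩, h⟩, ?_⟩
    rintro ⟨j', b', ⟨rfl, rfl⟩, h⟩
    exact h

lemma mix_apply_symm (c c' : Cfg k Q α W) : R.mix c c' = (starRingEnd ℂ) (R.mix c' c) := by
  classical
  have key : ∀ c c' : Cfg k Q α W,
      (∃ j b, R.hadBit c.state c.read = some (j, b) ∧ c.flipHead j = c') →
      ∃ j b, R.hadBit c'.state c'.read = some (j, b) ∧ c'.flipHead j = c := by
    rintro c c' ⟨j, b, h, rfl⟩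
    exact ⟨j, !b, R.hadBit_flipHead h, Cfg.flipHead_flipHead _ _⟩
  by_cases h : c = c'
  · subst h
    rcases hc : R.hadBit c.state c.read with _ | ⟨j, b⟩
    · simp [R.mix_of_none hc]
    · rw [R.mix_of_some hc]
      simp only [Finsupp.add_apply, Finsupp.single_apply, map_add]
      split_ifs <;> simp [conj_amp]
  · rw [R.mix_apply_of_ne h, R.mix_apply_of_ne (Ne.symm h)]
    by_cases hc : ∃ j b, R.hadBit c.state c.read = some (j, b) ∧ c.flipHead j = c'
    · rw [if_pos hc, if_pos (key _ _ hc), conj_amp]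
    · rw [if_neg hc, if_neg fun h' => hc (key _ _ h'), map_zero]

open Classical in
/-- The amplitudes of the quantum machine given by a reversible machine with Hadamard gates. -/
noncomputable def δ (q : Q) (s : TapeIdx k W → Sym α) : Action k Q α W →₀ ℂ :=
  match R.hadBit q s with
  | none => Finsupp.single (R.action (R.σ (q, s))) 1
  | some (j, b) =>
    Finsupp.single (R.action (R.σ (q, Function.update s (Sum.inr (Sum.inl j))
      (flip (s (Sum.inr (Sum.inl j))))))) (amp false) +
    Finsupp.single (R.action (R.σ (q, s))) (amp b)

lemma δ_mem {K : Set ℂ}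
    (hK : ({0, 1, ((1 / √2 : ℝ) : ℂ), ((-(1 / √2) : ℝ) : ℂ)} : Set ℂ) ⊆ K)
    (q : Q) (s : TapeIdx k W → Sym α) (a : Action k Q α W) : R.δ q s a ∈ K := by
  classical
  have hamp : ∀ b, amp b ∈ K := fun b => hK (by cases b <;> simp [amp])
  have h0 : (0 : ℂ) ∈ K := hK (by simp)
  have h1 : (1 : ℂ) ∈ K := hK (by simp)
  unfold δ
  rcases h : R.hadBit q s with _ | ⟨j, b⟩
  · simp only [Finsupp.single_apply]
    split_ifs
    · exact h1
    · exact h0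
  · have hs := (R.hadBit_eq_some.1 h).2
    -- The two branches lead to different actions, so their amplitudes are never added; a sum need
    -- not lie in `K`.
    have hne : R.action (R.σ (q, Function.update s (Sum.inr (Sum.inl j))
        (flip (s (Sum.inr (Sum.inl j)))))) ≠ R.action (R.σ (q, s)) := by
      intro heq
      have := congrFun (Prod.ext_iff.1 (R.σ.injective (R.action_injective heq))).2
        (Sum.inr (Sum.inl j))
      simp only [Function.update_self, hs, flip_bit] at this
      simpa using bit_injective this
    simp only [Finsupp.add_apply, Finsupp.single_apply]
    split_ifs with h₁ h₂ h₂
    · exact absurd (h₁.trans h₂.symm) hne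
    · simpa using hamp false
    · simpa using hamp b
    · simpa using h0

variable [Finite Q] [Finite α] [Finite W]

/-- The quantum machine given by a reversible machine with Hadamard gates. -/
noncomputable def toQOTM (start : Q) (accept : Set Q) : QOTM k where
  Q := Q
  α := α
  W := W
  start := start
  pre := R.pre
  post := R.post
  accept := accept
  δ := R.δ

variable (start : Q) (accept : Set Q)

/-- This factors a step into a gate and a bijection of configurations, the form needed for
unitarity. In the state `pre` there is no gate, so calls fit in as well. -/
lemma stepBasis_eq (A : Language Bool) (c : Cfg k Q α W) :
    (R.toQOTM start accept).stepBasis A c = Finsupp.mapDomain (R.next A) (R.mix c) := by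
  classical
  by_cases hpre : c.state = R.pre
  · rw [R.mix_of_none (R.hadBit_of_had_eq_none (hpre ▸ R.had_pre) _), Finsupp.mapDomain_single,
      next, if_pos hpre]
    exact if_pos hpre
  · refine (if_neg hpre).trans ?_
    change Finsupp.mapDomain c.act (R.δ c.state c.read) = _
    rcases h : R.hadBit c.state c.read with _ | ⟨j, b⟩
    · rw [R.mix_of_none h, δ, h]
      simp only [Finsupp.mapDomain_single]
      rw [next, if_neg hpre]
    · have hpre' : (c.flipHead j).state ≠ R.pre := hpre
      rw [R.mix_of_some h, δ, h]
      simp only [Finsupp.mapDomain_add, Finsupp.mapDomain_single]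
      rw [next, if_neg hpre', next, if_neg hpre, Cfg.act_flipHead, Cfg.read_flipHead]
      rfl

lemma wellFormed : (R.toQOTM start accept).WellFormed := by
  intro A
  have h : (R.toQOTM start accept).stepBasis A = fun c => Finsupp.mapDomain (R.next A) (R.mix c) :=
    funext (R.stepBasis_eq start accept A)
  have := bijective_and_sqNorm_of_involution R.mix_apply_symm R.linearCombination_mix
    (R.next_bijective A)
  rw [← h] at this
  exact this

end RevRule

/-! ### A deterministic machine with a log tape and a quantum subroutine -/

/-- On a finite type the complements of the domain and of the image have the same size. Thus a rule
has to be specified and injective only where it is actually used. -/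
lemma exists_perm_extending {X : Type} [Finite X] (f : X → X) (s : Set X) (hf : Set.InjOn f s) :
    ∃ σ : Equiv.Perm X, ∀ x ∈ s, σ x = f x := by
  classical
  have := Fintype.ofFinite X
  refine ⟨(Equiv.Set.imageOfInjOn f s hf).extendSubtype, fun x hx => ?_⟩
  rw [Equiv.extendSubtype_apply_of_mem _ x hx]
  rfl

/-- Control states with the last head moves, and the `4 * k + 5` states of the subroutine. -/
inductive LogState (k : ℕ) (Q W : Type) : Type
  | ctl (q : Q) (m : TapeIdx k W → SignType)
  | quant (i : Fin (4 * k + 5))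

instance (k : ℕ) (Q W : Type) [Finite Q] [Finite W] : Finite (LogState k Q W) := by
  let f : (Q × (TapeIdx k W → SignType)) ⊕ Fin (4 * k + 5) → LogState k Q W := fun
    | Sum.inl (q, m) => .ctl q m
    | Sum.inr i => .quant i
  refine Finite.of_surjective f ?_
  rintro (⟨q, m⟩ | i)
  · exact ⟨Sum.inl (q, m), rfl⟩
  · exact ⟨Sum.inr i, rfl⟩

/-- The entries of the log tape. -/
abbrev LogSym (k : ℕ) (Q α W : Type) : Type :=
  Q × (TapeIdx k W → SignType) × (TapeIdx k W → Sym α)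

section Log

variable {k : ℕ} {Q α W β : Type}

/-- The tapes other than the log tape. -/
def keep : TapeIdx k W → TapeIdx k (W ⊕ Unit) := Sum.map id (Sum.map id Sum.inl)

/-- The log tape. -/
def logTape : TapeIdx k (W ⊕ Unit) := Sum.inr (Sum.inr (Sum.inr ()))

/-- A family over all tapes, from its values at the log tape and at the other tapes. -/
def withLog (g : TapeIdx k W → β) (l : β) : TapeIdx k (W ⊕ Unit) → β :=
  Sum.elim (fun u => g (Sum.inl u)) (Sum.elim (fun j => g (Sum.inr (Sum.inl j)))
    (Sum.elim (fun w => g (Sum.inr (Sum.inr w))) fun _ => l))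

@[simp] lemma withLog_keep (g : TapeIdx k W → β) (l : β) (i : TapeIdx k W) :
    withLog g l (keep i) = g i := by
  rcases i with _ | _ | _ <;> rfl

@[simp] lemma withLog_logTape (g : TapeIdx k W → β) (l : β) : withLog g l logTape = l := rfl

lemma tape_cases (i : TapeIdx k (W ⊕ Unit)) : (∃ i', i = keep i') ∨ i = logTape := by
  rcases i with i | i | i | i
  · exact Or.inl ⟨Sum.inl i, rfl⟩
  · exact Or.inl ⟨Sum.inr (Sum.inl i), rfl⟩
  · exact Or.inl ⟨Sum.inr (Sum.inr i), rfl⟩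
  · exact Or.inr rfl

lemma tape_funext {f g : TapeIdx k (W ⊕ Unit) → β} (h : ∀ i, f (keep i) = g (keep i))
    (h' : f logTape = g logTape) : f = g := by
  funext i
  rcases tape_cases i with ⟨i, rfl⟩ | rfl
  · exact h i
  · exact h'

variable (ρ : Q → (TapeIdx k W → Sym α) → Action k Q α W) (enter final : Q)

/-- The embedding of the symbols into the alphabet with log entries. -/
def logSym : Sym α → Sym (α ⊕ LogSym k Q α W) := symMap Sum.inl

lemma logSym_injective : Function.Injective (logSym (k := k) (Q := Q) (α := α) (W := W)) :=
  symMap_injective Sum.inl_injective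

/-- The `i`-th state of the subroutine, followed by the control state `final`. -/
def quantAt (final : Q) (i : ℕ) : LogState k Q W :=
  if h : i < 4 * k + 5 then .quant ⟨i, h⟩ else .ctl final 0

lemma quantAt_inj {final : Q} {i i' : ℕ} (hi : i < 4 * k + 5)
    (h : (quantAt final i : LogState k Q W) = quantAt final i') : i = i' := by
  unfold quantAt at h
  rw [dif_pos hi] at h
  split_ifs at h
  simpa using h

open Classical in
/-- The control state after an action, or the first state of the subroutine. -/
noncomputable def wrapState (a : Action k Q α W) : LogState k Q W :=
  if a.1 = enter then quantAt final 0 else .ctl a.1 a.2.2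

/-- The partial rule of the machine: every control step is logged. -/
noncomputable def logRule (r : LogState k Q W × (TapeIdx k (W ⊕ Unit) → Sym (α ⊕ LogSym k Q α W))) :
    LogState k Q W × (TapeIdx k (W ⊕ Unit) → Sym (α ⊕ LogSym k Q α W)) :=
  match r with
  | (.ctl q m, s) =>
    (wrapState enter final (ρ q fun i => decode logSym (s (keep i))),
      withLog (fun i => logSym ((ρ q fun i => decode logSym (s (keep i))).2.1 i))
        (some (Sum.inr (Sum.inr (q, m, fun i => decode logSym (s (keep i)))))))
  | (.quant i, s) => (quantAt final (i + 1), s)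

/-- The domain of the partial rule. -/
def logDom : Set (LogState k Q W × (TapeIdx k (W ⊕ Unit) → Sym (α ⊕ LogSym k Q α W))) :=
  fun r => match r with
  | (.ctl _ _, s) => s logTape = none ∧ ∀ i, ∃ y, s (keep i) = logSym y
  | (.quant i, s) => i.1 = 2 * k + 2 ∨ s logTape = none

/-- A control step can be undone because its log entry contains the old state, moves and symbols.
Subroutine steps only advance a counter. The two kinds have different images: a control step leaves
an entry in the log cell, a subroutine step a blank. The step from `2 * k + 2` is allowed with any
log symbol, but leads to `2 * k + 3`, which no control step enters. -/
lemma injOn_logRule : Set.InjOn (logRule ρ enter final) logDom := by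
  have key : ∀ (q : Q) (m) (s s' : TapeIdx k (W ⊕ Unit) → Sym (α ⊕ LogSym k Q α W))
      (i : Fin (4 * k + 5)), (LogState.quant i, s') ∈ logDom (k := k) (Q := Q) (α := α) (W := W) →
      logRule ρ enter final (.ctl q m, s) ≠ logRule ρ enter final (.quant i, s') := by
    intro q m s s' i hi h
    simp only [logRule, Prod.mk.injEq] at h
    rcases hi with hi | hi
    · have h1 := h.1
      rw [hi] at h1
      unfold wrapState at h1
      split_ifs at h1
      · have := quantAt_inj (by omega) h1
        omega
      · rw [quantAt, dif_pos (by omega)] at h1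
        cases h1
    · have h2 := congrFun h.2 logTape
      rw [withLog_logTape, hi] at h2
      cases h2
  rintro ⟨q | i, s⟩ hr ⟨q' | i', s'⟩ hr' h
  · simp only [logRule, Prod.mk.injEq] at h
    have h2 := congrFun h.2 logTape
    simp only [withLog_logTape, Option.some.injEq, Sum.inr.injEq, Prod.mk.injEq] at h2
    obtain ⟨rfl, rfl, h3⟩ := h2
    congr 1
    refine tape_funext (fun i => ?_) (hr.1.trans hr'.1.symm)
    obtain ⟨y, hy⟩ := hr.2 i
    obtain ⟨y', hy'⟩ := hr'.2 i
    have := congrFun h3 i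
    rw [hy, hy', decode_apply logSym_injective, decode_apply logSym_injective] at this
    rw [hy, hy', this]
  · exact absurd h (key _ _ _ _ _ hr')
  · exact absurd h.symm (key _ _ _ _ _ hr)
  · simp only [logRule, Prod.mk.injEq] at h
    obtain ⟨h1, rfl⟩ := h
    congr 2
    unfold quantAt at h1
    split_ifs at h1
    · simpa [Fin.ext_iff] using h1
    · exact Fin.ext (by omega)

/-- The query tape to which the `i`-th state of the subroutine applies a Hadamard gate. -/
def hadIdx (k i : ℕ) : Option (Fin k) :=
  if h : i < k then some ⟨i, h⟩
  else if h : k + 1 ≤ i ∧ i < 2 * k + 1 then some ⟨i - (k + 1), by omega⟩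
  else if h : 2 * k + 3 ≤ i ∧ i < 3 * k + 3 then some ⟨i - (2 * k + 3), by omega⟩
  else if h : 3 * k + 4 ≤ i ∧ i < 4 * k + 4 then some ⟨i - (3 * k + 4), by omega⟩
  else none

/-- The move of the query heads when the `i`-th state of the subroutine is entered. -/
def quantMove (k i : ℕ) : SignType :=
  if i = k + 1 ∨ i = 3 * k + 4 then 1 else if i = 2 * k + 2 then -1 else 0

/-- The configuration `c` of the machine with log tape represents the configuration `e`. -/
structure Logged (c : Cfg k (LogState k Q W) (α ⊕ LogSym k Q α W) (W ⊕ Unit))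
    (e : Cfg k Q α W) : Prop where
  sees : Cfg.Sees keep logSym c e
  blank : ∀ z, c.head logTape ≤ z → c.tape logTape z = none
  enter_state : e.state = enter → c.state = quantAt final 0
  ctl_state : e.state ≠ enter → ∃ m, c.state = .ctl e.state m

/-- One step of the deterministic machine without log. -/
def detStep (e : Cfg k Q α W) : Cfg k Q α W := e.act (ρ e.state e.read)

lemma mem_logDom {c : Cfg k (LogState k Q W) (α ⊕ LogSym k Q α W) (W ⊕ Unit)} {e : Cfg k Q α W}
    (hs : Cfg.Sees keep logSym c e) (hb : ∀ z, c.head logTape ≤ z → c.tape logTape z = none) :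
    (c.state, c.read) ∈ logDom := by
  rcases h : c.state with ⟨q, m⟩ | i
  · exact ⟨hb _ le_rfl, fun i => ⟨_, hs.read i⟩⟩
  · exact Or.inr (hb _ le_rfl)

variable [Finite Q] [Finite α] [Finite W]

/-- The reversible machine with log tape. -/
noncomputable def logMachine : RevRule k (LogState k Q W) (α ⊕ LogSym k Q α W) (W ⊕ Unit) where
  σ := (exists_perm_extending _ _ (injOn_logRule ρ enter final)).choose
  move := fun q => match q with
    | .ctl _ m => withLog m 1
    | .quant i => withLog (Sum.elim (fun _ => 0) (Sum.elim (fun _ => quantMove k i) fun _ => 0))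
        -- State `0` is entered by a logged control step and must leave the new entry behind; later
        -- subroutine steps write none.
        (if i.1 = 0 then 1 else 0)
  had := fun q => match q with
    | .ctl _ _ => none
    | .quant i => hadIdx k i
  pre := .quant ⟨2 * k + 2, by omega⟩
  post := .quant ⟨2 * k + 3, by omega⟩
  σ_pre := fun s => by
    rw [(exists_perm_extending _ _ (injOn_logRule ρ enter final)).choose_spec _ (Or.inl rfl)]
    simp only [logRule, quantAt]
    rw [dif_pos (by omega)]
  had_pre := by
    simp only [hadIdx]
    repeat rw [dif_neg (by omega)]

lemma logMachine_σ {r : LogState k Q W × (TapeIdx k (W ⊕ Unit) → Sym (α ⊕ LogSym k Q α W))}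
    (hr : r ∈ logDom) : (logMachine ρ enter final).σ r = logRule ρ enter final r :=
  (exists_perm_extending _ _ (injOn_logRule ρ enter final)).choose_spec _ hr

variable {ρ enter final}

/-- The scanned symbols belong to the embedded alphabet and the log cell is blank, so the
permutation follows the partial rule. The hypothesis `hρ` is needed because the first subroutine
state, unlike a control state, cannot store head moves. -/
lemma Logged.next (hρ : ∀ q s, (ρ q s).1 = enter → (ρ q s).2.2 = 0) (A : Language Bool)
    {c : Cfg k (LogState k Q W) (α ⊕ LogSym k Q α W) (W ⊕ Unit)} {e : Cfg k Q α W}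
    (h : Logged enter final c e) (he : e.state ≠ enter) :
    Logged enter final ((logMachine ρ enter final).next A c) (detStep ρ e) := by
  obtain ⟨m, hm⟩ := h.ctl_state he
  have hpre : c.state ≠ (logMachine ρ enter final).pre := by
    rw [hm]
    simp [logMachine]
  set a := ρ e.state e.read with ha
  have hσ : (logMachine ρ enter final).σ (c.state, c.read) =
      (wrapState enter final a, withLog (fun i => logSym (a.2.1 i))
        (some (Sum.inr (Sum.inr (e.state, m, e.read))))) := by
    rw [logMachine_σ ρ enter final (mem_logDom h.sees h.blank), hm]
    simp only [logRule]
    rw [h.sees.decode_read logSym_injective]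
  have hmk : ∀ i, (logMachine ρ enter final).move (wrapState enter final a) (keep i) =
      a.2.2 i := by
    intro i
    unfold wrapState
    split_ifs with h1
    · rw [hρ _ _ h1]
      simp only [logMachine, quantAt]
      rw [dif_pos (by omega)]
      simp only [withLog_keep]
      rcases i with _ | _ | _
      · rfl
      · simp [quantMove]
      · rfl
    · simp [logMachine]
  have hml : (logMachine ρ enter final).move (wrapState enter final a) logTape = 1 := by
    unfold wrapState
    split_ifs with h1
    · simp only [logMachine, quantAt]
      rw [dif_pos (by omega)]
      simp
    · simp [logMachine]
  rw [RevRule.next, if_neg hpre, hσ]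
  refine ⟨⟨fun i z => ?_, fun i => ?_⟩, fun z hz => ?_, fun h' => ?_, fun h' => ?_⟩
  · rw [detStep, Cfg.act_tape, Cfg.act_tape, h.sees.head]
    simp only [RevRule.action, withLog_keep]
    by_cases hz : z = e.head i
    · subst hz
      simp [ha]
    · rw [Function.update_of_ne hz, Function.update_of_ne hz, h.sees.tape]
  · rw [detStep, Cfg.act_head, Cfg.act_head, h.sees.head]
    simp only [RevRule.action, hmk]
    rfl
  · rw [Cfg.act_head] at hz
    simp only [RevRule.action, hml, SignType.coe_one] at hz
    rw [Cfg.act_tape, Function.update_of_ne (by omega), h.blank _ (by omega)]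
  · exact if_pos h'
  · exact ⟨a.2.2, if_neg h'⟩

lemma Logged.iterate (hρ : ∀ q s, (ρ q s).1 = enter → (ρ q s).2.2 = 0) (A : Language Bool)
    {c : Cfg k (LogState k Q W) (α ⊕ LogSym k Q α W) (W ⊕ Unit)} {e : Cfg k Q α W}
    (h : Logged enter final c e) (t : ℕ)
    (he : ∀ s < t, ((detStep ρ)^[s] e).state ≠ enter) :
    Logged enter final (((logMachine ρ enter final).next A)^[t] c) ((detStep ρ)^[t] e) := by
  induction t with
  | zero => exact h
  | succ t ih =>
    rw [Function.iterate_succ_apply', Function.iterate_succ_apply']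
    exact (ih fun s hs => he s (by omega)).next hρ A (he t (by omega))

end Log

/-! ### The quantum subroutine -/

section Cells

variable {k : ℕ}

/-- The value of the answer cell (`false`) or of the cell to its right (`true`). -/
def cell (s : Bool) (p : Bool × Bool) : Bool := if s then p.2 else p.1

/-- Flip one of two cells. -/
def flipCell (s : Bool) (p : Bool × Bool) : Bool × Bool := if s then (p.1, !p.2) else (!p.1, p.2)

@[simp] lemma flipCell_flipCell (s : Bool) (p : Bool × Bool) : flipCell s (flipCell s p) = p := by
  cases s <;> simp [flipCell]

/-- Flip one of the two cells of the `j`-th query tape. -/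
def flipAt (s : Bool) (j : Fin k) (u : Fin k → Bool × Bool) : Fin k → Bool × Bool :=
  Function.update u j (flipCell s (u j))

lemma flipAt_involutive (s : Bool) (j : Fin k) : Function.Involutive (flipAt s j) := by
  intro u
  simp [flipAt]

/-- The second of the two cells is scanned in the `i`-th state of the subroutine. -/
def second (k i : ℕ) : Bool := decide ((k + 1 ≤ i ∧ i < 2 * k + 2) ∨ 3 * k + 4 ≤ i)

/-- The moves keep the query heads on the cell named by `second`: right before the second and the
fourth round of gates, and back left for the call. -/
lemma second_succ (k i : ℕ) (hi : i < 4 * k + 4) :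
    (((second k (i + 1)).toNat : ℕ) : ℤ) = (second k i).toNat + (quantMove k (i + 1) : ℤ) := by
  unfold second quantMove
  by_cases h1 : i + 1 = k + 1 ∨ i + 1 = 3 * k + 4
  · rw [if_pos h1, decide_eq_true (by omega), decide_eq_false (by omega)]
    simp
  · rw [if_neg h1]
    by_cases h2 : i + 1 = 2 * k + 2
    · rw [if_pos h2, decide_eq_false (by omega), decide_eq_true (by omega)]
      simp
    · rw [if_neg h2]
      have : (k + 1 ≤ i + 1 ∧ i + 1 < 2 * k + 2 ∨ 3 * k + 4 ≤ i + 1) ↔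
          (k + 1 ≤ i ∧ i < 2 * k + 2 ∨ 3 * k + 4 ≤ i) := by omega
      simp only [this]
      simp

/-- The configuration `c` with state `q`, query heads moved by `s`, and the bits `u j` in the cells
`0` and `1` to the right of the head of the `j`-th query tape. -/
def Cfg.withCells {Q Q' α W : Type} (c : Cfg k Q α W) (q : Q') (s : Bool)
    (u : Fin k → Bool × Bool) : Cfg k Q' α W where
  state := q
  tape := fun i => match i with
    | Sum.inr (Sum.inl j) => Function.update (Function.update (c.tape (Sum.inr (Sum.inl j)))
        (c.head (Sum.inr (Sum.inl j))) (bit (u j).1)) (c.head (Sum.inr (Sum.inl j)) + 1)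
        (bit (u j).2)
    | i => c.tape i
  head := fun i => match i with
    | Sum.inr (Sum.inl j) => c.head (Sum.inr (Sum.inl j)) + s.toNat
    | i => c.head i

variable {Q Q' α W : Type}

lemma Cfg.withCells_read (c : Cfg k Q α W) (q : Q') (s : Bool) (u : Fin k → Bool × Bool)
    (j : Fin k) : (c.withCells q s u).read (Sum.inr (Sum.inl j)) = bit (cell s (u j)) := by
  cases s <;> simp [withCells, read, cell]

lemma Cfg.withCells_flipHead (c : Cfg k Q α W) (q : Q') (s : Bool) (u : Fin k → Bool × Bool)
    (j : Fin k) : (c.withCells q s u).flipHead j = c.withCells q s (flipAt s j u) := by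
  ext i z
  · rfl
  · by_cases h : i = Sum.inr (Sum.inl j)
    · subst h
      simp only [flipHead, Function.update_self]
      rw [withCells_read, flip_bit]
      cases s
      · simp only [withCells, flipAt, cell, flipCell, Function.update_self, Bool.toNat_false,
          Nat.cast_zero, add_zero, Bool.false_eq_true, if_false]
        rw [Function.update_comm (by omega), Function.update_idem]
      · simp only [withCells, flipAt, cell, flipCell, Function.update_self, Bool.toNat_true,
          Nat.cast_one, if_true, Function.update_idem]
    · simp only [flipHead, ne_eq, h, not_false_eq_true, Function.update_of_ne]
      rcases i with _ | j' | _
      · rfl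
      · have hj : j' ≠ j := fun h' => h (by rw [h'])
        simp [withCells, flipAt, hj]
      · rfl
  · rfl

lemma Cfg.withCells_self (c : Cfg k Q α W) (u : Fin k → Bool × Bool)
    (h : ∀ j, c.tape (Sum.inr (Sum.inl j)) (c.head (Sum.inr (Sum.inl j))) = bit (u j).1)
    (h' : ∀ j, c.tape (Sum.inr (Sum.inl j)) (c.head (Sum.inr (Sum.inl j)) + 1) = bit (u j).2) :
    c.withCells c.state false u = c := by
  ext i z
  · rfl
  · rcases i with _ | j | _
    · rfl
    · simp only [withCells]
      rw [← h, Function.update_eq_self, ← h', Function.update_eq_self]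
    · rfl
  · rcases i with _ | j | _
    · rfl
    · simp [withCells]
    · rfl

lemma Cfg.withCells_call (c : Cfg k Q α W) (q q' : Q') (u : Fin k → Bool × Bool)
    (v : Fin k → Bool) : (c.withCells q false u).call q' v =
      c.withCells q' false fun j => (xor (u j).1 (v j), (u j).2) := by
  ext i z
  · rfl
  · rcases i with _ | j | _
    · rfl
    · simp only [call]
      rw [withCells_read, flip_bit]
      cases hv : v j
      · simp [withCells, hv]
      · simp only [withCells, cell, if_true, Bool.toNat_false, Nat.cast_zero, add_zero,
          Bool.false_eq_true, if_false, Bool.xor_true, hv]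
        rw [Function.update_comm (by omega), Function.update_idem]
    · rfl
  · rfl

end Cells

/-! ### Superpositions of cell contents -/

section Amplitudes

open RevRule

variable {k : ℕ}

/-- A Hadamard gate on one of the two cells of the `j`-th query tape. -/
noncomputable def hadOn (s : Bool) (j : Fin k) (f : (Fin k → Bool × Bool) → ℂ) :
    (Fin k → Bool × Bool) → ℂ :=
  fun u => amp false * f (flipAt s j u) + amp (cell s (u j)) * f u

/-- A Hadamard gate on one of two cells. -/
noncomputable def hadCell (s : Bool) (φ : Bool × Bool → ℂ) : Bool × Bool → ℂ :=
  fun p => amp false * φ (flipCell s p) + amp (cell s p) * φ p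

/-- A query with answers `v`. -/
def queryCell (v : Bool → Bool) (φ : Bool × Bool → ℂ) : Bool × Bool → ℂ :=
  fun p => φ (xor p.1 (v p.2), p.2)

/-- A product state. -/
noncomputable def prodAmp (φ : Fin k → Bool × Bool → ℂ) : (Fin k → Bool × Bool) → ℂ :=
  fun u => ∏ j, φ j (u j)

/-- A gate on one query tape changes only the factor of that tape, so the `k` instances of Deutsch's
algorithm stay independent. -/
lemma hadOn_prodAmp (s : Bool) (j : Fin k) (φ : Fin k → Bool × Bool → ℂ) :
    hadOn s j (prodAmp φ) = prodAmp (Function.update φ j (hadCell s (φ j))) := by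
  funext u
  simp only [hadOn, prodAmp]
  rw [← Finset.mul_prod_erase Finset.univ _ (Finset.mem_univ j),
    ← Finset.mul_prod_erase Finset.univ (fun j => φ j (u j)) (Finset.mem_univ j),
    ← Finset.mul_prod_erase Finset.univ (fun i => Function.update φ j _ i (u i))
      (Finset.mem_univ j)]
  have h1 : ∏ i ∈ Finset.univ.erase j, φ i (flipAt s j u i) =
      ∏ i ∈ Finset.univ.erase j, φ i (u i) :=
    Finset.prod_congr rfl fun i hi => by
      rw [flipAt, Function.update_of_ne (Finset.ne_of_mem_erase hi)]
  have h2 : ∏ i ∈ Finset.univ.erase j, Function.update φ j (hadCell s (φ j)) i (u i) =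
      ∏ i ∈ Finset.univ.erase j, φ i (u i) :=
    Finset.prod_congr rfl fun i hi => by
      rw [Function.update_of_ne (Finset.ne_of_mem_erase hi)]
  rw [h1, h2, flipAt, Function.update_self, Function.update_self, hadCell]
  ring

/-- The exclusive-or of two bits with one query. -/
lemma exists_deutsch (v : Bool → Bool) : ∃ ε : ℂ, ‖ε‖ = 1 ∧
    hadCell true (hadCell false (queryCell v (hadCell true (hadCell false
      (Pi.single (true, false) 1))))) = Pi.single (true, xor (v false) (v true)) ε := by
  have h2 : amp false * amp false = 1 / 2 := amp_mul_self
  have h4 : amp false * amp false * (amp false * amp false) = 1 / 4 := by rw [h2]; norm_num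
  -- Phase kickback: the answer cell is in the state `(|0⟩ - |1⟩)/√2`, so the query multiplies the
  -- branch `b` by the sign of `v b`, and the last gates turn the relative sign into a bit. The sign
  -- of `v false` remains as a global phase.
  refine ⟨if v false then -1 else 1, by split_ifs <;> simp, ?_⟩
  funext ⟨a, b⟩
  cases hv0 : v false <;> cases hv1 : v true <;> cases a <;> cases b <;>
    simp [hadCell, queryCell, flipCell, cell, hv0, hv1, Pi.single_apply] <;>
    first
      -- A nonzero final amplitude collects four paths, each with the fourth power of `1/√2` up to a
      -- common sign.
      | linear_combination (4 : ℂ) * h4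
      | linear_combination (-4 : ℂ) * h4
      | ring

end Amplitudes

/-! ### The run of the subroutine -/

section Subroutine

variable {k : ℕ} {Q α W : Type} [Finite Q] [Finite α] [Finite W]
  {ρ : Q → (TapeIdx k W → Sym α) → Action k Q α W} {enter final : Q}
  {c₀ : Cfg k (LogState k Q W) (α ⊕ LogSym k Q α W) (W ⊕ Unit)}

/-- The configuration in the `i`-th state of the subroutine with cell contents `u`. -/
def quantCfg (final : Q) (c₀ : Cfg k (LogState k Q W) (α ⊕ LogSym k Q α W) (W ⊕ Unit)) (i : ℕ)
    (u : Fin k → Bool × Bool) : Cfg k (LogState k Q W) (α ⊕ LogSym k Q α W) (W ⊕ Unit) :=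
  c₀.withCells (quantAt final i) (second k i) u

lemma next_quantCfg (A : Language Bool) (h₀ : c₀.tape logTape (c₀.head logTape) = none)
    {i : ℕ} (hi : i < 4 * k + 4) (hi' : i ≠ 2 * k + 2) (u : Fin k → Bool × Bool) :
    (logMachine ρ enter final).next A (quantCfg final c₀ i u) = quantCfg final c₀ (i + 1) u := by
  have hq : (quantCfg final c₀ i u).state = .quant ⟨i, by omega⟩ := dif_pos (by omega)
  have hpre : (quantCfg final c₀ i u).state ≠ (logMachine ρ enter final).pre := by
    rw [hq]
    simpa [logMachine] using hi'
  have hdom : ((quantCfg final c₀ i u).state, (quantCfg final c₀ i u).read) ∈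
      logDom (k := k) (Q := Q) (α := α) (W := W) := by
    rw [hq]
    exact Or.inr h₀
  rw [RevRule.next, if_neg hpre, logMachine_σ ρ enter final hdom, hq, logRule]
  have hmove : (logMachine ρ enter final).move (quantAt final (i + 1)) =
      withLog (Sum.elim (fun _ => 0) (Sum.elim (fun _ => quantMove k (i + 1)) fun _ => 0)) 0 := by
    rw [quantAt, dif_pos (by omega)]
    rfl
  ext t z
  · rfl
  · rw [Cfg.act_tape_of_eq]
    · rfl
    · rfl
  · rw [Cfg.act_head]
    simp only [RevRule.action]
    rw [hmove]
    rcases t with t | j | t | t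
    · exact add_zero _
    · change c₀.head (Sum.inr (Sum.inl j)) + ((second k i).toNat : ℤ) + (quantMove k (i + 1) : ℤ) =
        c₀.head (Sum.inr (Sum.inl j)) + ((second k (i + 1)).toNat : ℤ)
      rw [second_succ k i hi]
      ring
    · exact add_zero _
    · exact add_zero _

lemma second_call (k : ℕ) : second k (2 * k + 2) = false ∧ second k (2 * k + 3) = false := by
  constructor <;> exact decide_eq_false (by omega)

lemma next_quantCfg_call {A : Language Bool} {v : Fin k → Bool → Bool}
    (hv : ∀ (q : LogState k Q W) (u : Fin k → Bool × Bool) (j : Fin k),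
      (c₀.withCells q false u).answers A j = v j (u j).2)
    (u : Fin k → Bool × Bool) :
    (logMachine ρ enter final).next A (quantCfg final c₀ (2 * k + 2) u) =
      quantCfg final c₀ (2 * k + 3) fun j => (xor (u j).1 (v j (u j).2), (u j).2) := by
  have hq : (quantCfg final c₀ (2 * k + 2) u).state = (logMachine ρ enter final).pre :=
    dif_pos (by omega)
  have hpost : (logMachine ρ enter final).post = quantAt final (2 * k + 3) := by
    rw [quantAt, dif_pos (by omega)]
    rfl
  rw [RevRule.next, if_pos hq, hpost, quantCfg, quantCfg, (second_call k).1, (second_call k).2,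
    Cfg.withCells_call]
  congr 1
  funext j
  rw [hv]

lemma mix_quantCfg_of_none {i : ℕ} (hi : i < 4 * k + 5) (h : hadIdx k i = none)
    (u : Fin k → Bool × Bool) :
    (logMachine ρ enter final).mix (quantCfg final c₀ i u) =
      Finsupp.single (quantCfg final c₀ i u) 1 := by
  apply RevRule.mix_of_none
  apply RevRule.hadBit_of_had_eq_none
  have hq : (quantCfg final c₀ i u).state = .quant ⟨i, hi⟩ := dif_pos hi
  rw [hq]
  exact h

lemma mix_quantCfg_of_some {i : ℕ} (hi : i < 4 * k + 5) {j : Fin k} (h : hadIdx k i = some j)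
    (u : Fin k → Bool × Bool) :
    (logMachine ρ enter final).mix (quantCfg final c₀ i u) =
      Finsupp.single (quantCfg final c₀ i (flipAt (second k i) j u)) (RevRule.amp false) +
      Finsupp.single (quantCfg final c₀ i u) (RevRule.amp (cell (second k i) (u j))) := by
  have hq : (quantCfg final c₀ i u).state = .quant ⟨i, hi⟩ := dif_pos hi
  rw [RevRule.mix_of_some (j := j) (b := cell (second k i) (u j))]
  · rw [quantCfg, Cfg.withCells_flipHead]
    rfl
  · rw [RevRule.hadBit_eq_some, hq]
    exact ⟨h, Cfg.withCells_read _ _ _ _ _⟩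

/-- The evolution operator of the machine with log tape. -/
noncomputable def logEvolve (ρ : Q → (TapeIdx k W → Sym α) → Action k Q α W) (enter final : Q)
    (A : Language Bool) :
    (Cfg k (LogState k Q W) (α ⊕ LogSym k Q α W) (W ⊕ Unit) →₀ ℂ) →ₗ[ℂ]
      (Cfg k (LogState k Q W) (α ⊕ LogSym k Q α W) (W ⊕ Unit) →₀ ℂ) :=
  Finsupp.linearCombination ℂ fun c =>
    Finsupp.mapDomain ((logMachine ρ enter final).next A) ((logMachine ρ enter final).mix c)

/-- The superposition of the configurations of the subroutine with amplitudes `f`. -/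
noncomputable def quantState (final : Q)
    (c₀ : Cfg k (LogState k Q W) (α ⊕ LogSym k Q α W) (W ⊕ Unit)) (i : ℕ)
    (f : (Fin k → Bool × Bool) → ℂ) :
    Cfg k (LogState k Q W) (α ⊕ LogSym k Q α W) (W ⊕ Unit) →₀ ℂ :=
  ∑ u, Finsupp.single (quantCfg final c₀ i u) (f u)

lemma logEvolve_quantState_of_none {A : Language Bool}
    (h₀ : c₀.tape logTape (c₀.head logTape) = none) {i : ℕ} (hi : i < 4 * k + 4)
    (hi' : i ≠ 2 * k + 2) (h : hadIdx k i = none) (f : (Fin k → Bool × Bool) → ℂ) :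
    logEvolve ρ enter final A (quantState final c₀ i f) = quantState final c₀ (i + 1) f := by
  simp only [quantState, map_sum, logEvolve, Finsupp.linearCombination_single]
  refine Finset.sum_congr rfl fun u _ => ?_
  rw [mix_quantCfg_of_none (by omega) h, Finsupp.mapDomain_single, next_quantCfg A h₀ hi hi',
    Finsupp.smul_single, smul_eq_mul, mul_one]

lemma logEvolve_quantState_of_some {A : Language Bool}
    (h₀ : c₀.tape logTape (c₀.head logTape) = none) {i : ℕ} (hi : i < 4 * k + 4)
    (hi' : i ≠ 2 * k + 2) {j : Fin k} (h : hadIdx k i = some j)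
    (f : (Fin k → Bool × Bool) → ℂ) :
    logEvolve ρ enter final A (quantState final c₀ i f) =
      quantState final c₀ (i + 1) (hadOn (second k i) j f) := by
  simp only [quantState, map_sum, logEvolve, Finsupp.linearCombination_single]
  have h1 : ∀ u, f u • Finsupp.mapDomain ((logMachine ρ enter final).next A)
      ((logMachine ρ enter final).mix (quantCfg final c₀ i u)) =
      Finsupp.single (quantCfg final c₀ (i + 1) (flipAt (second k i) j u))
        (RevRule.amp false * f u) +
      Finsupp.single (quantCfg final c₀ (i + 1) u)
        (RevRule.amp (cell (second k i) (u j)) * f u) := by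
    intro u
    rw [mix_quantCfg_of_some (by omega) h, Finsupp.mapDomain_add, Finsupp.mapDomain_single,
      Finsupp.mapDomain_single, next_quantCfg A h₀ hi hi', next_quantCfg A h₀ hi hi', smul_add,
      Finsupp.smul_single, Finsupp.smul_single, smul_eq_mul, smul_eq_mul, mul_comm (f u),
      mul_comm (f u)]
  simp only [h1, hadOn, Finsupp.single_add, Finset.sum_add_distrib]
  congr 1
  -- Reindexing by the flip turns the action of the gate on basis states into its action on
  -- amplitudes.
  rw [← Equiv.sum_comp (flipAt_involutive (second k i) j).toPerm]
  refine Finset.sum_congr rfl fun u _ => ?_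
  simp only [Function.Involutive.coe_toPerm, (flipAt_involutive (second k i) j) u]

lemma logEvolve_quantState_call {A : Language Bool} {v : Fin k → Bool → Bool}
    (hv : ∀ (q : LogState k Q W) (u : Fin k → Bool × Bool) (j : Fin k),
      (c₀.withCells q false u).answers A j = v j (u j).2)
    (φ : Fin k → Bool × Bool → ℂ) :
    logEvolve ρ enter final A (quantState final c₀ (2 * k + 2) (prodAmp φ)) =
      quantState final c₀ (2 * k + 3) (prodAmp fun j => queryCell (v j) (φ j)) := by
  have h : hadIdx k (2 * k + 2) = none := by
    unfold hadIdx
    repeat rw [dif_neg (by omega)]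
  have hinv : Function.Involutive fun (u : Fin k → Bool × Bool) j =>
      (xor (u j).1 (v j (u j).2), (u j).2) := by
    intro u
    funext j
    simp
  simp only [quantState, map_sum, logEvolve, Finsupp.linearCombination_single]
  rw [← Equiv.sum_comp hinv.toPerm]
  refine Finset.sum_congr rfl fun u _ => ?_
  rw [mix_quantCfg_of_none (by omega) h, Finsupp.mapDomain_single, next_quantCfg_call hv,
    Finsupp.smul_single, smul_eq_mul, mul_one]
  congr 1
  exact congrArg (quantCfg final c₀ (2 * k + 3)) (hinv u)

/-- A round of gates treats one tape per step; after `n` steps exactly the first `n` factors have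
been transformed. The hypothesis `hi'` keeps the call out of the round. -/
lemma logEvolve_iterate_had {A : Language Bool}
    (h₀ : c₀.tape logTape (c₀.head logTape) = none) {i : ℕ} (hi : i + k ≤ 4 * k + 4)
    (hi' : 2 * k + 2 < i ∨ i + k ≤ 2 * k + 2) {s : Bool}
    (h : ∀ n : Fin k, hadIdx k (i + n) = some n ∧ second k (i + n) = s)
    (φ : Fin k → Bool × Bool → ℂ) :
    (logEvolve ρ enter final A)^[k] (quantState final c₀ i (prodAmp φ)) =
      quantState final c₀ (i + k) (prodAmp fun j => hadCell s (φ j)) := by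
  have key : ∀ n ≤ k, (logEvolve ρ enter final A)^[n] (quantState final c₀ i (prodAmp φ)) =
      quantState final c₀ (i + n)
        (prodAmp fun j => if j.1 < n then hadCell s (φ j) else φ j) := by
    intro n
    induction n with
    | zero => intro _; simp
    | succ n ih =>
      intro hn
      obtain ⟨h1, h2⟩ : hadIdx k (i + n) = some ⟨n, hn⟩ ∧ second k (i + n) = s := h ⟨n, hn⟩
      rw [Function.iterate_succ_apply', ih (by omega),
        logEvolve_quantState_of_some h₀ (by omega) (by omega) h1, h2, hadOn_prodAmp]
      refine congrArg (fun φ => quantState final c₀ (i + n + 1) (prodAmp φ)) (funext fun j => ?_)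
      by_cases hj : j = ⟨n, hn⟩
      · subst hj
        simp
      · have hj' : j.1 ≠ n := fun h' => hj (Fin.ext h')
        rw [Function.update_of_ne hj]
        by_cases hlt : j.1 < n
        · rw [if_pos hlt, if_pos (by omega)]
        · rw [if_neg hlt, if_neg (by omega)]
  rw [key k le_rfl]
  simp

/-- The subroutine computes, on every query tape, the exclusive-or of two answers. -/
lemma logEvolve_iterate_subroutine {A : Language Bool}
    (h₀ : c₀.tape logTape (c₀.head logTape) = none) {v : Fin k → Bool → Bool}
    (hv : ∀ (q : LogState k Q W) (u : Fin k → Bool × Bool) (j : Fin k),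
      (c₀.withCells q false u).answers A j = v j (u j).2) :
    ∃ ε : ℂ, ‖ε‖ = 1 ∧ (logEvolve ρ enter final A)^[4 * k + 4]
      (Finsupp.single (quantCfg final c₀ 0 fun _ => (true, false)) 1) =
      Finsupp.single (quantCfg final c₀ (4 * k + 4)
        fun j => (true, xor (v j false) (v j true))) ε := by
  have hprod : ∀ (i : ℕ) (w : Fin k → Bool × Bool) (z : Fin k → ℂ),
      quantState final c₀ i (prodAmp fun j => Pi.single (w j) (z j)) =
        Finsupp.single (quantCfg final c₀ i w) (∏ j, z j) := by
    intro i w z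
    rw [quantState, Finset.sum_eq_single w]
    · simp [prodAmp]
    · intro u _ hu
      obtain ⟨j, hj⟩ := Function.ne_iff.1 hu
      have : prodAmp (fun j => Pi.single (w j) (z j)) u = 0 :=
        Finset.prod_eq_zero (Finset.mem_univ j) (Pi.single_eq_of_ne hj _)
      rw [this, Finsupp.single_zero]
    · simp
  choose ε hε hφ using fun j => exists_deutsch (v j)
  refine ⟨∏ j, ε j, by simp [hε], ?_⟩
  have hnone : ∀ i, (i = k ∨ i = 2 * k + 1 ∨ i = 3 * k + 3) → hadIdx k i = none := by
    intro i hi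
    unfold hadIdx
    repeat rw [dif_neg (by omega)]
  have hA : ∀ n : Fin k, hadIdx k (0 + n) = some n ∧ second k (0 + n) = false := fun n => by
    refine ⟨?_, decide_eq_false (by omega)⟩
    rw [hadIdx, dif_pos (by omega)]
    simp
  have hB : ∀ n : Fin k, hadIdx k (k + 1 + n) = some n ∧ second k (k + 1 + n) = true := fun n => by
    refine ⟨?_, decide_eq_true (by omega)⟩
    rw [hadIdx, dif_neg (by omega), dif_pos (by omega)]
    simp
  have hC : ∀ n : Fin k, hadIdx k (2 * k + 3 + n) = some n ∧ second k (2 * k + 3 + n) = false :=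
    fun n => by
      refine ⟨?_, decide_eq_false (by omega)⟩
      rw [hadIdx, dif_neg (by omega), dif_neg (by omega), dif_pos (by omega)]
      simp
  have hD : ∀ n : Fin k, hadIdx k (3 * k + 4 + n) = some n ∧ second k (3 * k + 4 + n) = true :=
    fun n => by
      refine ⟨?_, decide_eq_true (by omega)⟩
      rw [hadIdx, dif_neg (by omega), dif_neg (by omega), dif_neg (by omega), dif_pos (by omega)]
      simp
  have hstart := hprod 0 (fun _ => (true, false)) fun _ => 1
  rw [Finset.prod_const_one] at hstart
  -- Read from the right in the order of time: gates on the answer cells, a move, gates on the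
  -- selecting bits, the move back, the call, gates on the answer cells, a move, gates on the
  -- selecting bits. The idle steps keep the moves apart even for `k = 0`.
  rw [← hstart, show 4 * k + 4 = k + (1 + (k + (1 + (1 + (k + (1 + k)))))) by ring]
  simp only [Function.iterate_add_apply, Function.iterate_one]
  rw [logEvolve_iterate_had h₀ (by omega) (by omega) hA, zero_add,
    logEvolve_quantState_of_none h₀ (by omega) (by omega) (hnone _ (by omega)),
    logEvolve_iterate_had h₀ (by omega) (by omega) hB, show k + 1 + k = 2 * k + 1 by ring,
    logEvolve_quantState_of_none h₀ (by omega) (by omega) (hnone _ (by omega)),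
    logEvolve_quantState_call hv,
    logEvolve_iterate_had h₀ (by omega) (by omega) hC, show 2 * k + 3 + k = 3 * k + 3 by ring,
    logEvolve_quantState_of_none h₀ (by omega) (by omega) (hnone _ (by omega)),
    logEvolve_iterate_had h₀ (by omega) (by omega) hD,
    show 3 * k + 4 + k = k + (1 + (k + (1 + (1 + (k + (1 + k)))))) by ring]
  simp only [hφ]
  exact hprod _ _ _

end Subroutine

/-! ### The control program -/

/-- The states of the control program: find the end of the input, copy it backwards to the query
tapes, write the query prefixes, call the subroutine, collect its results, and simulate. -/
inductive CtlState (k : ℕ) (Q : Type) : Type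
  | seek
  | copy
  | setup (i : Fin (k + 2))
  | enter
  | final
  | sim (q : Q) (par : Bool)

instance (k : ℕ) (Q : Type) [Finite Q] : Finite (CtlState k Q) := by
  let f : Fin 4 ⊕ (Fin (k + 2) ⊕ (Q × Bool)) → CtlState k Q := fun
    | Sum.inl 0 => .seek
    | Sum.inl 1 => .copy
    | Sum.inl 2 => .enter
    | Sum.inl 3 => .final
    | Sum.inr (Sum.inl i) => .setup i
    | Sum.inr (Sum.inr (q, b)) => .sim q b
  refine Finite.of_surjective f ?_
  rintro (_ | _ | i | _ | _ | ⟨q, b⟩)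
  · exact ⟨Sum.inl 0, rfl⟩
  · exact ⟨Sum.inl 1, rfl⟩
  · exact ⟨Sum.inr (Sum.inl i), rfl⟩
  · exact ⟨Sum.inl 2, rfl⟩
  · exact ⟨Sum.inl 3, rfl⟩
  · exact ⟨Sum.inr (Sum.inr (q, b)), rfl⟩

section Control

variable {k m : ℕ} (D : DOTM m)

/-- Write the bits `b j` on the query tapes. -/
def writeQuery {α W : Type} (s : TapeIdx k W → Sym α) (b : Fin k → Bool) : TapeIdx k W → Sym α :=
  Sum.elim (fun u => s (Sum.inl u))
    (Sum.elim (fun j => bit (b j)) fun w => s (Sum.inr (Sum.inr w)))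

/-- The tapes of the simulated machine among the tapes of the control program. -/
def ctlTape (k m : ℕ) (W : Type) : TapeIdx m W → TapeIdx k (Fin m ⊕ W) := Sum.map id Sum.inr

lemma ctlTape_injective (k m : ℕ) (W : Type) : Function.Injective (ctlTape k m W) :=
  Function.injective_id.sumMap Sum.inr_injective

variable (k) in
open Classical in
/-- The rule of the control program. -/
noncomputable def ctlRule (q : CtlState k D.Q) (s : TapeIdx k (Fin m ⊕ D.W) → Sym D.α) :
    Action k (CtlState k D.Q) D.α (Fin m ⊕ D.W) :=
  match q with
  | .seek =>
    if (bitOf (s (Sum.inl ()))).isSome then (.seek, s, Sum.elim (fun _ => 1) fun _ => 0)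
    else (.copy, s, Sum.elim (fun _ => -1) fun _ => 0)
  | .copy =>
    match bitOf (s (Sum.inl ())) with
    | some b => (.copy, writeQuery s fun _ => b,
        Sum.elim (fun _ => -1) (Sum.elim (fun _ => -1) fun _ => 0))
    | none => (.setup (Fin.last _), s, Sum.elim (fun _ => 1) fun _ => 0)
  | .setup i =>
    if i.1 = 0 then (.enter, writeQuery s fun _ => true, 0)
    else (.setup ⟨i.1 - 1, by omega⟩,
      writeQuery s fun j => ((queryPrefix k j false)[i.1 - 1]?).getD false,
      Sum.elim (fun _ => 0) (Sum.elim (fun _ => -1) fun _ => 0))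
  | .enter => (.enter, s, 0)
  | .final => (.sim D.start (decide (∃ j, s (Sum.inr (Sum.inl j)) = bit true)), s, 0)
  | .sim q par => Cfg.liftAction (ctlTape k m D.W) id
      (.sim (D.rule (fun _ => false) q fun i => s (ctlTape k m D.W i)).1 par) s
      (D.rule (fun _ => false) q fun i => s (ctlTape k m D.W i))

lemma ctlRule_enter (q : CtlState k D.Q) (s : TapeIdx k (Fin m ⊕ D.W) → Sym D.α)
    (h : (ctlRule k D q s).1 = .enter) : (ctlRule k D q s).2.2 = 0 := by
  rcases q with _ | _ | i | _ | _ | ⟨q, par⟩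
  · simp only [ctlRule] at h
    split_ifs at h
  · simp only [ctlRule] at h
    split at h <;> simp at h
  · simp only [ctlRule] at h ⊢
    split_ifs at h ⊢
    rfl
  · rfl
  · rfl
  · simp [ctlRule] at h

/-- The string `l` stands immediately to the right of the cell `h`, followed by blanks. -/
def RightOf {α : Type} (t : ℤ → Sym α) (h : ℤ) (l : List Bool) : Prop :=
  ∀ n : ℕ, t (h + 1 + n) = (l[n]?).map Sum.inl

/-- Writing a query from right to left leaves the head just before its beginning. So no rewinding is
needed, and the head finally rests on the answer cell. -/
lemma RightOf.cons {α : Type} {t : ℤ → Sym α} {h : ℤ} {l : List Bool} (hl : RightOf t h l)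
    (b : Bool) : RightOf (Function.update t h (bit b)) (h + -1) (b :: l) := by
  intro n
  cases n with
  | zero => simp [bit]
  | succ n =>
    rw [Function.update_of_ne (by push_cast; omega), List.getElem?_cons_succ, ← hl n]
    congr 1
    push_cast
    ring

lemma RightOf.update {α : Type} {t : ℤ → Sym α} {h : ℤ} {l : List Bool} (hl : RightOf t h l)
    (s : Sym α) : RightOf (Function.update t h s) h l := by
  intro n
  rw [Function.update_of_ne (by omega), hl n]

/-- The control program leads from `e` to `e'` in `n` steps, without calling the subroutine. -/
def Runs (n : ℕ) (e e' : Cfg k (CtlState k D.Q) D.α (Fin m ⊕ D.W)) : Prop :=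
  (detStep (ctlRule k D))^[n] e = e' ∧
    ∀ s < n, ((detStep (ctlRule k D))^[s] e).state ≠ .enter

variable {D}

lemma Runs.trans {n n' : ℕ} {e e' e'' : Cfg k (CtlState k D.Q) D.α (Fin m ⊕ D.W)}
    (h : Runs D n e e') (h' : Runs D n' e' e'') : Runs D (n + n') e e'' := by
  obtain ⟨rfl, h⟩ := h
  obtain ⟨rfl, h'⟩ := h'
  refine ⟨by rw [add_comm, Function.iterate_add_apply], fun s hs => ?_⟩
  rcases lt_or_ge s n with hlt | hge
  · exact h s hlt
  · have := h' (s - n) (by omega)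
    rwa [← Function.iterate_add_apply, Nat.sub_add_cancel hge] at this

lemma Runs.single {e : Cfg k (CtlState k D.Q) D.α (Fin m ⊕ D.W)} (h : e.state ≠ .enter) :
    Runs D 1 e (detStep (ctlRule k D) e) := by
  refine ⟨rfl, fun s hs => ?_⟩
  obtain rfl : s = 0 := by omega
  exact h

lemma runs_seek (x : List Bool) (r i : ℕ) (hi : i + r = x.length)
    (e : Cfg k (CtlState k D.Q) D.α (Fin m ⊕ D.W)) (hq : e.state = .seek)
    (ht : e.tape (Sum.inl ()) = strTape x) (hh : e.head (Sum.inl ()) = i) :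
    ∃ e', Runs D (r + 1) e e' ∧ e'.state = .copy ∧ e'.tape = e.tape ∧
      e'.head (Sum.inl ()) = x.length + (-1 : ℤ) ∧
      ∀ j, e'.head (Sum.inr j) = e.head (Sum.inr j) := by
  have hread : bitOf (e.read (Sum.inl ())) = x[i]? := by
    rw [Cfg.read, ht, hh, strTape_natCast, bitOf_map_inl]
  have hrun := Runs.single (D := D) (e := e) (by simp [hq])
  rw [detStep, hq] at hrun
  simp only [ctlRule, hread] at hrun
  induction r generalizing i e with
  | zero =>
    rw [List.getElem?_eq_none (by omega)] at hrun
    simp only [Option.isSome_none, Bool.false_eq_true, if_false] at hrun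
    refine ⟨_, hrun, rfl, funext fun t => Cfg.act_tape_of_eq _ _ _ rfl, ?_, fun j => ?_⟩
    · rw [Cfg.act_head, hh]
      simp
      omega
    · simp [Cfg.act_head]
  | succ r ih =>
    rw [List.getElem?_eq_getElem (by omega)] at hrun
    simp only [Option.isSome_some, if_true] at hrun
    set e₁ := e.act (.seek, e.read, Sum.elim (fun _ => 1) fun _ => 0) with he₁
    have ht₁ : e₁.tape = e.tape := funext fun t => Cfg.act_tape_of_eq _ _ _ rfl
    have hh₁ : e₁.head (Sum.inl ()) = ((i + 1 : ℕ) : ℤ) := by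
      simp [he₁, Cfg.act_head, hh]
    have hread₁ : bitOf (e₁.read (Sum.inl ())) = x[i + 1]? := by
      rw [Cfg.read, ht₁, ht, hh₁, strTape_natCast, bitOf_map_inl]
    have hrun₁ := Runs.single (D := D) (e := e₁) (by simp [he₁])
    rw [detStep, show e₁.state = .seek from rfl] at hrun₁
    simp only [ctlRule, hread₁] at hrun₁
    obtain ⟨e', h1, h2, h3, h4, h5⟩ := ih (i + 1) (by omega) e₁ rfl (by rw [ht₁, ht]) hh₁ hread₁
      hrun₁
    refine ⟨e', ?_, h2, by rw [h3, ht₁], h4, fun j => ?_⟩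
    · have := hrun.trans h1
      rwa [add_comm 1] at this
    · rw [h5]
      simp [he₁, Cfg.act_head]

lemma act_writeQuery {Q α W : Type} (e : Cfg k Q α W) (q : Q) (b : Fin k → Bool)
    (mv : TapeIdx k W → SignType) :
    (e.act (q, writeQuery e.read b, mv)).tape (Sum.inl ()) = e.tape (Sum.inl ()) ∧
    (∀ j, (e.act (q, writeQuery e.read b, mv)).tape (Sum.inr (Sum.inl j)) =
      Function.update (e.tape (Sum.inr (Sum.inl j))) (e.head (Sum.inr (Sum.inl j))) (bit (b j))) ∧
    ∀ w, (e.act (q, writeQuery e.read b, mv)).tape (Sum.inr (Sum.inr w)) =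
      e.tape (Sum.inr (Sum.inr w)) :=
  ⟨Cfg.act_tape_of_eq _ _ _ rfl, fun _ => rfl, fun _ => Cfg.act_tape_of_eq _ _ _ rfl⟩

lemma runs_copy (x : List Bool) (r : ℕ) (hr : r ≤ x.length)
    (e : Cfg k (CtlState k D.Q) D.α (Fin m ⊕ D.W)) (hq : e.state = .copy)
    (ht : e.tape (Sum.inl ()) = strTape x) (hh : e.head (Sum.inl ()) = r + (-1 : ℤ))
    (hl : ∀ j, RightOf (e.tape (Sum.inr (Sum.inl j))) (e.head (Sum.inr (Sum.inl j)))
      (x.drop r)) :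
    ∃ e', Runs D (r + 1) e e' ∧ e'.state = .setup (Fin.last _) ∧
      e'.tape (Sum.inl ()) = strTape x ∧ e'.head (Sum.inl ()) = 0 ∧
      (∀ j, RightOf (e'.tape (Sum.inr (Sum.inl j))) (e'.head (Sum.inr (Sum.inl j))) x) ∧
      ∀ w, e'.tape (Sum.inr (Sum.inr w)) = e.tape (Sum.inr (Sum.inr w)) ∧
        e'.head (Sum.inr (Sum.inr w)) = e.head (Sum.inr (Sum.inr w)) := by
  induction r generalizing e with
  | zero =>
    have hread : bitOf (e.read (Sum.inl ())) = none := by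
      rw [Cfg.read, ht, hh, strTape_of_neg _ (by simp), bitOf_none]
    have hrun := Runs.single (D := D) (e := e) (by simp [hq])
    rw [detStep, hq] at hrun
    simp only [ctlRule, hread] at hrun
    refine ⟨_, hrun, rfl, ?_, ?_, fun j => ?_, fun w => ⟨?_, ?_⟩⟩
    · rw [Cfg.act_tape_of_eq _ _ _ rfl, ht]
    · simp [Cfg.act_head, hh]
    · rw [Cfg.act_tape_of_eq _ _ _ rfl]
      simpa [Cfg.act_head] using hl j
    · rw [Cfg.act_tape_of_eq _ _ _ rfl]
    · simp [Cfg.act_head]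
  | succ r ih =>
    have hh' : e.head (Sum.inl ()) = (r : ℕ) := by
      rw [hh]
      push_cast
      ring
    have hread : bitOf (e.read (Sum.inl ())) = some x[r] := by
      rw [Cfg.read, ht, hh', strTape_natCast, bitOf_map_inl, List.getElem?_eq_getElem]
    have hrun := Runs.single (D := D) (e := e) (by simp [hq])
    rw [detStep, hq] at hrun
    simp only [ctlRule, hread] at hrun
    set mv : TapeIdx k (Fin m ⊕ D.W) → SignType :=
      Sum.elim (fun _ => -1) (Sum.elim (fun _ => -1) fun _ => 0) with hmv
    obtain ⟨w1, w2, w3⟩ := act_writeQuery e (.copy : CtlState k D.Q) (fun _ => x[r]) mv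
    set e₁ := e.act (.copy, writeQuery e.read fun _ => x[r], mv) with he₁
    obtain ⟨e', h1, h2, h3, h4, h5, h6⟩ := ih (by omega) e₁ rfl (by rw [w1, ht])
      (by simp [he₁, Cfg.act_head, hh', hmv]) (fun j => by
        rw [w2, ← List.cons_getElem_drop_succ (h := by omega)]
        exact (hl j).cons _)
    refine ⟨e', ?_, h2, h3, h4, h5, fun w => ⟨?_, ?_⟩⟩
    · have := hrun.trans h1
      rwa [add_comm 1] at this
    · rw [(h6 w).1, w3]
    · rw [(h6 w).2]
      simp [he₁, Cfg.act_head, hmv]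

/-- State `r > 0` writes bit `r - 1` of the prefix, and state `0` writes the answer bit. The latter
is `true`, as phase kickback requires; the selecting bit is initially `false`. -/
lemma runs_setup (x : List Bool) (r : ℕ) (hr : r < k + 2)
    (e : Cfg k (CtlState k D.Q) D.α (Fin m ⊕ D.W)) (hq : e.state = .setup ⟨r, hr⟩)
    (hl : ∀ j, RightOf (e.tape (Sum.inr (Sum.inl j))) (e.head (Sum.inr (Sum.inl j)))
      ((queryPrefix k j false).drop r ++ x)) :
    ∃ e', Runs D (r + 1) e e' ∧ e'.state = .enter ∧
      e'.tape (Sum.inl ()) = e.tape (Sum.inl ()) ∧ e'.head (Sum.inl ()) = e.head (Sum.inl ()) ∧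
      (∀ j, e'.tape (Sum.inr (Sum.inl j)) (e'.head (Sum.inr (Sum.inl j))) = bit true ∧
        RightOf (e'.tape (Sum.inr (Sum.inl j))) (e'.head (Sum.inr (Sum.inl j)))
          (queryPrefix k j false ++ x)) ∧
      ∀ w, e'.tape (Sum.inr (Sum.inr w)) = e.tape (Sum.inr (Sum.inr w)) ∧
        e'.head (Sum.inr (Sum.inr w)) = e.head (Sum.inr (Sum.inr w)) := by
  induction r generalizing e with
  | zero =>
    have hrun := Runs.single (D := D) (e := e) (by simp [hq])
    rw [detStep, hq] at hrun
    simp only [ctlRule, if_true] at hrun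
    obtain ⟨w1, w2, w3⟩ := act_writeQuery e (.enter : CtlState k D.Q) (fun _ => true) 0
    refine ⟨_, hrun, rfl, w1, ?_, fun j => ?_, fun w => ⟨w3 w, ?_⟩⟩
    · simp [Cfg.act_head]
    · have hhead : (e.act (.enter, writeQuery e.read fun _ => true, 0)).head
          (Sum.inr (Sum.inl j)) = e.head (Sum.inr (Sum.inl j)) := by simp [Cfg.act_head]
      rw [w2, hhead, Function.update_self]
      exact ⟨rfl, (hl j).update _⟩
    · simp [Cfg.act_head]
  | succ r ih =>
    have hrun := Runs.single (D := D) (e := e) (by simp [hq])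
    rw [detStep, hq] at hrun
    simp only [ctlRule, Nat.succ_ne_zero, if_false, Nat.add_sub_cancel] at hrun
    set mv : TapeIdx k (Fin m ⊕ D.W) → SignType :=
      Sum.elim (fun _ => 0) (Sum.elim (fun _ => -1) fun _ => 0) with hmv
    obtain ⟨w1, w2, w3⟩ := act_writeQuery e (.setup ⟨r, by omega⟩ : CtlState k D.Q)
      (fun j => ((queryPrefix k j false)[r]?).getD false) mv
    set e₁ := e.act (.setup ⟨r, by omega⟩,
      writeQuery e.read fun j => ((queryPrefix k j false)[r]?).getD false, mv) with he₁
    obtain ⟨e', h1, h2, h3, h4, h5, h6⟩ := ih (by omega) e₁ rfl (fun j => by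
      have hlt : r < (queryPrefix k j false).length := by simp; omega
      rw [w2, ← List.cons_getElem_drop_succ (h := hlt), List.getElem?_eq_getElem hlt]
      exact (hl j).cons _)
    refine ⟨e', ?_, h2, by rw [h3, w1], ?_, h5, fun w => ⟨?_, ?_⟩⟩
    · have := hrun.trans h1
      rwa [add_comm 1] at this
    · rw [h4]
      simp [he₁, Cfg.act_head, hmv]
    · rw [(h6 w).1, w3]
    · rw [(h6 w).2]
      simp [he₁, Cfg.act_head, hmv]

variable (k) in
/-- The configuration in which the control program calls the subroutine. -/
lemma runs_init (D : DOTM m) (x : List Bool) :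
    ∃ e : Cfg k (CtlState k D.Q) D.α (Fin m ⊕ D.W),
      Runs D (2 * x.length + k + 4) (Cfg.init .seek x) e ∧ e.state = .enter ∧
      Cfg.Sees (ctlTape k m D.W) id e (Cfg.init D.start x : Cfg m D.Q D.α D.W) ∧
      ∀ j, e.tape (Sum.inr (Sum.inl j)) (e.head (Sum.inr (Sum.inl j))) = bit true ∧
        RightOf (e.tape (Sum.inr (Sum.inl j))) (e.head (Sum.inr (Sum.inl j)))
          (queryPrefix k j false ++ x) := by
  obtain ⟨e₁, a1, a2, a3, a4, a5⟩ := runs_seek (k := k) (D := D) x x.length 0 (by simp)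
    (Cfg.init .seek x) rfl rfl rfl
  obtain ⟨e₂, b1, b2, b3, b4, b5, b6⟩ := runs_copy x x.length le_rfl e₁ a2 (by rw [a3]; rfl) a4
    (fun j n => by
      rw [a3, List.drop_length]
      rfl)
  obtain ⟨e₃, c1, c2, c3, c4, c5, c6⟩ := runs_setup x (k + 1) (by omega) e₂ b2
    (fun j => by
      rw [List.drop_eq_nil_of_le (by simp)]
      exact b5 j)
  refine ⟨e₃, ?_, c2, ⟨?_, ?_⟩, c5⟩
  · have := (a1.trans b1).trans c1
    convert this using 1
    ring
  · rintro (_ | w) z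
    · exact congrFun (c3.trans b3) z
    · change e₃.tape (Sum.inr (Sum.inr w)) z = _
      rw [(c6 w).1, (b6 w).1, a3]
      rfl
  · rintro (_ | w)
    · exact c4.trans b4
    · change e₃.head (Sum.inr (Sum.inr w)) = _
      rw [(c6 w).2, (b6 w).2, a5]
      rfl

/-- After the subroutine the query heads scan the second cells, which hold the exclusive-ors, so one
step collects their disjunction. The tapes reserved for `D` still show its initial configuration. -/
lemma detStep_final {e : Cfg k (CtlState k D.Q) D.α (Fin m ⊕ D.W)} {x : List Bool}
    (hs : Cfg.Sees (ctlTape k m D.W) id e (Cfg.init D.start x : Cfg m D.Q D.α D.W))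
    (u : Fin k → Bool × Bool) :
    Cfg.Sees (ctlTape k m D.W) id (detStep (ctlRule k D) (e.withCells .final true u))
      (Cfg.init D.start x : Cfg m D.Q D.α D.W) ∧
    (detStep (ctlRule k D) (e.withCells .final true u)).state =
      .sim D.start (decide (∃ j, (u j).2 = true)) := by
  classical
  set e₁ : Cfg k (CtlState k D.Q) D.α (Fin m ⊕ D.W) := e.withCells .final true u with he₁
  have hstep : detStep (ctlRule k D) e₁ =
      ⟨.sim D.start (decide (∃ j, e₁.read (Sum.inr (Sum.inl j)) = bit true)),
        e₁.tape, e₁.head⟩ := by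
    rw [← Cfg.act_self]
    rfl
  rw [hstep]
  constructor
  · refine hs.congr (fun i => ?_) (fun i => ?_) rfl rfl <;> rcases i with _ | _ <;> rfl
  · simp only [he₁, Cfg.withCells_read, cell, if_true, bit_injective.eq_iff]

lemma detStep_iterate_sim {e : Cfg k (CtlState k D.Q) D.α (Fin m ⊕ D.W)} {x : List Bool}
    {par : Bool} (hq : e.state = .sim D.start par)
    (hs : Cfg.Sees (ctlTape k m D.W) id e (Cfg.init D.start x : Cfg m D.Q D.α D.W)) (t : ℕ) :
    Cfg.Sees (ctlTape k m D.W) id ((detStep (ctlRule k D))^[t] e)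
      (D.run (fun _ _ => false) x t) ∧
    ((detStep (ctlRule k D))^[t] e).state = .sim (D.run (fun _ _ => false) x t).state par := by
  induction t with
  | zero => exact ⟨hs, hq⟩
  | succ t ih =>
    rw [Function.iterate_succ_apply', DOTM.run_const_succ]
    set e' := (detStep (ctlRule k D))^[t] e
    obtain ⟨h1, h2⟩ := ih
    have hr : (fun i => e'.read (ctlTape k m D.W i)) = (D.run (fun _ _ => false) x t).read :=
      funext fun i => h1.read i
    rw [detStep, h2, ctlRule, hr]
    exact ⟨h1.act (ctlTape_injective _ _ _) _ _, rfl⟩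

end Control

/-! ### The quantum machine -/

section Assembly

variable {k : ℕ} {Q α W : Type} [Finite Q] [Finite α] [Finite W]
  {ρ : Q → (TapeIdx k W → Sym α) → Action k Q α W} {enter final : Q} {A : Language Bool}

lemma logEvolve_single {c : Cfg k (LogState k Q W) (α ⊕ LogSym k Q α W) (W ⊕ Unit)}
    (h : (logMachine ρ enter final).had c.state = none) (z : ℂ) :
    logEvolve ρ enter final A (Finsupp.single c z) =
      Finsupp.single ((logMachine ρ enter final).next A c) z := by
  rw [logEvolve, Finsupp.linearCombination_single,
    RevRule.mix_of_none _ (RevRule.hadBit_of_had_eq_none _ h _), Finsupp.mapDomain_single,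
    Finsupp.smul_single, smul_eq_mul, mul_one]

lemma logEvolve_iterate_single {c : Cfg k (LogState k Q W) (α ⊕ LogSym k Q α W) (W ⊕ Unit)}
    (t : ℕ) (h : ∀ s < t, (logMachine ρ enter final).had
      (((logMachine ρ enter final).next A)^[s] c).state = none) (z : ℂ) :
    (logEvolve ρ enter final A)^[t] (Finsupp.single c z) =
      Finsupp.single (((logMachine ρ enter final).next A)^[t] c) z := by
  induction t with
  | zero => rfl
  | succ t ih =>
    rw [Function.iterate_succ_apply', ih fun s hs => h s (by omega),
      logEvolve_single (h t (by omega)), Function.iterate_succ_apply']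

lemma eq_next_of_ne_zero {c c' : Cfg k (LogState k Q W) (α ⊕ LogSym k Q α W) (W ⊕ Unit)}
    (h : (logMachine ρ enter final).had c.state = none)
    (hc : Finsupp.mapDomain ((logMachine ρ enter final).next A)
      ((logMachine ρ enter final).mix c) c' ≠ 0) :
    c' = (logMachine ρ enter final).next A c := by
  rw [RevRule.mix_of_none _ (RevRule.hadBit_of_had_eq_none _ h _), Finsupp.mapDomain_single] at hc
  by_contra hne
  exact hc (Finsupp.single_eq_of_ne hne)

lemma next_quantCfg_mem (A : Language Bool)
    {c₀ : Cfg k (LogState k Q W) (α ⊕ LogSym k Q α W) (W ⊕ Unit)}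
    (h₀ : c₀.tape logTape (c₀.head logTape) = none) {v : Fin k → Bool → Bool}
    (hv : ∀ (q : LogState k Q W) (u : Fin k → Bool × Bool) (j : Fin k),
      (c₀.withCells q false u).answers A j = v j (u j).2) {i : ℕ} (hi : i < 4 * k + 4)
    (u : Fin k → Bool × Bool) :
    ∃ u', (logMachine ρ enter final).next A (quantCfg final c₀ i u) =
      quantCfg final c₀ (i + 1) u' := by
  by_cases hi' : i = 2 * k + 2
  · subst hi'
    exact ⟨_, next_quantCfg_call hv u⟩
  · exact ⟨u, next_quantCfg A h₀ hi hi' u⟩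

/-- The gates and the call change cell contents only, so every branch passes through the subroutine
states at the same times. -/
lemma eq_quantCfg_of_ne_zero
    {c₀ : Cfg k (LogState k Q W) (α ⊕ LogSym k Q α W) (W ⊕ Unit)}
    (h₀ : c₀.tape logTape (c₀.head logTape) = none) {v : Fin k → Bool → Bool}
    (hv : ∀ (q : LogState k Q W) (u : Fin k → Bool × Bool) (j : Fin k),
      (c₀.withCells q false u).answers A j = v j (u j).2) {i : ℕ} (hi : i < 4 * k + 4)
    (u : Fin k → Bool × Bool)
    {c' : Cfg k (LogState k Q W) (α ⊕ LogSym k Q α W) (W ⊕ Unit)}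
    (hc : Finsupp.mapDomain ((logMachine ρ enter final).next A)
      ((logMachine ρ enter final).mix (quantCfg final c₀ i u)) c' ≠ 0) :
    ∃ u', c' = quantCfg final c₀ (i + 1) u' := by
  rcases h : hadIdx k i with _ | j
  · obtain ⟨u', hu'⟩ := next_quantCfg_mem (ρ := ρ) (enter := enter) (final := final) A h₀ hv hi u
    rw [mix_quantCfg_of_none (by omega) h, Finsupp.mapDomain_single, hu'] at hc
    refine ⟨u', ?_⟩
    by_contra hne
    exact hc (Finsupp.single_eq_of_ne hne)
  · obtain ⟨u₁, hu₁⟩ := next_quantCfg_mem (ρ := ρ) (enter := enter) (final := final) A h₀ hv hi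
      (flipAt (second k i) j u)
    obtain ⟨u₂, hu₂⟩ := next_quantCfg_mem (ρ := ρ) (enter := enter) (final := final) A h₀ hv hi u
    rw [mix_quantCfg_of_some (by omega) h, Finsupp.mapDomain_add, Finsupp.mapDomain_single,
      Finsupp.mapDomain_single, hu₁, hu₂, Finsupp.add_apply] at hc
    by_contra! hne
    exact hc (by rw [Finsupp.single_eq_of_ne (hne u₁), Finsupp.single_eq_of_ne (hne u₂), add_zero])

/-- The first step after the subroutine. -/
lemma logged_next_quantCfg
    {c₀ : Cfg k (LogState k Q W) (α ⊕ LogSym k Q α W) (W ⊕ Unit)} {e₀ : Cfg k Q α W}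
    (hne : final ≠ enter) (h : Logged enter final c₀ e₀) (u : Fin k → Bool × Bool) :
    Logged enter final ((logMachine ρ enter final).next A (quantCfg final c₀ (4 * k + 4) u))
      (e₀.withCells final true u) := by
  set c := quantCfg final c₀ (4 * k + 4) u with hc
  have hq : c.state = .quant ⟨4 * k + 4, by omega⟩ := dif_pos (by omega)
  have hsec : second k (4 * k + 4) = true := decide_eq_true (by omega)
  have hpre : c.state ≠ (logMachine ρ enter final).pre := by
    rw [hq]
    simp [logMachine]
    omega
  have hdom : (c.state, c.read) ∈ logDom (k := k) (Q := Q) (α := α) (W := W) := by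
    rw [hq]
    exact Or.inr (h.blank _ le_rfl)
  have hfin : (quantAt final (4 * k + 4 + 1) : LogState k Q W) = .ctl final 0 :=
    dif_neg (by omega)
  rw [RevRule.next, if_neg hpre, logMachine_σ ρ enter final hdom, hq, logRule, hfin]
  have htape : ∀ i, (c.act ((logMachine ρ enter final).action (.ctl final 0, c.read))).tape i =
      c.tape i := fun i => Cfg.act_tape_of_eq _ _ _ rfl
  have hhead : ∀ i, (c.act ((logMachine ρ enter final).action (.ctl final 0, c.read))).head i =
      c.head i + ((withLog (fun _ => 0) 1 i : SignType) : ℤ) := fun i => rfl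
  refine ⟨⟨fun i z => ?_, fun i => ?_⟩, fun z hz => ?_, fun h' => absurd h' hne,
    fun _ => ⟨0, rfl⟩⟩
  · rw [htape, hc]
    rcases i with _ | j | w
    · exact h.sees.tape (Sum.inl _) z
    · have ht : c₀.tape (Sum.inr (Sum.inl j)) = fun z => logSym (e₀.tape (Sum.inr (Sum.inl j)) z) :=
        funext (h.sees.tape (Sum.inr (Sum.inl j)))
      have hh : c₀.head (Sum.inr (Sum.inl j)) = e₀.head (Sum.inr (Sum.inl j)) :=
        h.sees.head (Sum.inr (Sum.inl j))
      simp only [quantCfg, Cfg.withCells, keep, Sum.map_inr, Sum.map_inl, id_eq]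
      rw [ht, hh]
      simp only [Function.update_apply]
      split_ifs <;> rfl
    · exact h.sees.tape (Sum.inr (Sum.inr w)) z
  · rw [hhead, withLog_keep, SignType.coe_zero, add_zero, hc, quantCfg, hsec]
    rcases i with _ | j | w
    · exact h.sees.head (Sum.inl _)
    · exact congrArg (· + ((true.toNat : ℕ) : ℤ)) (h.sees.head (Sum.inr (Sum.inl j)))
    · exact h.sees.head (Sum.inr (Sum.inr w))
  · rw [hhead, withLog_logTape, SignType.coe_one] at hz
    rw [htape]
    refine h.blank z ?_
    change c₀.head logTape + 1 ≤ z at hz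
    omega

end Assembly

/-! ### Computation paths and the superposition after the subroutine -/

section Path

variable {k : ℕ} {Q α W : Type} [Finite Q] [Finite α] [Finite W]
  {ρ : Q → (TapeIdx k W → Sym α) → Action k Q α W} {enter final : Q} {A : Language Bool}

lemma Logged.had_eq_none_and_ne_pre
    {c : Cfg k (LogState k Q W) (α ⊕ LogSym k Q α W) (W ⊕ Unit)} {e : Cfg k Q α W}
    (h : Logged enter final c e) (he : e.state ≠ enter) :
    (logMachine ρ enter final).had c.state = none ∧
      c.state ≠ (logMachine ρ enter final).pre := by
  obtain ⟨m, hm⟩ := h.ctl_state he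
  rw [hm]
  exact ⟨rfl, by simp [logMachine]⟩

lemma had_quantCfg_last (c₀ : Cfg k (LogState k Q W) (α ⊕ LogSym k Q α W) (W ⊕ Unit))
    (u : Fin k → Bool × Bool) :
    (logMachine ρ enter final).had (quantCfg final c₀ (4 * k + 4) u).state = none := by
  have hq : (quantCfg final c₀ (4 * k + 4) u).state = .quant ⟨4 * k + 4, by omega⟩ :=
    dif_pos (by omega)
  rw [hq]
  change hadIdx k (4 * k + 4) = none
  unfold hadIdx
  repeat rw [dif_neg (by omega)]

lemma quantCfg_state_eq_pre {c₀ : Cfg k (LogState k Q W) (α ⊕ LogSym k Q α W) (W ⊕ Unit)}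
    {u : Fin k → Bool × Bool} {i : ℕ} (hi : i < 4 * k + 5)
    (h : (quantCfg final c₀ i u).state = (logMachine ρ enter final).pre) : i = 2 * k + 2 := by
  have hq : (quantCfg final c₀ i u).state = .quant ⟨i, hi⟩ := dif_pos hi
  rw [hq] at h
  simpa [logMachine] using h

lemma logged_iterate_quantCfg (hρ : ∀ q s, (ρ q s).1 = enter → (ρ q s).2.2 = 0)
    {c₀ : Cfg k (LogState k Q W) (α ⊕ LogSym k Q α W) (W ⊕ Unit)} {e₀ : Cfg k Q α W}
    (hne : final ≠ enter) (h : Logged enter final c₀ e₀) (u : Fin k → Bool × Bool)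
    (hsim : ∀ t, ((detStep ρ)^[t] (e₀.withCells final true u)).state ≠ enter) (t : ℕ) :
    Logged enter final (((logMachine ρ enter final).next A)^[t + 1]
      (quantCfg final c₀ (4 * k + 4) u)) ((detStep ρ)^[t] (e₀.withCells final true u)) := by
  rw [Function.iterate_succ_apply]
  exact (logged_next_quantCfg hne h u).iterate hρ A t fun s _ => hsim s

lemma had_iterate_quantCfg (hρ : ∀ q s, (ρ q s).1 = enter → (ρ q s).2.2 = 0)
    {c₀ : Cfg k (LogState k Q W) (α ⊕ LogSym k Q α W) (W ⊕ Unit)} {e₀ : Cfg k Q α W}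
    (hne : final ≠ enter) (h : Logged enter final c₀ e₀) (u : Fin k → Bool × Bool)
    (hsim : ∀ t, ((detStep ρ)^[t] (e₀.withCells final true u)).state ≠ enter) (t : ℕ) :
    (logMachine ρ enter final).had (((logMachine ρ enter final).next A)^[t]
      (quantCfg final c₀ (4 * k + 4) u)).state = none := by
  cases t with
  | zero => exact had_quantCfg_last c₀ u
  | succ t => exact ((logged_iterate_quantCfg hρ hne h u hsim t).had_eq_none_and_ne_pre (hsim t)).1

/-- On every computation path, the oracle is called at one fixed time only. -/
lemma eq_of_state_eq_pre (hρ : ∀ q s, (ρ q s).1 = enter → (ρ q s).2.2 = 0)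
    {c₀ c₁ : Cfg k (LogState k Q W) (α ⊕ LogSym k Q α W) (W ⊕ Unit)} {e₀ e₁ : Cfg k Q α W} {n : ℕ}
    (h₁ : Logged enter final c₁ e₁) (hn : ∀ s < n, ((detStep ρ)^[s] e₁).state ≠ enter)
    (hc₀ : ((logMachine ρ enter final).next A)^[n] c₁ = c₀)
    (hne : final ≠ enter) (h : Logged enter final c₀ e₀)
    (hsim : ∀ u t, ((detStep ρ)^[t] (e₀.withCells final true u)).state ≠ enter)
    {u₀ : Fin k → Bool × Bool} (hself : c₀ = quantCfg final c₀ 0 u₀)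
    {v : Fin k → Bool → Bool}
    (hv : ∀ (q : LogState k Q W) (u : Fin k → Bool × Bool) (j : Fin k),
      (c₀.withCells q false u).answers A j = v j (u j).2)
    {T : ℕ} {c : ℕ → Cfg k (LogState k Q W) (α ⊕ LogSym k Q α W) (W ⊕ Unit)} (hc : c 0 = c₁)
    (hstep : ∀ i < T, Finsupp.mapDomain ((logMachine ρ enter final).next A)
      ((logMachine ρ enter final).mix (c i)) (c (i + 1)) ≠ 0) {t : ℕ} (ht : t ≤ T)
    (hpre : (c t).state = (logMachine ρ enter final).pre) : t = n + (2 * k + 2) := by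
  have h₀ : c₀.tape logTape (c₀.head logTape) = none := h.blank _ le_rfl
  have hlog : ∀ s ≤ n, Logged enter final (((logMachine ρ enter final).next A)^[s] c₁)
      ((detStep ρ)^[s] e₁) := fun s hs => h₁.iterate hρ A s fun r hr => hn r (by omega)
  -- Before the subroutine the path is forced and stays in control states, none of which is `pre`.
  have hfirst : ∀ s ≤ n, s ≤ T → c s = ((logMachine ρ enter final).next A)^[s] c₁ := by
    intro s
    induction s with
    | zero => exact fun _ _ => hc
    | succ s ih =>
      intro hs hsT
      have hcs := ih (by omega) (by omega)
      rw [Function.iterate_succ_apply', ← hcs]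
      refine eq_next_of_ne_zero ?_ (hstep s hsT)
      rw [hcs]
      exact ((hlog s (by omega)).had_eq_none_and_ne_pre (hn s hs)).1
  have hquant : ∀ i ≤ 4 * k + 4, n + i ≤ T → ∃ u, c (n + i) = quantCfg final c₀ i u := by
    intro i
    induction i with
    | zero => exact fun _ hT => ⟨u₀, ((hfirst n le_rfl hT).trans hc₀).trans hself⟩
    | succ i ih =>
      intro hi hT
      obtain ⟨u, hu⟩ := ih (by omega) (by omega)
      have := hstep (n + i) hT
      rw [hu] at this
      exact eq_quantCfg_of_ne_zero h₀ hv hi u this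
  rcases lt_or_ge t n with hlt | hge
  · rw [hfirst t hlt.le ht] at hpre
    exact absurd hpre ((hlog t hlt.le).had_eq_none_and_ne_pre (hn t hlt)).2
  obtain ⟨t, rfl⟩ := Nat.exists_eq_add_of_le hge
  rcases le_or_gt t (4 * k + 4) with hle | hgt
  · obtain ⟨u, hu⟩ := hquant t hle ht
    rw [hu] at hpre
    rw [quantCfg_state_eq_pre (by omega) hpre]
  · obtain ⟨u, hu⟩ := hquant (4 * k + 4) le_rfl (by omega)
    -- After the gates each branch continues deterministically. The cell contents `u` are arbitrary
    -- here, because branches whose total amplitude cancels are still paths.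
    have hlast : ∀ s, n + (4 * k + 4) + s ≤ T → c (n + (4 * k + 4) + s) =
        ((logMachine ρ enter final).next A)^[s] (quantCfg final c₀ (4 * k + 4) u) := by
      intro s
      induction s with
      | zero => exact fun _ => hu
      | succ s ih =>
        intro hT
        have hcs := ih (by omega)
        rw [Function.iterate_succ_apply', ← hcs]
        refine eq_next_of_ne_zero ?_ (hstep _ hT)
        rw [hcs]
        exact had_iterate_quantCfg hρ hne h u (hsim u) s
    obtain ⟨s, hs⟩ : ∃ s, n + t = n + (4 * k + 4) + (s + 1) :=
      ⟨t - (4 * k + 5), by omega⟩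
    rw [hs] at hpre ht
    rw [hlast _ ht] at hpre
    exact absurd hpre
      ((logged_iterate_quantCfg hρ hne h u (hsim u) s).had_eq_none_and_ne_pre (hsim u s)).2

/-- The superposition after the subroutine and `t` further steps. -/
lemma logEvolve_iterate_init (hρ : ∀ q s, (ρ q s).1 = enter → (ρ q s).2.2 = 0)
    {c₀ c₁ : Cfg k (LogState k Q W) (α ⊕ LogSym k Q α W) (W ⊕ Unit)} {e₀ e₁ : Cfg k Q α W} {n : ℕ}
    (h₁ : Logged enter final c₁ e₁) (hn : ∀ s < n, ((detStep ρ)^[s] e₁).state ≠ enter)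
    (hc₀ : ((logMachine ρ enter final).next A)^[n] c₁ = c₀)
    (hne : final ≠ enter) (h : Logged enter final c₀ e₀)
    (hsim : ∀ u t, ((detStep ρ)^[t] (e₀.withCells final true u)).state ≠ enter)
    (hself : c₀ = quantCfg final c₀ 0 fun _ => (true, false))
    {v : Fin k → Bool → Bool}
    (hv : ∀ (q : LogState k Q W) (u : Fin k → Bool × Bool) (j : Fin k),
      (c₀.withCells q false u).answers A j = v j (u j).2) (t : ℕ) :
    ∃ ε : ℂ, ‖ε‖ = 1 ∧
      (logEvolve ρ enter final A)^[t + ((4 * k + 4) + n)] (Finsupp.single c₁ 1) =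
      Finsupp.single (((logMachine ρ enter final).next A)^[t] (quantCfg final c₀ (4 * k + 4)
        fun j => (true, xor (v j false) (v j true)))) ε := by
  obtain ⟨ε, hε, hsub⟩ := logEvolve_iterate_subroutine (ρ := ρ) (enter := enter) (final := final)
    (h.blank _ le_rfl) hv
  rw [← hself] at hsub
  refine ⟨ε, hε, ?_⟩
  rw [Function.iterate_add_apply, Function.iterate_add_apply, logEvolve_iterate_single n _ 1, hc₀,
    hsub]
  · exact logEvolve_iterate_single t
      (fun s _ => had_iterate_quantCfg hρ hne h _ (hsim _) s) ε
  · exact fun s hs => ((h₁.iterate hρ A s fun r hr => hn r (by omega)).had_eq_none_and_ne_pre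
      (hn s hs)).1

end Path

/-! ### The quantum machine and its acceptance probability -/

section Simulation

lemma logged_init {k : ℕ} {Q α W : Type} {enter final q : Q} (hq : q ≠ enter) (x : List Bool) :
    Logged (α := α) (W := W) (k := k) enter final (Cfg.init (.ctl q 0) x) (Cfg.init q x) := by
  refine ⟨⟨fun i z => ?_, fun i => rfl⟩, fun z _ => rfl, fun h => absurd h hq, fun _ => ⟨0, rfl⟩⟩
  rcases i with _ | _ | _
  · exact (symMap_strTape _ x z).symm
  · rfl
  · rfl

open Classical in
-- The second cell is the first cell of the query string, so its bit selects the question of the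
-- pair; the answer cell has no influence.
lemma answers_withCells {k : ℕ} {Q Q' α W : Type} {c : Cfg k Q α W} {j : Fin k} {x : List Bool}
    (h : RightOf (c.tape (Sum.inr (Sum.inl j))) (c.head (Sum.inr (Sum.inl j)))
      (queryPrefix k j false ++ x)) (B : Language Bool) (q : Q') (u : Fin k → Bool × Bool) :
    (c.withCells q false u).answers B j = decide (queryPrefix k j (u j).2 ++ x ∈ B) := by
  apply Cfg.HasQuery.answers_eq
  rw [Cfg.hasQuery_iff]
  intro n _
  simp only [Cfg.withCells, Bool.toNat_false, Nat.cast_zero, add_zero]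
  cases n with
  | zero => simp [queryPrefix]
  | succ n =>
    rw [Function.update_of_ne (by push_cast; omega), Function.update_of_ne (by push_cast; omega),
      h (n + 1)]
    simp only [queryPrefix, List.cons_append, List.getElem?_cons_succ]
    rcases (List.ofFn (fun i => decide (i = j)) ++ x)[n]? with _ | b <;> rfl

variable {k m : ℕ} (D : DOTM m)

/-- The accepting states: the output of the simulated machine differs from the collected bit. -/
def acceptSet : Set (LogState k (CtlState k D.Q) (Fin m ⊕ D.W)) :=
  {q | ∃ q' par mv b, q = .ctl (.sim q' par) mv ∧ D.output q' = some b ∧ xor b par = true}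

lemma ctl_sim_mem_acceptSet {q : D.Q} {par b : Bool} {mv : TapeIdx k (Fin m ⊕ D.W) → SignType}
    (hb : D.output q = some b) :
    (LogState.ctl (.sim q par) mv : LogState k (CtlState k D.Q) (Fin m ⊕ D.W)) ∈ acceptSet D ↔
      xor b par = true := by
  constructor
  · rintro ⟨q', par', mv', b', h, hb', hx⟩
    simp only [LogState.ctl.injEq, CtlState.sim.injEq] at h
    obtain ⟨⟨rfl, rfl⟩, -⟩ := h
    rw [hb, Option.some.injEq] at hb'
    rwa [hb']
  · exact fun h => ⟨q, par, mv, b, rfl, hb, h⟩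

variable (k) in
/-- The quantum machine that computes the output of `D` without queries and the exclusive-ors of
pairs of answers. -/
noncomputable def quantumMachine : QOTM k :=
  (logMachine (ctlRule k D) .enter .final).toQOTM (.ctl .seek 0) (acceptSet D)

lemma quantumMachine_evolve (B : Language Bool) :
    (quantumMachine k D).evolve B = logEvolve (ctlRule k D) .enter .final B :=
  congrArg (Finsupp.linearCombination ℂ)
    (funext ((logMachine (ctlRule k D) .enter .final).stepBasis_eq _ _ B))

open Classical in
-- The total time consists of the preparation, the subroutine, two steps that enter and leave
-- `final`, and `t` steps of `D` with negative answers. The final superposition is one configuration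
-- with an amplitude of norm one, so the probability is exactly 0 or 1.
lemma quantumMachine_spec (B : Language Bool) (x : List Bool) (t : ℕ) {b : Bool}
    (hb : D.output (D.run (fun _ _ => false) x t).state = some b) :
    (quantumMachine k D).NonAdaptive B x (t + 2 + ((4 * k + 4) + (2 * x.length + k + 4))) ∧
    (quantumMachine k D).acceptProb B x (t + 2 + ((4 * k + 4) + (2 * x.length + k + 4))) =
      if xor b (decide (∃ j : Fin k, xor (decide (queryPrefix k j false ++ x ∈ B))
        (decide (queryPrefix k j true ++ x ∈ B)) = true)) = true then 1 else 0 := by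
  obtain ⟨e₀, ⟨hrun, hn⟩, hstate, hsees, hquery⟩ := runs_init k D x
  set n := 2 * x.length + k + 4
  have h₁ : Logged .enter .final (Cfg.init (.ctl .seek 0) x)
      (Cfg.init .seek x : Cfg k (CtlState k D.Q) D.α (Fin m ⊕ D.W)) :=
    logged_init (by simp) x
  set R := logMachine (ctlRule k D) .enter .final with hR
  set c₁ : Cfg k (LogState k (CtlState k D.Q) (Fin m ⊕ D.W))
      (D.α ⊕ LogSym k (CtlState k D.Q) D.α (Fin m ⊕ D.W)) ((Fin m ⊕ D.W) ⊕ Unit) :=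
    Cfg.init (.ctl .seek 0) x with hc₁
  obtain ⟨c₀, hc₀⟩ : ∃ c₀, (R.next B)^[n] c₁ = c₀ := ⟨_, rfl⟩
  have h : Logged .enter .final c₀ e₀ := by
    rw [← hc₀, ← hrun]
    exact h₁.iterate (ctlRule_enter D) B n hn
  have hne : (CtlState.final : CtlState k D.Q) ≠ .enter := by simp
  have hafter : ∀ (u : Fin k → Bool × Bool) s,
      ((detStep (ctlRule k D))^[s + 1] (e₀.withCells .final true u)).state =
        .sim (D.run (fun _ _ => false) x s).state (decide (∃ j, (u j).2 = true)) := by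
    intro u s
    rw [Function.iterate_succ_apply]
    exact (detStep_iterate_sim (detStep_final hsees u).2 (detStep_final hsees u).1 s).2
  have hsim : ∀ (u : Fin k → Bool × Bool) s,
      ((detStep (ctlRule k D))^[s] (e₀.withCells .final true u)).state ≠ .enter := by
    intro u s
    cases s with
    | zero => exact hne
    | succ s =>
      rw [hafter]
      simp
  have htape : ∀ j z, c₀.tape (Sum.inr (Sum.inl j)) z =
      logSym (e₀.tape (Sum.inr (Sum.inl j)) z) := fun j => h.sees.tape (Sum.inr (Sum.inl j))
  have hhead : ∀ j, c₀.head (Sum.inr (Sum.inl j)) = e₀.head (Sum.inr (Sum.inl j)) :=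
    fun j => h.sees.head (Sum.inr (Sum.inl j))
  have hright : ∀ j, RightOf (c₀.tape (Sum.inr (Sum.inl j))) (c₀.head (Sum.inr (Sum.inl j)))
      (queryPrefix k j false ++ x) := by
    intro j i
    rw [htape, hhead, (hquery j).2 i]
    exact symMap_map_inl _ _
  have hself : c₀ = quantCfg .final c₀ 0 fun _ => (true, false) := by
    have hsec : second k 0 = false := decide_eq_false (by omega)
    rw [quantCfg, hsec, ← h.enter_state hstate]
    refine (Cfg.withCells_self c₀ _ (fun j => ?_) fun j => ?_).symm
    · rw [htape, hhead, (hquery j).1]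
      rfl
    · have := hright j 0
      rwa [Nat.cast_zero, add_zero] at this
  have hv := fun (q : LogState k (CtlState k D.Q) (Fin m ⊕ D.W)) u j =>
    answers_withCells (hright j) B q u
  constructor
  · intro c hc s r hsr hr hs hr'
    have hstep : ∀ i < t + 2 + (4 * k + 4 + n),
        Finsupp.mapDomain (R.next B) (R.mix (c i)) (c (i + 1)) ≠ 0 := by
      intro i hi
      have hval := DFunLike.congr_fun (R.stepBasis_eq (.ctl .seek 0) (acceptSet D) B (c i))
        (c (i + 1))
      exact fun h0 => hc.2 i hi (hval.trans h0)
    -- Two calls on the same path would both occur at the time `n + (2 * k + 2)`.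
    have e1 := eq_of_state_eq_pre (ctlRule_enter D) h₁ hn hc₀ hne h hsim hself
      (v := fun j b => decide (queryPrefix k j b ++ x ∈ B)) hv hc.1 hstep (t := s) (by omega) hs
    have e2 := eq_of_state_eq_pre (ctlRule_enter D) h₁ hn hc₀ hne h hsim hself
      (v := fun j b => decide (queryPrefix k j b ++ x ∈ B)) hv hc.1 hstep (t := r) (by omega) hr'
    omega
  · obtain ⟨ε, hε, hevo⟩ := logEvolve_iterate_init (ctlRule_enter D) h₁ hn hc₀ hne h hsim hself
      (v := fun j b => decide (queryPrefix k j b ++ x ∈ B)) hv (t + 2)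
    set u : Fin k → Bool × Bool := fun j => (true, xor (decide (queryPrefix k j false ++ x ∈ B))
      (decide (queryPrefix k j true ++ x ∈ B))) with hu
    have hlast := logged_iterate_quantCfg (A := B) (ctlRule_enter D) hne h u (hsim u) (t + 1)
    obtain ⟨mv, hmv⟩ := hlast.ctl_state (hsim u (t + 1))
    rw [hafter] at hmv
    have hrun' : (quantumMachine k D).run B x (t + 2 + (4 * k + 4 + n)) =
        Finsupp.single ((R.next B)^[t + 1 + 1] (quantCfg .final c₀ (4 * k + 4) u)) ε := by
      rw [QOTM.run, quantumMachine_evolve]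
      exact hevo
    rw [QOTM.acceptProb, hrun']
    refine (Finsupp.sum_single_index (by simp)).trans ?_
    rw [hmv, hε, one_pow]
    exact if_congr (ctl_sim_mem_acceptSet D hb) rfl rfl

end Simulation

end QueryMachine

theorem theorem2 (K : Set ℂ)
    (hK : ({0, 1, ((1 / √2 : ℝ) : ℂ), ((-(1 / √2) : ℝ) : ℂ)} : Set ℂ) ⊆ K) (k : ℕ) :
    QueryMachine.PParNP (2 * k) ⊆ QueryMachine.EQPParNP K k := by
  classical
  intro L hL
  obtain ⟨D, p, B, hB, h⟩ := QueryMachine.exists_xor_oracle hL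
  -- This polynomial is the exact measuring time of `quantumMachine_spec` with `t = p(|x|)`, so
  -- every input is measured at the moment for which the configuration is known.
  refine ⟨B, hB, QueryMachine.quantumMachine k D, p + Polynomial.C 2 + (Polynomial.C (4 * k + 4) +
    (Polynomial.C 2 * Polynomial.X + Polynomial.C k + Polynomial.C 4)), ?_,
    QueryMachine.RevRule.wellFormed _ _ _, fun x => ?_⟩
  · exact fun q s a => QueryMachine.RevRule.δ_mem _ hK q s a
  · obtain ⟨b, hb, hx⟩ := h x
    have hspec := QueryMachine.quantumMachine_spec (k := k) D B x _ hb
    rw [← hx] at hspec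
    simp only [Polynomial.eval_add, Polynomial.eval_mul, Polynomial.eval_C, Polynomial.eval_X]
    exact ⟨hspec.1, hspec.2.trans (if_congr decide_eq_true_iff rfl rfl)⟩
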